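/- **Setting.** Let $T$ be a hyperbolic automorphism of $\mathbb T^2=\mathbb R^2/\mathbb Z^2$ given by $M=M_T=\begin{pmatrix}a&b\\c&d\end{pmatrix}\in GL(2,\mathbb Z)$ (no eigenvalue of modulus $1$) with trace $r=a+d>0$. Put $\sigma=\det M$, $D=r^2-4\sigma$, $\lambda=\frac{r+\sqrt D}2>1$ and $f_T(x,y)=bx^2-(a-d)xy-cy^2$. The matrix $M$ is *primitive* if there are no $K\in GL(2,\mathbb Z)$ and $n\ge2$ with $M=K^n$; two matrices are *algebraically conjugate* if they are conjugate in $GL(2,\mathbb Z)$. The Dirichlet group is $\mathcal U_D=\{\frac{x+y\sqrt D}2: x,y\in\mathbb Z,\ x^2-Dy^2=\pm4\}$. A point $x\in\mathbb T^2$ is homoclinic if $T^nx\to0$ as $n\to\pm\infty$; its coordinates in $\mathbb R^2$ are those of its representative on the eigenline $\{v: Mv=\lambda v\}$. Let $\widetilde{\mathfrak X}$ be the additive semigroup of all two-sided sequences $\varepsilon=(\varepsilon_n)_{n\in\mathbb Z}$ of nonnegative integers such that $\sum_{n\ge1}\varepsilon_n\lambda^{-n}$ and $\sum_{n\ge1}\varepsilon_{-n}\lambda^{-n}$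 converge, with the topology of the metric $\sum_n|\varepsilon_n-\varepsilon'_n|\lambda^{-|n|}$ (on sets of sequences with uniformly bounded coordinates this is coordinatewise convergence), and let $\tau$ be the shift, $(\tau\varepsilon)_n=\varepsilon_{n+1}$. An *arithmetic coding* of $T$ is a pair $(\phi,\mathfrak X)$, where $\phi:\widetilde{\mathfrak X}\to\mathbb T^2$ is a continuous semigroup homomorphism with $\phi\tau=T\phi$, and $\mathfrak X\subset\widetilde{\mathfrak X}$ is a closed shift-invariant set such that * $\mathfrak X$ is total: if $\varepsilon\in\mathfrak X$, $N\in\mathbb Z$ and $\varepsilon'\in\widetilde{\mathfrak X}$ satisfies $(\varepsilon'_{N+k},\varepsilon'_{N+k+1},\dots)\prec_{\rm lex}(\varepsilon_N,\varepsilon_{N+1},\dots)$ for every $k\in\mathbb Z$, then $\varepsilon'\in\mathfrak X$; * $\phi|_{\mathfrak X}$ is surjective, and it is one-to-one on the set of sequences in $\mathfrak X$ with finitely many nonzero coordinates. A map $\phi$ is a *bijective arithmetic coding* (BAC) of $T$ if, for some $\mathfrak X$, the pair $(\phi,\mathfrak X)$ is an arithmetic coding and Lebesgue-almost every point of $\mathbb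 T^2$ has exactly one preimage in $\mathfrak X$. **Theorem 2.6.** 1. $T$ admits a BAC only if $M$ is primitive, with the exception of the case $M=K^2$, where $K$ is algebraically conjugate to $\begin{pmatrix}1&1\\1&0\end{pmatrix}$; in this case $M$ is not primitive and $T$ does admit a BAC. 2. $T$ admits a BAC if and only if one of the equations $f_T(x,y)=\pm1$ is solvable in integers. Suppose that this is so. * If $M$ is primitive, then $\mathcal U_D=\{\pm\lambda^k: k\in\mathbb Z\}$, and there is a homoclinic point with coordinates $(\xi_0,\eta_0)$ in $\mathbb R^2$ such that the BACs of $T$ are exactly the maps $$\phi_k^{\pm}(\varepsilon)=\Bigl(\sum_{n=-\infty}^{\infty}\varepsilon_n\lambda^{-n}\Bigr)\begin{pmatrix}\pm\xi_0\lambda^k\\ \pm\eta_0\lambda^k\end{pmatrix}\bmod\mathbb Z^2,\qquad k\in\mathbb Z,$$ where the two-sided series is the limit modulo $\mathbb Z^2$ of the sums over $|n|\le N$ as $N\to\infty$. The correspondence $\pm\lambda^k\leftrightarrow\phi_k^\pm$ between $\mathcal U_D$ and the set of all BACs is one-to-one. * If $M$ is not primitive, then $\lambda=\frac{3+\sqrt5}2$,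 and with $\theta=\sqrt\lambda=\frac{1+\sqrt5}2$ one has $\mathcal U_D=\{\pm\theta^k: k\in\mathbb Z\}$, and there is a homoclinic point with coordinates $(\xi_0,\eta_0)$ in $\mathbb R^2$ such that the BACs of $T$ are exactly the maps $$\phi_k^{\pm}(\varepsilon)=\Bigl(\sum_{n=-\infty}^{\infty}\varepsilon_n\lambda^{-n}\Bigr)\begin{pmatrix}\pm\xi_0\theta^k\\ \pm\eta_0\theta^k\end{pmatrix}\bmod\mathbb Z^2,\qquad k\in\mathbb Z,$$ again with a one-to-one correspondence $\pm\theta^k\leftrightarrow\phi_k^\pm$ between $\mathcal U_D$ and the set of all BACs. -/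

import Mathlib

open Filter Topology MeasureTheory

namespace ArithmeticCoding

/-! ### Integer matrices and toral automorphisms -/

/-- The automorphism `T` of the torus `ℝ² / ℤ²` given by a matrix `M ∈ GL(2, ℤ)`. -/
def toralMap (M : GL (Fin 2) ℤ) (x : UnitAddTorus (Fin 2)) : UnitAddTorus (Fin 2) :=
  fun i => ∑ j, M.1 i j • x j

/-- Reduction modulo `ℤ²`. -/
def torusProj (v : Fin 2 → ℝ) : UnitAddTorus (Fin 2) := fun i => (v i : UnitAddCircle)

/-- The matrix has no eigenvalue on the unit circle. -/
def IsHyperbolicMatrix (M : GL (Fin 2) ℤ) : Prop :=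
  ∀ μ ∈ spectrum ℂ (M.1.map (Int.cast : ℤ → ℂ)), ‖μ‖ ≠ 1

/-- The discriminant `D = r² - 4σ` of the characteristic polynomial `x² - r x + σ`. -/
def discrim (M : GL (Fin 2) ℤ) : ℤ := M.1.trace ^ 2 - 4 * M.1.det

/-- The eigenvalue `λ = (r + √D) / 2`. -/
noncomputable def eigen (M : GL (Fin 2) ℤ) : ℝ :=
  ((M.1.trace : ℝ) + √(discrim M : ℝ)) / 2

/-- A matrix of `GL(2, ℤ)` is primitive if it is not a proper power in `GL(2, ℤ)`. -/
def IsPrimitiveMatrix (M : GL (Fin 2) ℤ) : Prop :=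
  ¬ ∃ (K : GL (Fin 2) ℤ) (n : ℕ), 2 ≤ n ∧ M = K ^ n

/-- The Fibonacci matrix as an element of `GL(2, ℤ)`. -/
noncomputable def fibMatrix : GL (Fin 2) ℤ :=
  Matrix.GeneralLinearGroup.mk'' !![1, 1; 1, 0] (by simp [Matrix.det_fin_two])

/-- `M = K²` with `K` conjugate in `GL(2, ℤ)` to the Fibonacci matrix. -/
def IsFibSquare (M : GL (Fin 2) ℤ) : Prop :=
  ∃ K : GL (Fin 2) ℤ, IsConj K fibMatrix ∧ M = K ^ 2

/-- The binary quadratic form `b x² - (a - d) x y - c y²` associated with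
`M = [[a, b], [c, d]]`. -/
def assocForm (M : GL (Fin 2) ℤ) (x y : ℤ) : ℤ :=
  M.1 0 1 * x ^ 2 - (M.1 0 0 - M.1 1 1) * x * y - M.1 1 0 * y ^ 2

/-- One of the two equations `f_T(x, y) = ± 1` is solvable in integers. -/
def RepresentsUnit (M : GL (Fin 2) ℤ) : Prop :=
  ∃ x y : ℤ, assocForm M x y = 1 ∨ assocForm M x y = -1

/-- The set of all `± μ ^ k`, `k ∈ ℤ`. -/
def signedPowers (μ : ℝ) : Set ℝ := {u | ∃ k : ℤ, u = μ ^ k ∨ u = -μ ^ k}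

/-- The Dirichlet group: the numbers `(x + y √D) / 2` with `x² - D y² = ± 4`. -/
def dirichletGroup (D : ℤ) : Set ℝ :=
  {u | ∃ x y : ℤ, (x ^ 2 - D * y ^ 2 = 4 ∨ x ^ 2 - D * y ^ 2 = -4) ∧
    u = ((x : ℝ) + y * √(D : ℝ)) / 2}

/-- `x` is homoclinic to zero: `Tⁿ x → 0` as `n → ± ∞`. -/
def IsHomoclinic (M : GL (Fin 2) ℤ) (x : UnitAddTorus (Fin 2)) : Prop :=
  Tendsto (fun n : ℤ => toralMap (M ^ n) x) atTop (𝓝 0) ∧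
    Tendsto (fun n : ℤ => toralMap (M ^ n) x) atBot (𝓝 0)

/-- `v` gives the coordinates in `ℝ²` of a homoclinic point: `v` is its representative on the
unstable eigenline, the line of eigenvectors for `λ`. -/
def IsHomoclinicCoord (M : GL (Fin 2) ℤ) (v : Fin 2 → ℝ) : Prop :=
  (M.1.map (Int.cast : ℤ → ℝ)).mulVec v = eigen M • v ∧ IsHomoclinic M (torusProj v)

/-! ### The primary symbolic space -/

/-- The semigroup of two-sided sequences of nonnegative integers for which both
`∑ ε_n λ⁻ⁿ` and `∑ ε_{-n} λ⁻ⁿ` (`n ≥ 0`) converge. -/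
def primarySet (lam : ℝ) : AddSubmonoid (ℤ → ℕ) where
  carrier := {ε | Summable (fun n : ℕ => (ε n : ℝ) * lam⁻¹ ^ n) ∧
    Summable (fun n : ℕ => (ε (-n) : ℝ) * lam⁻¹ ^ n)}
  zero_mem' := by
    constructor <;> simp
  add_mem' := by
    rintro a b ⟨ha, ha'⟩ ⟨hb, hb'⟩
    refine ⟨(ha.add hb).congr fun n => ?_, (ha'.add hb').congr fun n => ?_⟩ <;>
    · simp only [Pi.add_apply, Nat.cast_add]
      ring

/-- The primary symbolic space, a type of its own so that it does not inherit the topology of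
coordinatewise convergence. -/
def PrimarySpace (lam : ℝ) : Type := primarySet lam

instance (lam : ℝ) : AddCommMonoid (PrimarySpace lam) :=
  inferInstanceAs (AddCommMonoid (primarySet lam))

/-- The `n`-th coordinate of a sequence. -/
def PrimarySpace.digit {lam : ℝ} (ε : PrimarySpace lam) (n : ℤ) : ℕ := Subtype.val ε n

/-- The weighted sequence `(ε_n λ^{-|n|})_n` as an element of `ℓ¹(ℤ)`. -/
noncomputable def PrimarySpace.toL1 {lam : ℝ} (ε : PrimarySpace lam) :
    lp (fun _ : ℤ => ℝ) 1 :=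
  ⟨fun n => (ε.digit n : ℝ) * lam⁻¹ ^ n.natAbs, by
    refine memℓp_gen ?_
    have h := Subtype.property ε
    have h1 : Summable fun n : ℤ => (ε.digit n : ℝ) * lam⁻¹ ^ n.natAbs := by
      refine Summable.of_nat_of_neg ?_ ?_
      · simpa [PrimarySpace.digit] using h.1
      · simpa [PrimarySpace.digit] using h.2
    simpa using h1.abs⟩

/-- The natural topology of the primary space: `ε^{(j)} → ε` if and only if
`∑_n |ε^{(j)}_n - ε_n| λ^{-|n|} → 0`. On every set of sequences with uniformly bounded
digits it is, for `λ > 1`, the topology of coordinatewise convergence. -/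
noncomputable instance (lam : ℝ) : TopologicalSpace (PrimarySpace lam) :=
  TopologicalSpace.induced PrimarySpace.toL1 inferInstance

/-- The shift `τ`, `(τ ε)_n = ε_{n+1}`. -/
def PrimarySpace.shift {lam : ℝ} (ε : PrimarySpace lam) : PrimarySpace lam :=
  ⟨fun n => ε.digit (n + 1), by
    have h := Subtype.property ε
    constructor
    · rcases eq_or_ne lam 0 with rfl | hl
      · refine summable_of_ne_finset_zero (s := {0}) fun n hn => ?_
        have : n ≠ 0 := by simpa using hn
        simp [this]
      · have h1 := ((summable_nat_add_iff 1).2 h.1).mul_left lam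
        refine h1.congr fun n => ?_
        simp only [PrimarySpace.digit, Nat.cast_add, Nat.cast_one, pow_succ]
        field_simp
    · refine (summable_nat_add_iff 1).1 ?_
      refine (h.2.mul_right lam⁻¹).congr fun n => ?_
      have e : (-((n + 1 : ℕ) : ℤ) + 1) = -(n : ℤ) := by push_cast; ring
      simp only [PrimarySpace.digit, e, pow_succ]
      ring⟩

/-- A sequence is finite if only finitely many of its coordinates are nonzero. -/
def PrimarySpace.IsFiniteSeq {lam : ℝ} (ε : PrimarySpace lam) : Prop :=
  {n : ℤ | ε.digit n ≠ 0}.Finite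

/-- The one-sided sequence `(ε_N, ε_{N+1}, …)`. -/
def PrimarySpace.tail {lam : ℝ} (ε : PrimarySpace lam) (N : ℤ) : ℕ → ℕ :=
  fun j => ε.digit (N + j)

/-- Strict lexicographic order on one-sided sequences. -/
def LexLess (a b : ℕ → ℕ) : Prop := ∃ n, (∀ m < n, a m = b m) ∧ a n < b n

/-- `X` is total: together with `ε` it contains each `ε'` all of whose tails are
lexicographically less than one fixed tail of `ε`. -/
def IsTotal {lam : ℝ} (X : Set (PrimarySpace lam)) : Prop :=
  ∀ ε ∈ X, ∀ ε' : PrimarySpace lam,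
    (∃ N : ℤ, ∀ k : ℤ, LexLess (ε'.tail (N + k)) (ε.tail N)) → ε' ∈ X

/-! ### Arithmetic codings -/

/-- `(φ, X)` is an arithmetic coding of the automorphism given by `M`. -/
structure IsArithmeticCoding (M : GL (Fin 2) ℤ)
    (φ : PrimarySpace (eigen M) →+ UnitAddTorus (Fin 2))
    (X : Set (PrimarySpace (eigen M))) : Prop where
  continuous : Continuous φ
  equivariant : ∀ ε, φ ε.shift = toralMap M (φ ε)
  closed : IsClosed X
  shift_invariant : ∀ ε, ε.shift ∈ X ↔ ε ∈ X
  total : IsTotal X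
  surjOn : Set.SurjOn φ X Set.univ
  injOn_finite : Set.InjOn φ {ε | ε ∈ X ∧ ε.IsFiniteSeq}

/-- `φ` is a bijective arithmetic coding (BAC): for some `X` the pair `(φ, X)` is an arithmetic
coding and Lebesgue almost every point of the torus has exactly one preimage in `X`. -/
def IsBAC (M : GL (Fin 2) ℤ) (φ : PrimarySpace (eigen M) →+ UnitAddTorus (Fin 2)) : Prop :=
  ∃ X : Set (PrimarySpace (eigen M)), IsArithmeticCoding M φ X ∧
    ∀ᵐ x : UnitAddTorus (Fin 2), ∃! ε, ε ∈ X ∧ φ ε = x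

/-- The automorphism given by `M` admits a bijective arithmetic coding. -/
def AdmitsBAC (M : GL (Fin 2) ℤ) : Prop := ∃ φ, IsBAC M φ

/-- `φ(ε) = (∑_n ε_n λ⁻ⁿ) v mod ℤ²` for all `ε`, the two-sided series being the limit modulo `ℤ²`
of its symmetric partial sums. -/
def IsGivenBy (M : GL (Fin 2) ℤ) (φ : PrimarySpace (eigen M) →+ UnitAddTorus (Fin 2))
    (v : Fin 2 → ℝ) : Prop :=
  ∀ ε, Tendsto (fun N : ℕ => torusProj
    ((∑ n ∈ Finset.Icc (-(N : ℤ)) N, (ε.digit n : ℝ) * eigen M ^ (-n)) • v)) atTop (𝓝 (φ ε))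

/-- The BACs of `M` are exactly the maps given by the vectors `u v`, `u ∈ U`, and this is a
one-to-one correspondence between `U` and the set of all BACs. -/
def ParametrizesBACs (M : GL (Fin 2) ℤ) (U : Set ℝ) (v : Fin 2 → ℝ) : Prop :=
  (∀ u ∈ U, ∃! φ, IsBAC M φ ∧ IsGivenBy M φ (u • v)) ∧
    ∀ φ, IsBAC M φ → ∃! u, u ∈ U ∧ IsGivenBy M φ (u • v)

end ArithmeticCoding

open ArithmeticCoding

namespace ArithmeticCoding

/-! ### Values of one-sided digit sequences -/

/-! A continuous equivariant homomorphism `φ` is determined by its value at `single 0`. The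
sequences `single n` tend to zero as `|n| → ∞`, so this value is homoclinic. Lifting its two
half-orbits to the plane gives one representative on the stable line and one on the unstable line.
They differ by an integer vector `m`, and the unstable one is the projection of `m` along the stable
line. Hence `φ` is `matrixCoding m`: the coding of the companion matrix followed by the integer
matrix with columns `m` and `M m` (`exists_eq_matrixCoding`).

For the companion matrix the sequences with no tail above the quasi-greedy expansion of `1` form a
good symbolic set, `betaSet`. Greedy expansions put half of the unstable line into its image; that
image is compact and an irrational half-line is dense, so the coding is onto (`coding_surjOn`). The
future and past coordinates of admissible sequences stay in a region of area `λ - λ'`, with `λ' = σ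
/ λ`, which is area one in the plane. A set of area at most one that covers the torus covers almost
every point once (`ae_coding_injOn`). So every `m` whose matrix has determinant `±1` yields a BAC.

Conversely, a closed total set `X` that codes the whole torus contains `betaSet`: if it missed a
finite admissible sequence, all tails in `X` would be bounded by a sequence of value less than one,
and such a family codes only a null set (`betaSet_subset`). A kernel of the integer matrix would
then give every point several preimages in `X`, so the determinant is `±1`. Up to sign that
determinant is `f_T`, which gives the criterion.

Once one such `m` exists, the others are `(a + b M) m` with `a² + a b r + b² σ = ±1`, and `a + b M`
acts on the unstable line as `a + b λ`. These numbers are exactly the Dirichlet group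
(`parametrizesBACs`). No unit lies strictly between `1` and `λ` unless `r = 3` and `σ = 1`. Outside
that case the group is `±λ^k`, and `M = K^n` would give a unit `κ` with `κ^n = λ`, which forces `n =
1`. In the exceptional case `M - 1` is a square root of `M` conjugate to the Fibonacci matrix, and
`D = 5` is also the discriminant belonging to the golden mean. -/

/-- The sequence `(a_k, a_{k+1}, …)`. -/
def dropSeq (k : ℕ) (a : ℕ → ℕ) : ℕ → ℕ := fun j => a (k + j)

/-- The value `∑ a_j μ^{j+1}` of a digit sequence. -/
noncomputable def seqVal (μ : ℝ) (a : ℕ → ℕ) : ℝ := ∑' j, (a j : ℝ) * μ ^ (j + 1)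

/-- Convergence of the series defining `seqVal`. -/
def SeqSummable (μ : ℝ) (a : ℕ → ℕ) : Prop := Summable fun j => (a j : ℝ) * μ ^ (j + 1)

/-- No tail of `a` is lexicographically greater than `d`. -/
def LexAdm (d a : ℕ → ℕ) : Prop := ∀ k, ¬ LexLess d (dropSeq k a)

@[simp] lemma dropSeq_zero (a : ℕ → ℕ) : dropSeq 0 a = a := by
  funext j; simp [dropSeq]

lemma dropSeq_dropSeq (k l : ℕ) (a : ℕ → ℕ) :
    dropSeq k (dropSeq l a) = dropSeq (l + k) a := by
  funext j; simp [dropSeq, add_assoc]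

lemma lexLess_iff (a b : ℕ → ℕ) : LexLess a b ↔ toLex a < toLex b := Iff.rfl

lemma lexLess_trans {a b c : ℕ → ℕ} (h : LexLess a b) (h' : LexLess b c) : LexLess a c :=
  (lexLess_iff a c).2 (lt_trans ((lexLess_iff a b).1 h) ((lexLess_iff b c).1 h'))

lemma lexLess_trichotomy (a b : ℕ → ℕ) : LexLess a b ∨ a = b ∨ LexLess b a := by
  rcases lt_trichotomy (toLex a) (toLex b) with h | h | h
  · exact Or.inl h
  · exact Or.inr (Or.inl h)
  · exact Or.inr (Or.inr h)

lemma not_lexLess_iff (a b : ℕ → ℕ) : ¬ LexLess a b ↔ toLex b ≤ toLex a :=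
  (not_congr (lexLess_iff a b)).trans not_lt

lemma lexLess_of_head {a b : ℕ → ℕ} (h : a 0 < b 0) : LexLess a b :=
  ⟨0, by simp, h⟩

lemma LexAdm.drop {d a : ℕ → ℕ} (h : LexAdm d a) (k : ℕ) : LexAdm d (dropSeq k a) := by
  intro l
  rw [dropSeq_dropSeq]
  exact h _

lemma LexAdm.le_head {d a : ℕ → ℕ} (h : LexAdm d a) (k : ℕ) : a k ≤ d 0 := by
  by_contra! hk
  exact h k (lexLess_of_head (by simpa [dropSeq] using hk))

section
variable {μ : ℝ} (h0 : 0 < μ) (h1 : μ < 1)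
include h0 h1

lemma seqSummable_of_le {a : ℕ → ℕ} {B : ℕ} (h : ∀ j, a j ≤ B) : SeqSummable μ a := by
  refine Summable.of_nonneg_of_le (fun j => by positivity) (fun j => ?_)
    (((summable_geometric_of_lt_one h0.le h1).mul_left ((B : ℝ) * μ)))
  rw [pow_succ', ← mul_assoc]
  have : (a j : ℝ) ≤ B := by exact_mod_cast h j
  gcongr

lemma seqVal_le_of_le {a : ℕ → ℕ} {B : ℕ} (h : ∀ j, a j ≤ B) :
    seqVal μ a ≤ B * μ * (1 - μ)⁻¹ := by
  rw [← tsum_geometric_of_lt_one h0.le h1, ← tsum_mul_left]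
  refine Summable.tsum_le_tsum (fun j => ?_) (seqSummable_of_le h0 h1 h)
    (((summable_geometric_of_lt_one h0.le h1).mul_left ((B : ℝ) * μ)))
  rw [pow_succ', ← mul_assoc]
  have : (a j : ℝ) ≤ B := by exact_mod_cast h j
  gcongr

omit h1 in
lemma seqVal_nonneg (a : ℕ → ℕ) : 0 ≤ seqVal μ a :=
  tsum_nonneg fun j => by positivity

omit h1 in
lemma SeqSummable.drop {a : ℕ → ℕ} (h : SeqSummable μ a) (k : ℕ) :
    SeqSummable μ (dropSeq k a) := by
  have h2 := ((summable_nat_add_iff k).2 h).mul_left ((μ ^ k)⁻¹)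
  refine h2.congr fun j => ?_
  simp only [dropSeq]
  rw [show j + k + 1 = k + (j + 1) by ring, pow_add, add_comm j k]
  field_simp

omit h0 h1 in
lemma seqVal_split {a : ℕ → ℕ} (h : SeqSummable μ a) (k : ℕ) :
    seqVal μ a = ∑ j ∈ Finset.range k, (a j : ℝ) * μ ^ (j + 1) + μ ^ k * seqVal μ (dropSeq k a) := by
  unfold seqVal
  rw [← h.sum_add_tsum_nat_add k, ← tsum_mul_left]
  congr 2
  funext j
  simp only [dropSeq]
  rw [show j + k + 1 = k + (j + 1) by ring, pow_add, add_comm j k]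
  ring

omit h0 h1 in
lemma seqVal_succ {a : ℕ → ℕ} (h : SeqSummable μ a) :
    seqVal μ a = μ * (a 0 + seqVal μ (dropSeq 1 a)) := by
  rw [seqVal_split h 1]
  simp
  ring

omit h1 in
lemma sum_range_le_seqVal {a : ℕ → ℕ} (h : SeqSummable μ a) (k : ℕ) :
    ∑ j ∈ Finset.range k, (a j : ℝ) * μ ^ (j + 1) ≤ seqVal μ a :=
  h.sum_le_tsum _ fun j _ => by positivity

omit h0 h1 in
/-- The expansion of a value at the first place where two sequences differ. -/
lemma seqVal_eq_of_agree {a b : ℕ → ℕ} (ha : SeqSummable μ a) {i : ℕ}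
    (hab : ∀ m < i, a m = b m) :
    seqVal μ a = ∑ j ∈ Finset.range i, (b j : ℝ) * μ ^ (j + 1) + a i * μ ^ (i + 1) +
      μ ^ (i + 1) * seqVal μ (dropSeq (i + 1) a) := by
  rw [seqVal_split ha (i + 1), Finset.sum_range_succ]
  congr 2
  exact Finset.sum_congr rfl fun j hj => by rw [hab j (Finset.mem_range.1 hj)]

-- At the first difference `a` loses at least `μ^(i+1)`, and only its later tail can make up for the
-- loss. The lemmas relating lexicographic order to value rest on this inequality.
omit h1 in
lemma seqVal_le_of_lexLess {a b : ℕ → ℕ} (ha : SeqSummable μ a) (hb : SeqSummable μ b)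
    {i : ℕ} (hab : ∀ m < i, a m = b m) (hi : a i < b i) :
    seqVal μ a ≤ seqVal μ b + μ ^ (i + 1) * (seqVal μ (dropSeq (i + 1) a) - 1) := by
  rw [seqVal_eq_of_agree ha hab]
  have h2 := sum_range_le_seqVal h0 hb (i + 1)
  rw [Finset.sum_range_succ] at h2
  have h3 : (a i : ℝ) + 1 ≤ b i := by exact_mod_cast hi
  have h4 : ((a i : ℝ) + 1) * μ ^ (i + 1) ≤ b i * μ ^ (i + 1) := by gcongr
  nlinarith

/-- A bounded family that improves its excess over a bound by a factor `μ` obeys the bound. -/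
lemma le_of_contracting {ι : Type*} {f : ι → ℝ} {P : ι → Prop} {b C : ℝ} (hC0 : 0 ≤ C)
    (hC : ∀ k, P k → f k ≤ b + C)
    (hstep : ∀ t, 0 ≤ t → (∀ k, P k → f k ≤ b + t) → ∀ k, P k → f k ≤ b + μ * t) :
    ∀ k, P k → f k ≤ b := by
  have key : ∀ n : ℕ, ∀ k, P k → f k ≤ b + μ ^ n * C := by
    intro n
    induction n with
    | zero => simpa using hC
    | succ n ih =>
      have := hstep _ (by positivity) ih
      intro k hk
      rw [pow_succ', mul_assoc]
      exact this k hk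
  intro k hk
  have hlim : Tendsto (fun n : ℕ => b + μ ^ n * C) atTop (𝓝 (b + 0 * C)) :=
    ((tendsto_pow_atTop_nhds_zero_of_lt_one h0.le h1).mul_const C).const_add b
  rw [zero_mul, add_zero] at hlim
  exact ge_of_tendsto' hlim fun n => key n k hk

lemma LexAdm.seqSummable {d a : ℕ → ℕ} (h : LexAdm d a) : SeqSummable μ a :=
  seqSummable_of_le h0 h1 h.le_head

/-- All tails of `a` have value at most one: if they exceed one by at most `t`, comparison with `d`
at the first difference improves this to `μ t`. With tails bounded by one, a digit lost against `w`
is never recovered. -/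
lemma LexAdm.seqVal_le {d w a : ℕ → ℕ} (hd : SeqSummable μ d) (hdv : seqVal μ d = 1)
    (ha : LexAdm d a) (hw : SeqSummable μ w)
    (haw : ¬ LexLess w a) : seqVal μ a ≤ seqVal μ w := by
  have h2 : ∀ k : ℕ, True → seqVal μ (dropSeq k a) ≤ 1 := by
    have hnn : 0 ≤ (d 0 : ℝ) * μ * (1 - μ)⁻¹ :=
      mul_nonneg (by positivity) (inv_nonneg.2 (by linarith))
    refine le_of_contracting h0 h1 hnn (fun k _ => ?_) ?_
    · have := seqVal_le_of_le h0 h1 (ha.drop k).le_head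
      linarith
    · intro t ht hall k _
      rcases lexLess_trichotomy (dropSeq k a) d with h | h | h
      · obtain ⟨i, hi, hi'⟩ := h
        have h3 := seqVal_le_of_lexLess h0 ((ha.drop k).seqSummable h0 h1) hd hi hi'
        rw [dropSeq_dropSeq] at h3
        have h4 := hall (k + (i + 1)) trivial
        have h5 : μ ^ (i + 1) * (seqVal μ (dropSeq (k + (i + 1)) a) - 1) ≤ μ ^ (i + 1) * t := by
          gcongr; linarith
        have h6 : μ ^ (i + 1) * t ≤ μ * t := by
          gcongr
          exact pow_le_of_le_one h0.le h1.le (by simp)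
        linarith
      · rw [h, hdv]
        have : 0 ≤ μ * t := by positivity
        linarith
      · exact absurd h (ha k)
  rcases lexLess_trichotomy a w with h | h | h
  · obtain ⟨i, hi, hi'⟩ := h
    have h3 := seqVal_le_of_lexLess h0 (ha.seqSummable h0 h1) hw hi hi'
    have h4 : μ ^ (i + 1) * (seqVal μ (dropSeq (i + 1) a) - 1) ≤ 0 :=
      mul_nonpos_of_nonneg_of_nonpos (by positivity) (by linarith [h2 (i + 1) trivial])
    linarith
  · rw [h]
  · exact absurd h haw

lemma LexAdm.seqVal_le_one {d a : ℕ → ℕ} (hd : SeqSummable μ d) (hdv : seqVal μ d = 1)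
    (ha : LexAdm d a) : seqVal μ a ≤ 1 := by
  have := ha.seqVal_le h0 h1 hd hdv hd (by simpa using ha 0)
  rwa [hdv] at this

/-- Finite admissible sequences have value less than one. -/
lemma LexAdm.seqVal_lt_one {d a : ℕ → ℕ} (hd : SeqSummable μ d) (hdv : seqVal μ d = 1)
    (hinf : ∀ n, ∃ m, n ≤ m ∧ d m ≠ 0) (ha : LexAdm d a) {n : ℕ} (hn : ∀ m, n ≤ m → a m = 0) :
    seqVal μ a < 1 := by
  -- `l` bounds the number of places left before `a` vanishes. Each comparison with `d` moves at
  -- least one place on, and equality with `d` is impossible because `d` has infinitely many nonzero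
  -- digits.
  have key : ∀ l k : ℕ, n ≤ k + l → seqVal μ (dropSeq k a) < 1 := by
    intro l
    induction l using Nat.strong_induction_on with
    | _ l ih =>
      intro k hk
      rcases lexLess_trichotomy (dropSeq k a) d with h | h | h
      · obtain ⟨i, hi, hi'⟩ := h
        have h3 := seqVal_le_of_lexLess h0 ((ha.drop k).seqSummable h0 h1) hd hi hi'
        rw [dropSeq_dropSeq] at h3
        have h5 : seqVal μ (dropSeq (k + (i + 1)) a) < 1 := by
          rcases Nat.eq_zero_or_pos l with hl | hl
          · have : dropSeq (k + (i + 1)) a = 0 := by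
              funext j; exact hn _ (by omega)
            rw [this]; simp [seqVal]
          · exact ih (l - 1) (by omega) _ (by omega)
        have h4 : μ ^ (i + 1) * (seqVal μ (dropSeq (k + (i + 1)) a) - 1) < 0 :=
          mul_neg_of_pos_of_neg (by positivity) (by linarith)
        linarith
      · obtain ⟨m, hm, hm'⟩ := hinf n
        exact absurd (hn (k + m) (by omega)) (by rw [← h] at hm'; exact hm')
      · exact absurd h (ha k)
  simpa using key n 0 (by omega)

omit h1 in
/-- Sequences all of whose tails have value less than one are admissible. -/
lemma lexAdm_of_seqVal_lt_one {d a : ℕ → ℕ} (hd : SeqSummable μ d) (hdv : seqVal μ d = 1)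
    (hdt : ∀ k, seqVal μ (dropSeq k d) ≤ 1) (has : SeqSummable μ a)
    (ha : ∀ k, seqVal μ (dropSeq k a) < 1) : LexAdm d a := by
  rintro k ⟨i, hi, hi'⟩
  have h3 := seqVal_le_of_lexLess h0 hd (has.drop h0 k) hi hi'
  have h4 : μ ^ (i + 1) * (seqVal μ (dropSeq (i + 1) d) - 1) ≤ 0 :=
    mul_nonpos_of_nonneg_of_nonpos (by positivity) (by linarith [hdt (i + 1)])
  linarith [ha k]

omit h1 in
/-- Among sequences with tails of value less than one the value is determined by the sequence. -/
lemma eq_of_seqVal_eq {a b : ℕ → ℕ} (has : SeqSummable μ a) (hbs : SeqSummable μ b)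
    (ha : ∀ k, seqVal μ (dropSeq k a) < 1) (hb : ∀ k, seqVal μ (dropSeq k b) < 1)
    (hab : seqVal μ a = seqVal μ b) : a = b := by
  rcases lexLess_trichotomy a b with ⟨i, hi, hi'⟩ | h | ⟨i, hi, hi'⟩
  · have h3 := seqVal_le_of_lexLess h0 has hbs hi hi'
    have h4 : μ ^ (i + 1) * (seqVal μ (dropSeq (i + 1) a) - 1) < 0 :=
      mul_neg_of_pos_of_neg (by positivity) (by linarith [ha (i + 1)])
    linarith
  · exact h
  · have h3 := seqVal_le_of_lexLess h0 hbs has hi hi'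
    have h4 : μ ^ (i + 1) * (seqVal μ (dropSeq (i + 1) b) - 1) < 0 :=
      mul_neg_of_pos_of_neg (by positivity) (by linarith [hb (i + 1)])
    linarith

/-- If all tails of the sequences in a family are at most `w` and `w` has value less than one,
then the values of the family form a null set. -/
lemma volume_seqVal_eq_zero {w : ℕ → ℕ} (hw : SeqSummable μ w) (hw1 : seqVal μ w < 1) :
    volume {x : ℝ | ∃ a, LexAdm w a ∧ seqVal μ a = x} = 0 := by
  set E := {x : ℝ | ∃ a, LexAdm w a ∧ seqVal μ a = x} with hE
  have hfin : volume E ≠ ⊤ := by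
    refine ne_top_of_le_ne_top ?_ (measure_mono (?_ : E ⊆ Set.Icc 0 ((w 0 : ℝ) * μ * (1 - μ)⁻¹)))
    · simp
    · rintro x ⟨a, ha, rfl⟩
      exact ⟨seqVal_nonneg h0 a, seqVal_le_of_le h0 h1 ha.le_head⟩
  -- Self-similarity: a sequence leaving `w` at place `i` has one of `w i` smaller digits there,
  -- followed by another member of the family. The copies of `E` are scaled by `μ^(i+1)`, so their
  -- total factor is the value of `w`, less than one; since `volume E` is finite, it must vanish.
  have hcover : E ⊆ {seqVal μ w} ∪ ⋃ i : ℕ, ⋃ b ∈ Finset.range (w i),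
      (fun z : ℝ => (∑ j ∈ Finset.range i, (w j : ℝ) * μ ^ (j + 1) + b * μ ^ (i + 1)) +
        μ ^ (i + 1) * z) '' E := by
    rintro x ⟨a, ha, rfl⟩
    rcases lexLess_trichotomy a w with ⟨i, hi, hi'⟩ | h | h
    · right
      simp only [Set.mem_iUnion]
      refine ⟨i, a i, Finset.mem_range.2 hi', seqVal μ (dropSeq (i + 1) a), ⟨_, ha.drop _, rfl⟩, ?_⟩
      exact (seqVal_eq_of_agree (ha.seqSummable h0 h1) hi).symm
    · left; simp [h]
    · exact absurd h (by simpa using ha 0)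
  have hpiece : ∀ (i : ℕ) (c : ℝ), volume ((fun z : ℝ => c + μ ^ (i + 1) * z) '' E) =
      ENNReal.ofReal (μ ^ (i + 1)) * volume E := by
    intro i c
    have : (fun z : ℝ => c + μ ^ (i + 1) * z) '' E =
        (fun z => c + z) '' ((fun z : ℝ => (μ ^ (i + 1)) • z) '' E) := by
      rw [Set.image_image]; rfl
    rw [this, Set.image_add_left, measure_preimage_add, Set.image_smul,
      Measure.addHaar_smul]
    simp [abs_of_pos h0]
  have hle : volume E ≤ ENNReal.ofReal (seqVal μ w) * volume E := by
    calc volume E ≤ _ := measure_mono hcover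
      _ ≤ volume {seqVal μ w} + _ := measure_union_le _ _
      _ ≤ 0 + ∑' i : ℕ, (w i : ENNReal) * (ENNReal.ofReal (μ ^ (i + 1)) * volume E) := by
          gcongr
          · simp
          · refine (measure_iUnion_le _).trans (ENNReal.tsum_le_tsum fun i => ?_)
            refine (measure_biUnion_finset_le _ _).trans ?_
            simp only [hpiece]
            simp
      _ = ENNReal.ofReal (seqVal μ w) * volume E := by
          rw [zero_add, seqVal, ENNReal.ofReal_tsum_of_nonneg (fun j => by positivity) hw,
            ← ENNReal.tsum_mul_right]
          refine tsum_congr fun i => ?_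
          rw [ENNReal.ofReal_mul (by positivity), ENNReal.ofReal_natCast, mul_assoc]
  by_contra hne
  have hlt : ENNReal.ofReal (seqVal μ w) < 1 := by
    rw [← ENNReal.ofReal_one]
    exact (ENNReal.ofReal_lt_ofReal_iff one_pos).2 hw1
  have := ENNReal.mul_lt_mul_left hne hfin hlt
  rw [one_mul] at this
  exact absurd hle (not_le.2 this)

end

/-! ### The primary space -/

lemma isOpen_lexLess (d : ℕ → ℕ) : IsOpen {a : ℕ → ℕ | LexLess d a} := by
  have : {a : ℕ → ℕ | LexLess d a} =
      ⋃ n, (⋂ m ∈ Finset.range n, {a : ℕ → ℕ | d m = a m}) ∩ {a | d n < a n} := by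
    ext a
    simp [LexLess]
  rw [this]
  refine isOpen_iUnion fun n => ((isOpen_biInter_finset fun m _ => ?_)).inter ?_
  · exact (isOpen_discrete {k | d m = k}).preimage (continuous_apply m)
  · exact (isOpen_discrete {k | d n < k}).preimage (continuous_apply n)

namespace PrimarySpace

variable {lam : ℝ}

/-- A two-sided sequence in the primary set as a point of the primary space. -/
def mk (e : ℤ → ℕ) (h : e ∈ primarySet lam) : PrimarySpace lam := ⟨e, h⟩

@[simp] lemma digit_mk (e : ℤ → ℕ) (h : e ∈ primarySet lam) (n : ℤ) : (mk e h).digit n = e n := rfl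

@[ext] lemma ext {a b : PrimarySpace lam} (h : ∀ n, a.digit n = b.digit n) : a = b :=
  Subtype.ext (funext h)

/-- The `n`-th digit as a homomorphism. -/
def digitHom (lam : ℝ) (n : ℤ) : PrimarySpace lam →+ ℕ where
  toFun ε := ε.digit n
  map_zero' := rfl
  map_add' _ _ := rfl

@[simp] lemma digit_zero (n : ℤ) : (0 : PrimarySpace lam).digit n = 0 := rfl

@[simp] lemma digit_add (a b : PrimarySpace lam) (n : ℤ) :
    (a + b).digit n = a.digit n + b.digit n := rfl

@[simp] lemma digit_nsmul (k : ℕ) (a : PrimarySpace lam) (n : ℤ) :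
    (k • a).digit n = k * a.digit n := by
  exact (map_nsmul (digitHom lam n) k a).trans (by rw [smul_eq_mul]; rfl)

@[simp] lemma digit_sum {ι : Type*} (s : Finset ι) (f : ι → PrimarySpace lam) (n : ℤ) :
    (∑ i ∈ s, f i).digit n = ∑ i ∈ s, (f i).digit n :=
  map_sum (digitHom lam n) f s

@[simp] lemma digit_shift (a : PrimarySpace lam) (n : ℤ) : a.shift.digit n = a.digit (n + 1) := rfl

lemma finite_mem_primarySet {e : ℤ → ℕ} (h : {n | e n ≠ 0}.Finite) : e ∈ primarySet lam := by
  constructor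
  · refine summable_of_hasFiniteSupport ((h.preimage (Nat.cast_injective.injOn)).subset ?_)
    intro n hn
    simp only [Function.mem_support] at hn
    simpa using left_ne_zero_of_mul hn
  · refine summable_of_hasFiniteSupport
      ((h.preimage ((neg_injective.comp Nat.cast_injective).injOn)).subset ?_)
    intro n hn
    simp only [Function.mem_support] at hn
    simpa using left_ne_zero_of_mul hn

/-- The sequence whose only nonzero digit is a `1` at place `n`. -/
def single (lam : ℝ) (n : ℤ) : PrimarySpace lam :=
  mk (fun m => if m = n then 1 else 0)
    (finite_mem_primarySet ((Set.finite_singleton n).subset fun m hm => by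
      by_contra h
      exact hm (if_neg h)))

@[simp] lemma digit_single (n m : ℤ) : (single lam n).digit m = if m = n then 1 else 0 := rfl

lemma shift_single (n : ℤ) : (single lam n).shift = single lam (n - 1) := by
  ext m
  simp only [digit_shift, digit_single]
  congr 1
  simp only [eq_iff_iff]
  omega

/-- The restriction of a sequence to the window `[-N, N]`. -/
noncomputable def trunc (N : ℕ) (ε : PrimarySpace lam) : PrimarySpace lam :=
  ∑ n ∈ Finset.Icc (-(N : ℤ)) N, ε.digit n • single lam n

lemma digit_trunc (N : ℕ) (ε : PrimarySpace lam) (n : ℤ) :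
    (trunc N ε).digit n = if n ∈ Finset.Icc (-(N : ℤ)) N then ε.digit n else 0 := by
  simp only [trunc, digit_sum, digit_nsmul, digit_single, mul_ite, mul_one, mul_zero,
    Finset.sum_ite_eq]

lemma digit_trunc_le (N : ℕ) (ε : PrimarySpace lam) (n : ℤ) :
    (trunc N ε).digit n ≤ ε.digit n := by
  rw [digit_trunc]; split_ifs <;> simp

lemma toL1_apply (ε : PrimarySpace lam) (n : ℤ) :
    ε.toL1 n = (ε.digit n : ℝ) * lam⁻¹ ^ n.natAbs := rfl

lemma isInducing_toL1 : IsInducing (toL1 : PrimarySpace lam → _) := ⟨rfl⟩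

lemma toL1_zero : (0 : PrimarySpace lam).toL1 = 0 := by
  ext n; simp [toL1_apply]

lemma continuous_digit (hl : lam ≠ 0) (n : ℤ) :
    Continuous fun ε : PrimarySpace lam => ε.digit n := by
  rw [Nat.isClosedEmbedding_coe_real.isInducing.continuous_iff]
  have h1 : Continuous fun f : lp (fun _ : ℤ => ℝ) 1 => f n :=
    (continuous_apply n).comp (lp.uniformContinuous_coe).continuous
  have h2 := (h1.comp (isInducing_toL1 (lam := lam)).continuous).mul_const (lam ^ n.natAbs : ℝ)
  refine h2.congr fun ε => ?_
  simp [toL1_apply, hl]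

lemma isClosed_lex (hl : lam ≠ 0) (d : ℕ → ℕ) :
    IsClosed {ε : PrimarySpace lam | ∀ N, ¬ LexLess d (ε.tail N)} := by
  rw [Set.ofPred_forall]
  refine isClosed_iInter fun N => ?_
  have h : Continuous fun ε : PrimarySpace lam => ε.tail N :=
    continuous_pi fun j => continuous_digit hl _
  exact ((isOpen_lexLess d).preimage h).isClosed_compl

lemma toL1_trunc (N : ℕ) (ε : PrimarySpace lam) :
    (trunc N ε).toL1 = ∑ n ∈ Finset.Icc (-(N : ℤ)) N, lp.single 1 n (ε.toL1 n) := by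
  ext n
  rw [toL1_apply, digit_trunc, lp.coeFn_sum, Finset.sum_apply]
  simp only [lp.coeFn_single, Pi.single_apply, Finset.sum_ite_eq, toL1_apply]
  split_ifs <;> simp

/-- Finite sequences are dense, so a continuous homomorphism is known from its values on `single n`,
and the symmetric partial sums converge to it. -/
lemma tendsto_trunc (ε : PrimarySpace lam) :
    Tendsto (fun N => trunc N ε) atTop (𝓝 ε) := by
  rw [isInducing_toL1.tendsto_nhds_iff]
  have := (lp.hasSum_single ENNReal.one_ne_top ε.toL1).comp (Finset.tendsto_Icc_neg (R := ℤ))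
  refine this.congr fun N => ?_
  simp only [Function.comp, toL1_trunc]

lemma toL1_single (n : ℤ) : (single lam n).toL1 = lp.single 1 n (lam⁻¹ ^ n.natAbs) := by
  ext m
  rw [toL1_apply, lp.coeFn_single, Pi.single_apply, digit_single]
  split_ifs with h
  · simp [h]
  · simp

lemma tendsto_single (hl : 1 < lam) {l : Filter ℤ} (h : Tendsto Int.natAbs l atTop) :
    Tendsto (fun n => single lam n) l (𝓝 0) := by
  rw [isInducing_toL1.tendsto_nhds_iff, toL1_zero, tendsto_zero_iff_norm_tendsto_zero]
  have h2 : Tendsto (fun n : ℕ => lam⁻¹ ^ n) atTop (𝓝 0) :=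
    tendsto_pow_atTop_nhds_zero_of_lt_one (by positivity) (inv_lt_one_of_one_lt₀ hl)
  refine (h2.comp h).congr fun n => ?_
  simp only [Function.comp, toL1_single]
  rw [lp.norm_single one_pos, Real.norm_of_nonneg (by positivity)]

/-- Bounded coefficients define a bounded functional on `ℓ¹`. The future coordinate uses `c = 1`,
the past coordinate `c j = σ^j`. -/
lemma continuous_tsum_toL1 {g : ℕ → ℤ} (hg : Function.Injective g) {c : ℕ → ℝ}
    (hc : ∀ j, |c j| ≤ 1) :
    Continuous fun ε : PrimarySpace lam => ∑' j, c j * ε.toL1 (g j) := by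
  have hs : ∀ f : lp (fun _ : ℤ => ℝ) 1, Summable fun n => ‖f n‖ := fun f => by
    simpa using (lp.hasSum_norm (p := 1) (by simp) f).summable
  have hs1 : ∀ f : lp (fun _ : ℤ => ℝ) 1, Summable fun j => ‖c j * f (g j)‖ := fun f => by
    refine Summable.of_nonneg_of_le (fun _ => norm_nonneg _) (fun j => ?_)
      ((hs f).comp_injective hg)
    rw [norm_mul]
    exact mul_le_of_le_one_left (norm_nonneg _) (hc j)
  have hs2 : ∀ f : lp (fun _ : ℤ => ℝ) 1, Summable fun j => c j * f (g j) :=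
    fun f => (hs1 f).of_norm
  let F : lp (fun _ : ℤ => ℝ) 1 →ₗ[ℝ] ℝ :=
    { toFun := fun f => ∑' j, c j * f (g j)
      map_add' := fun f f' => by
        rw [← (hs2 f).tsum_add (hs2 f')]
        exact tsum_congr fun j => by simp [mul_add]
      map_smul' := fun a f => by
        rw [RingHom.id_apply, smul_eq_mul, ← tsum_mul_left]
        exact tsum_congr fun j => by simp; ring }
  have hF : Continuous F := by
    refine (F.mkContinuous 1 fun f => ?_).continuous
    rw [one_mul]
    have h3 : ‖f‖ = ∑' n, ‖f n‖ := by
      rw [lp.norm_eq_tsum_rpow (by simp) f]; simp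
    rw [h3]
    refine (norm_tsum_le_tsum_norm (hs1 f)).trans ?_
    refine (Summable.tsum_le_tsum (fun j => ?_) (hs1 f) ((hs f).comp_injective hg)).trans
      (tsum_comp_le_tsum_of_inj (hs f) (fun _ => norm_nonneg _) hg)
    rw [norm_mul]
    exact mul_le_of_le_one_left (norm_nonneg _) (hc j)
  exact hF.comp isInducing_toL1.continuous

lemma tail_apply (ε : PrimarySpace lam) (N : ℤ) (j : ℕ) : ε.tail N j = ε.digit (N + j) := rfl

lemma dropSeq_tail (ε : PrimarySpace lam) (N : ℤ) (k : ℕ) :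
    dropSeq k (ε.tail N) = ε.tail (N + k) := by
  funext j
  simp only [dropSeq, tail_apply]
  congr 1; push_cast; ring

lemma lexAdm_tail {d : ℕ → ℕ} {ε : PrimarySpace lam} (h : ∀ N, ¬ LexLess d (ε.tail N)) (N : ℤ) :
    LexAdm d (ε.tail N) := fun k => by rw [dropSeq_tail]; exact h _

lemma tail_shift (ε : PrimarySpace lam) (N : ℤ) : ε.shift.tail N = ε.tail (N + 1) := by
  funext j
  simp only [tail_apply, digit_shift]
  congr 1; ring

lemma seqSummable_tail_one (ε : PrimarySpace lam) :
    SeqSummable lam⁻¹ (ε.tail 1) := by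
  have h := (summable_nat_add_iff 1).2 (Subtype.property ε).1
  refine h.congr fun n => ?_
  simp only [tail_apply, digit]
  rw [show ((n + 1 : ℕ) : ℤ) = 1 + n by push_cast; ring]

/-- Tails of the primary space give summable one-sided sequences. -/
lemma seqSummable_tail (hl : 1 < lam) (ε : PrimarySpace lam) (N : ℤ) :
    SeqSummable lam⁻¹ (ε.tail N) := by
  have h0 : (0 : ℝ) < lam⁻¹ := by positivity
  obtain ⟨k, hk | hk⟩ : ∃ k : ℕ, N = 1 + k ∨ N = 1 - k := ⟨(N - 1).natAbs, by omega⟩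
  · have := (seqSummable_tail_one ε).drop h0 k
    rwa [dropSeq_tail, ← hk] at this
  · have h1 := ((seqSummable_tail_one ε).mul_left (lam⁻¹ ^ k))
    refine (summable_nat_add_iff k).1 (h1.congr fun j => ?_)
    simp only [tail_apply, hk]
    rw [show (1 : ℤ) - k + ((j + k : ℕ) : ℤ) = 1 + j by push_cast; ring]
    ring

end PrimarySpace

/-! ### The torus -/

/-- Reduction modulo `ℤ²` as a homomorphism. -/
def torusProjHom : (Fin 2 → ℝ) →+ UnitAddTorus (Fin 2) where
  toFun := torusProj
  map_zero' := by funext i; simp [torusProj]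
  map_add' v w := by funext i; simp [torusProj]

lemma torusProjHom_apply (v : Fin 2 → ℝ) : torusProjHom v = torusProj v := rfl

lemma torusProj_add (v w : Fin 2 → ℝ) : torusProj (v + w) = torusProj v + torusProj w :=
  map_add torusProjHom v w

lemma torusProj_sub (v w : Fin 2 → ℝ) : torusProj (v - w) = torusProj v - torusProj w :=
  map_sub torusProjHom v w

lemma torusProj_zero : torusProj 0 = 0 := map_zero torusProjHom

lemma torusProj_nsmul (k : ℕ) (w : Fin 2 → ℝ) : torusProj ((k : ℝ) • w) = k • torusProj w := by
  rw [Nat.cast_smul_eq_nsmul]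
  exact map_nsmul torusProjHom k w

lemma continuous_torusProj : Continuous torusProj :=
  continuous_pi fun i => (AddCircle.continuous_mk' 1).comp (continuous_apply i)

/-- An integer vector as a real vector. -/
def intVec (k : Fin 2 → ℤ) : Fin 2 → ℝ := fun i => (k i : ℝ)

lemma torusProj_eq_zero_iff (v : Fin 2 → ℝ) : torusProj v = 0 ↔ ∃ k, v = intVec k := by
  constructor
  · intro h
    have h1 : ∀ i, ∃ k : ℤ, (k : ℝ) = v i := fun i => by
      have := congrFun h i
      simp only [torusProj, Pi.zero_apply] at this
      obtain ⟨k, hk⟩ := (AddCircle.coe_eq_zero_iff (1 : ℝ)).1 this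
      exact ⟨k, by simpa using hk⟩
    choose k hk using h1
    exact ⟨k, funext fun i => (hk i).symm⟩
  · rintro ⟨k, rfl⟩
    funext i
    exact (AddCircle.coe_eq_zero_iff (1 : ℝ)).2 ⟨k i, by simp [intVec]⟩

lemma torusProj_eq_iff (v w : Fin 2 → ℝ) :
    torusProj v = torusProj w ↔ ∃ k, v = w + intVec k := by
  rw [← sub_eq_zero, ← torusProj_sub, torusProj_eq_zero_iff]
  simp only [sub_eq_iff_eq_add']

lemma torusProj_intVec (k : Fin 2 → ℤ) : torusProj (intVec k) = 0 :=
  (torusProj_eq_zero_iff _).2 ⟨k, rfl⟩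

/-- The representative with coordinates in `(0, 1]`. -/
noncomputable def torusLift (x : UnitAddTorus (Fin 2)) : Fin 2 → ℝ :=
  fun i => (AddCircle.equivIoc (1 : ℝ) 0 (x i) : ℝ)

/-- The half-open unit square. -/
def unitSquare : Set (Fin 2 → ℝ) := Set.univ.pi fun _ => Set.Ioc 0 1

lemma torusProj_torusLift (x : UnitAddTorus (Fin 2)) : torusProj (torusLift x) = x := by
  funext i
  exact (AddCircle.equivIoc (1 : ℝ) 0).symm_apply_apply (x i)

lemma torusProj_surjective : Function.Surjective torusProj :=
  fun x => ⟨_, torusProj_torusLift x⟩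

lemma torusLift_mem (x : UnitAddTorus (Fin 2)) : torusLift x ∈ unitSquare := fun i _ => by
  have := (AddCircle.equivIoc (1 : ℝ) 0 (x i)).2
  simpa [torusLift] using this

lemma measurePreserving_torusLift :
    MeasurePreserving torusLift volume (volume.restrict unitSquare) := by
  have h1 : MeasurePreserving (fun x : UnitAddCircle => (AddCircle.equivIoc (1 : ℝ) 0 x : ℝ))
      volume (volume.restrict (Set.Ioc 0 1)) := by
    have h2 := (measurePreserving_subtype_coe (μa := (volume : Measure ℝ))
      (measurableSet_Ioc (a := (0 : ℝ)) (b := 0 + 1))).comp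
        (AddCircle.measurePreserving_equivIoc 1 (a := 0))
    simpa [Function.comp_def] using h2
  have h3 := measurePreserving_pi (fun _ : Fin 2 => (volume : Measure UnitAddCircle))
    (fun _ : Fin 2 => (volume : Measure ℝ).restrict (Set.Ioc 0 1)) (fun _ => h1)
  rw [← Measure.restrict_pi_pi] at h3
  exact h3

lemma volume_unitSquare : volume unitSquare = 1 := by
  simp [unitSquare, volume_pi_pi]

lemma measurableSet_unitSquare : MeasurableSet unitSquare :=
  MeasurableSet.univ_pi fun _ => measurableSet_Ioc

/-- The lift of a point of the image lies in one of countably many integer translates of `S`. -/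
lemma volume_image_torusProj_eq_zero {S : Set (Fin 2 → ℝ)} (hS : volume S = 0) :
    volume (torusProj '' S) = 0 := by
  have h1 : volume (⋃ k, (fun v => v + intVec k) ⁻¹' S) = 0 := by
    rw [measure_iUnion_null_iff]
    intro k
    rwa [measure_preimage_add_right]
  refine measure_mono_null ?_ (measurePreserving_torusLift.quasiMeasurePreserving.preimage_null
    (Measure.absolutelyContinuous_of_le Measure.restrict_le_self h1))
  rintro _ ⟨v, hv, rfl⟩
  obtain ⟨k, hk⟩ := (torusProj_eq_iff v (torusLift (torusProj v))).1 (torusProj_torusLift _).symm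
  simp only [Set.mem_preimage, Set.mem_iUnion]
  exact ⟨k, hk ▸ hv⟩

lemma existsUnique_add_intVec_mem (p : Fin 2 → ℝ) : ∃! k, p + intVec k ∈ unitSquare := by
  have h : ∀ i, ∃! k : ℤ, p i + k ∈ Set.Ioc (0 : ℝ) 1 := fun i => by
    simpa using existsUnique_add_zsmul_mem_Ioc (one_pos : (0 : ℝ) < 1) (p i) 0
  choose k hk hk' using h
  exact ⟨k, fun i _ => hk i, fun l hl => funext fun i => hk' i (l i) (hl i trivial)⟩

/-- The translates of a set cover the unit square with total mass the measure of the set. -/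
lemma tsum_volume_inter_unitSquare {B : Set (Fin 2 → ℝ)} (hB : MeasurableSet B) :
    ∑' k, volume ((fun v => v + intVec k) ⁻¹' B ∩ unitSquare) = volume B := by
  have h1 : ∀ k, volume ((fun v => v + intVec k) ⁻¹' B ∩ unitSquare) =
      volume (B ∩ (fun v => v + intVec (-k)) ⁻¹' unitSquare) := fun k => by
    rw [← measure_preimage_add_right volume (intVec k)
      (B ∩ (fun v => v + intVec (-k)) ⁻¹' unitSquare)]
    congr 1
    ext v
    have : v + intVec k + intVec (-k) = v := by
      funext i; simp [intVec]
    simp [this]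
  simp_rw [h1]
  have hm : ∀ k, MeasurableSet (B ∩ (fun v => v + intVec (-k)) ⁻¹' unitSquare) := fun k =>
    hB.inter (measurableSet_unitSquare.preimage (by fun_prop))
  rw [← measure_iUnion _ hm]
  · congr 1
    rw [← Set.inter_iUnion]
    refine Set.inter_eq_left.2 fun p _ => ?_
    obtain ⟨k, hk, -⟩ := existsUnique_add_intVec_mem p
    exact Set.mem_iUnion.2 ⟨-k, by simpa using hk⟩
  · intro k l hkl
    refine Set.disjoint_left.2 fun p hp hp' => hkl ?_
    exact neg_injective ((existsUnique_add_intVec_mem p).unique hp.2 hp'.2)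

/-- A set of measure at most one that covers the torus covers almost every point just once. -/
lemma ae_unique_of_cover {B : Set (Fin 2 → ℝ)} (hB : MeasurableSet B) (hvol : volume B ≤ 1)
    (hcov : ∀ x, ∃ p ∈ B, torusProj p = x) :
    ∀ᵐ x, ∀ p ∈ B, ∀ q ∈ B, torusProj p = x → torusProj q = x → p = q := by
  -- `f` counts the points of `B` over a given torus point. It is at least one by covering and its
  -- integral over the unit square is `volume B ≤ 1`, so it equals one almost everywhere.
  set f : (Fin 2 → ℝ) → ENNReal := fun p =>
    ∑' k, ((fun v => v + intVec k) ⁻¹' B).indicator 1 p with hf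
  have hmk : ∀ k, MeasurableSet ((fun v => v + intVec k) ⁻¹' B) := fun k =>
    hB.preimage (by fun_prop)
  have hfm : Measurable f := Measurable.tsum fun k => measurable_one.indicator (hmk k)
  have hf1 : ∀ p, 1 ≤ f p := fun p => by
    obtain ⟨q, hq, hqp⟩ := hcov (torusProj p)
    obtain ⟨k, rfl⟩ := (torusProj_eq_iff _ _).1 hqp
    refine le_trans ?_ (ENNReal.le_tsum k)
    rw [Set.indicator_of_mem (by exact hq)]
    simp
  have hint : ∫⁻ p in unitSquare, f p = volume B := by
    rw [hf, lintegral_tsum fun k => (measurable_one.indicator (hmk k)).aemeasurable,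
      ← tsum_volume_inter_unitSquare hB]
    refine tsum_congr fun k => ?_
    rw [lintegral_indicator_one (hmk k), Measure.restrict_apply (hmk k)]
  have hae : ∀ᵐ p ∂(volume.restrict unitSquare), f p ≤ 1 := by
    have h2 : ∫⁻ p in unitSquare, (f p - 1) = 0 := by
      rw [lintegral_sub measurable_const (by simp [volume_unitSquare])
        (Eventually.of_forall hf1), hint]
      simp [volume_unitSquare, tsub_eq_zero_of_le hvol]
    filter_upwards [(lintegral_eq_zero_iff (hfm.sub measurable_const)).1 h2] with p hp
    exact tsub_eq_zero_iff_le.1 hp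
  filter_upwards [measurePreserving_torusLift.quasiMeasurePreserving.ae hae] with x hx p hp q hq h h'
  obtain ⟨k, rfl⟩ := (torusProj_eq_iff p (torusLift x)).1 (h.trans (torusProj_torusLift x).symm)
  obtain ⟨l, rfl⟩ := (torusProj_eq_iff q (torusLift x)).1 (h'.trans (torusProj_torusLift x).symm)
  by_contra hne
  have hkl : k ≠ l := fun e => hne (by rw [e])
  have h3 := ENNReal.sum_le_tsum (f := fun k => ((fun v => v + intVec k) ⁻¹' B).indicator
    (1 : (Fin 2 → ℝ) → ENNReal) (torusLift x)) {k, l}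
  rw [Finset.sum_pair hkl, Set.indicator_of_mem (by exact hp), Set.indicator_of_mem (by exact hq)]
    at h3
  have h4 : (1 : ENNReal) + 1 ≤ 1 := h3.trans hx
  norm_num at h4

/-! ### Integer matrices acting on the torus -/

/-- The real matrix with the given integer entries. -/
def realMat (C : Matrix (Fin 2) (Fin 2) ℤ) : Matrix (Fin 2) (Fin 2) ℝ := C.map (Int.cast : ℤ → ℝ)

lemma realMat_mul (A C : Matrix (Fin 2) (Fin 2) ℤ) : realMat (A * C) = realMat A * realMat C :=
  Matrix.map_mul (f := Int.castRingHom ℝ)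

lemma realMat_one : realMat 1 = 1 := by simp [realMat]

/-- The endomorphism of the torus given by an integer matrix. -/
def intMap (C : Matrix (Fin 2) (Fin 2) ℤ) : UnitAddTorus (Fin 2) →+ UnitAddTorus (Fin 2) where
  toFun x := fun i => ∑ j, C i j • x j
  map_zero' := by funext i; simp
  map_add' x y := by funext i; simp [smul_add, Finset.sum_add_distrib]

lemma toralMap_eq (M : GL (Fin 2) ℤ) (x : UnitAddTorus (Fin 2)) : toralMap M x = intMap M.1 x := rfl

lemma continuous_intMap (C : Matrix (Fin 2) (Fin 2) ℤ) : Continuous (intMap C) :=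
  continuous_pi fun i => by
    change Continuous fun x : UnitAddTorus (Fin 2) => ∑ j, C i j • x j
    exact continuous_finsetSum _ fun j _ => (continuous_zsmul (C i j)).comp (continuous_apply j)

lemma intMap_torusProj (C : Matrix (Fin 2) (Fin 2) ℤ) (v : Fin 2 → ℝ) :
    intMap C (torusProj v) = torusProj ((realMat C).mulVec v) := by
  funext i
  simp [intMap, torusProj, realMat, Matrix.mulVec, dotProduct, ← zsmul_eq_mul]

lemma intMap_mul (A C : Matrix (Fin 2) (Fin 2) ℤ) (x : UnitAddTorus (Fin 2)) :
    intMap (A * C) x = intMap A (intMap C x) := by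
  obtain ⟨v, rfl⟩ := torusProj_surjective x
  simp only [intMap_torusProj, realMat_mul, Matrix.mulVec_mulVec]

lemma intMap_one (x : UnitAddTorus (Fin 2)) : intMap 1 x = x := by
  obtain ⟨v, rfl⟩ := torusProj_surjective x
  simp [intMap_torusProj, realMat_one]

lemma realMat_mulVec_intVec (C : Matrix (Fin 2) (Fin 2) ℤ) (k : Fin 2 → ℤ) :
    (realMat C).mulVec (intVec k) = intVec (C.mulVec k) := by
  funext i
  simp [intVec, realMat, Matrix.mulVec, dotProduct]

lemma intMap_inv_intMap {C : Matrix (Fin 2) (Fin 2) ℤ} (hC : IsUnit C.det)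
    (x : UnitAddTorus (Fin 2)) : intMap C⁻¹ (intMap C x) = x := by
  rw [← intMap_mul, Matrix.nonsing_inv_mul _ hC, intMap_one]

lemma intMap_intMap_inv {C : Matrix (Fin 2) (Fin 2) ℤ} (hC : IsUnit C.det)
    (x : UnitAddTorus (Fin 2)) : intMap C (intMap C⁻¹ x) = x := by
  rw [← intMap_mul, Matrix.mul_nonsing_inv _ hC, intMap_one]

lemma intMap_injective {C : Matrix (Fin 2) (Fin 2) ℤ} (hC : IsUnit C.det) :
    Function.Injective (intMap C) :=
  Function.LeftInverse.injective (intMap_inv_intMap hC)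

lemma measurePreserving_intMap {C : Matrix (Fin 2) (Fin 2) ℤ} (hC : IsUnit C.det) :
    MeasurePreserving (intMap C) volume volume :=
  AddMonoidHom.measurePreserving (continuous_intMap C) (fun x => ⟨_, intMap_intMap_inv hC x⟩) rfl

/-- Injectivity on the torus says that only integer vectors are sent to integer vectors. A real
kernel is therefore impossible, and the real solution of `C l = e` given by the adjugate is
integral, so `C` is onto `ℤ²`. -/
lemma isUnit_det_of_injective {C : Matrix (Fin 2) (Fin 2) ℤ} (hC : Function.Injective (intMap C)) :
    IsUnit C.det := by
  have hint : ∀ v : Fin 2 → ℝ, ∀ k, (realMat C).mulVec v = intVec k → ∃ l, v = intVec l := by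
    intro v k h
    rw [← torusProj_eq_zero_iff]
    apply hC
    rw [intMap_torusProj, h, torusProj_intVec, map_zero]
  have hdet : (C.det : ℝ) ≠ 0 := by
    intro h0
    have h1 : (realMat C).det = 0 := by
      rw [← h0, realMat]; simp [Matrix.det_fin_two]
    obtain ⟨v, hv, hv0⟩ := Matrix.exists_mulVec_eq_zero_iff.2 h1
    obtain ⟨i, hi⟩ := Function.ne_iff.1 hv
    -- Scaled so that the `i`-th coordinate is `1/2`, a kernel vector cannot be integral.
    obtain ⟨l, hl⟩ := hint ((2 * v i)⁻¹ • v) 0 (by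
      rw [Matrix.mulVec_smul, hv0]; funext i; simp [intVec])
    have h2 := congrFun hl i
    simp only [Pi.zero_apply] at hi
    simp only [Pi.smul_apply, smul_eq_mul, intVec] at h2
    have h3 : (2 * l i : ℝ) = 1 := by rw [← h2]; field_simp
    have h4 : 2 * l i = 1 := by exact_mod_cast h3
    omega
  have hcol : ∀ e : Fin 2 → ℤ, ∃ l, C.mulVec l = e := fun e => by
    obtain ⟨l, hl⟩ := hint ((C.det : ℝ)⁻¹ • intVec (C.adjugate.mulVec e)) e (by
      rw [Matrix.mulVec_smul, realMat_mulVec_intVec, Matrix.mulVec_mulVec, Matrix.mul_adjugate,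
        Matrix.smul_mulVec, Matrix.one_mulVec]
      funext i
      simp [intVec, hdet])
    refine ⟨l, ?_⟩
    have h5 : intVec (C.mulVec l) = intVec e := by
      rw [← realMat_mulVec_intVec, ← hl, Matrix.mulVec_smul, realMat_mulVec_intVec,
        Matrix.mulVec_mulVec, Matrix.mul_adjugate, Matrix.smul_mulVec, Matrix.one_mulVec]
      funext i
      simp [intVec, hdet]
    funext i
    have := congrFun h5 i
    simpa [intVec] using this
  exact (Matrix.isUnit_iff_isUnit_det C).1 (Matrix.mulVec_surjective_iff_isUnit.1 hcol)

/-! ### Quadratic units -/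

/-- `lam > 1` is the larger root of `x² - r x + σ`, where `σ = ±1` and the roots are real,
of positive sum and not of modulus one. -/
structure IsQuadUnit (r σ : ℤ) (lam : ℝ) : Prop where
  one_lt : 1 < lam
  eqn : lam ^ 2 = r * lam - σ
  sign : (σ = 1 ∧ 3 ≤ r) ∨ (σ = -1 ∧ 1 ≤ r)

/-- The quasi-greedy expansion of `1` in base `lam`: `(r - 1) (r - 2) (r - 2) …` if `σ = 1` and
`r 0 r 0 …` if `σ = -1`. -/
def quasiGreedy (r σ : ℤ) : ℕ → ℕ := fun n =>
  if σ = 1 then (if n = 0 then (r - 1).toNat else (r - 2).toNat)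
  else if Even n then r.toNat else 0

namespace IsQuadUnit

variable {r σ : ℤ} {lam : ℝ} (h : IsQuadUnit r σ lam)
include h

lemma pos : 0 < lam := by linarith [h.one_lt]

lemma inv_pos : 0 < lam⁻¹ := by have := h.pos; positivity

lemma inv_lt_one : lam⁻¹ < 1 := inv_lt_one_of_one_lt₀ h.one_lt

lemma mul_inv : lam * lam⁻¹ = 1 := mul_inv_cancel₀ h.pos.ne'

lemma conj_eq : (σ : ℝ) * lam⁻¹ = r - lam := by
  have h1 := h.eqn
  have h2 := h.pos
  field_simp
  linarith

lemma abs_sign : |(σ : ℝ)| = 1 := by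
  rcases h.sign with ⟨rfl, -⟩ | ⟨rfl, -⟩ <;> simp

lemma isUnit_sign : IsUnit σ := by
  rcases h.sign with ⟨rfl, -⟩ | ⟨rfl, -⟩ <;> simp

lemma lam_sub_conj_pos : 0 < lam - σ * lam⁻¹ := by
  have h1 := h.one_lt
  have h2 := h.inv_lt_one
  have h3 := h.inv_pos
  rcases h.sign with ⟨rfl, -⟩ | ⟨rfl, -⟩ <;> push_cast <;> linarith

lemma sqrt_discrim : lam - σ * lam⁻¹ = √((r ^ 2 - 4 * σ : ℤ) : ℝ) := by
  symm
  rw [Real.sqrt_eq_iff_mul_self_eq_of_pos h.lam_sub_conj_pos, h.conj_eq]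
  have := h.eqn
  push_cast
  nlinarith

/-- The discriminant is not a square: for `σ = 1` it lies strictly between `(r-1)²` and `r²`; for `σ
= -1` between `r²` and `(r+2)²`, and `(r+1)²` is excluded by parity. -/
lemma irrational : Irrational lam := by
  have h1 : Irrational (2 * lam - r) := by
    refine irrational_nrt_of_notint_nrt 2 (r ^ 2 - 4 * σ) ?_ ?_ two_pos
    · have := h.eqn
      push_cast
      nlinarith
    · rintro ⟨y, hy⟩
      have h2 : y ^ 2 = r ^ 2 - 4 * σ := by
        have h3 : (y : ℝ) ^ 2 = r ^ 2 - 4 * σ := by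
          rw [← hy]
          have := h.eqn
          nlinarith
        exact_mod_cast h3
      rw [← sq_abs] at h2
      have h4 := abs_nonneg y
      generalize |y| = z at h2 h4
      rcases h.sign with ⟨rfl, hr⟩ | ⟨rfl, hr⟩
      · have h5 : z < r := by nlinarith
        have h6 : r - 1 < z := by nlinarith
        omega
      · have h5 : r < z := by nlinarith
        have h6 : z < r + 2 := by nlinarith
        have h7 : z = r + 1 := by omega
        subst h7
        have : 2 * r = 3 := by linarith
        omega
  intro hq
  obtain ⟨q, rfl⟩ := hq
  exact h1 ⟨2 * q - r, by push_cast; ring⟩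

lemma irrational_conj : Irrational ((σ : ℝ) * lam⁻¹) := by
  rw [h.conj_eq]
  exact h.irrational.intCast_sub r

lemma summable_of_le {a : ℕ → ℕ} {B : ℕ} (ha : ∀ j, a j ≤ B) : SeqSummable lam⁻¹ a :=
  seqSummable_of_le h.inv_pos h.inv_lt_one ha

omit h in
lemma quasiGreedy_le (n : ℕ) : quasiGreedy r σ n ≤ r.toNat := by
  unfold quasiGreedy
  split_ifs <;> omega

lemma summable_quasiGreedy : SeqSummable lam⁻¹ (quasiGreedy r σ) :=
  h.summable_of_le quasiGreedy_le

lemma quasiGreedy_zero_pos : 0 < quasiGreedy r σ 0 := by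
  rcases h.sign with ⟨rfl, hr⟩ | ⟨rfl, hr⟩ <;> simp [quasiGreedy] <;> omega

lemma quasiGreedy_infinite (n : ℕ) : ∃ m, n ≤ m ∧ quasiGreedy r σ m ≠ 0 := by
  rcases h.sign with ⟨rfl, hr⟩ | ⟨rfl, hr⟩
  · refine ⟨n, le_rfl, ?_⟩
    simp only [quasiGreedy, if_true]
    split_ifs <;> omega
  · refine ⟨2 * n, by omega, ?_⟩
    simp [quasiGreedy]
    omega

lemma seqVal_const (hσ : σ = 1) :
    seqVal lam⁻¹ (fun _ => (r - 2).toNat) = 1 - lam⁻¹ := by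
  subst hσ
  have hr : 3 ≤ r := by rcases h.sign with h1 | h1 <;> omega
  have h1 := seqVal_succ (μ := lam⁻¹) (a := fun _ => (r - 2).toNat) (h.summable_of_le fun _ => le_rfl)
  have h2 : dropSeq 1 (fun _ => (r - 2).toNat) = fun _ => (r - 2).toNat := rfl
  rw [h2] at h1
  have h3 : (((r - 2).toNat : ℕ) : ℝ) = r - 2 := by
    have : (((r - 2).toNat : ℤ) : ℝ) = ((r - 2 : ℤ) : ℝ) := by
      rw [Int.toNat_of_nonneg (by omega)]
    push_cast at this
    exact this
  rw [h3] at h1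
  have h4 := h.mul_inv
  have h5 := h.conj_eq
  push_cast at h5
  have h6 := h.inv_lt_one
  have h7 : (seqVal lam⁻¹ (fun _ => (r - 2).toNat) - (1 - lam⁻¹)) * (1 - lam⁻¹) = 0 := by
    have : (r : ℝ) = lam + lam⁻¹ := by linarith
    rw [this] at h1
    linear_combination h1 + h4
  rcases mul_eq_zero.1 h7 with h8 | h8 <;> linarith

lemma seqVal_quasiGreedy : seqVal lam⁻¹ (quasiGreedy r σ) = 1 := by
  have h0 := h.summable_quasiGreedy
  have h4 := h.mul_inv
  have h5 := h.conj_eq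
  have h6 := h.inv_lt_one
  have h1 := seqVal_succ h0
  rcases h.sign with ⟨rfl, hr⟩ | ⟨rfl, hr⟩
  · have h2 : dropSeq 1 (quasiGreedy r 1) = fun _ => (r - 2).toNat := by
      funext j; simp [dropSeq, quasiGreedy]
    have h3 : ((quasiGreedy r 1 0 : ℕ) : ℝ) = r - 1 := by
      have : (((r - 1).toNat : ℤ) : ℝ) = ((r - 1 : ℤ) : ℝ) := by
        rw [Int.toNat_of_nonneg (by omega)]
      push_cast at this
      simpa [quasiGreedy] using this
    rw [h1, h2, h.seqVal_const rfl, h3]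
    push_cast at h5
    have : (r : ℝ) = lam + lam⁻¹ := by linarith
    rw [this]
    linear_combination h4
  · have hd2 : dropSeq 2 (quasiGreedy r (-1)) = quasiGreedy r (-1) := by
      funext j
      simp [dropSeq, quasiGreedy, Nat.even_add]
    have h7 := seqVal_split h0 2
    rw [hd2] at h7
    have h3 : ((quasiGreedy r (-1) 0 : ℕ) : ℝ) = r := by
      have : ((r.toNat : ℤ) : ℝ) = ((r : ℤ) : ℝ) := by
        rw [Int.toNat_of_nonneg (by omega)]
      push_cast at this
      simpa [quasiGreedy] using this
    have h8 : quasiGreedy r (-1) 1 = 0 := by simp [quasiGreedy]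
    rw [Finset.sum_range_succ, Finset.sum_range_one, h3, h8] at h7
    push_cast at h5
    have h9 : (r : ℝ) = lam - lam⁻¹ := by linarith
    rw [h9] at h7
    have h10 : (seqVal lam⁻¹ (quasiGreedy r (-1)) - 1) * ((1 - lam⁻¹) * (1 + lam⁻¹)) = 0 := by
      push_cast at h7
      linear_combination h7 + h4
    have h11 := h.inv_pos
    rcases mul_eq_zero.1 h10 with h12 | h12
    · linarith
    · have : 0 < (1 - lam⁻¹) * (1 + lam⁻¹) := by
        apply mul_pos <;> linarith
      linarith

/-- Needed for `lexAdm_of_seqVal_lt_one`. For `σ = 1` the proper tails are constant; for `σ = -1`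
the even tails repeat the sequence and the odd ones have value `λ - r`, the reciprocal of `λ`. -/
lemma seqVal_drop_quasiGreedy (k : ℕ) : seqVal lam⁻¹ (dropSeq k (quasiGreedy r σ)) ≤ 1 := by
  have h0 := h.summable_quasiGreedy
  have h1 := h.inv_pos
  rcases h.sign with ⟨rfl, hr⟩ | ⟨rfl, hr⟩
  · rcases Nat.eq_zero_or_pos k with rfl | hk
    · rw [dropSeq_zero, h.seqVal_quasiGreedy]
    · have h2 : dropSeq k (quasiGreedy r 1) = fun _ => (r - 2).toNat := by
        funext j
        have : ¬ (k + j = 0) := by omega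
        simp only [dropSeq, quasiGreedy, if_true, this, if_false]
      rw [h2, h.seqVal_const rfl]
      linarith
  · rcases Nat.even_or_odd k with hk | hk
    · have h2 : dropSeq k (quasiGreedy r (-1)) = quasiGreedy r (-1) := by
        funext j
        simp [dropSeq, quasiGreedy, Nat.even_add, hk]
      rw [h2, h.seqVal_quasiGreedy]
    · have h2 : dropSeq k (quasiGreedy r (-1)) = dropSeq 1 (quasiGreedy r (-1)) := by
        funext j
        have : ¬ Even k := Nat.not_even_iff_odd.2 hk
        simp [dropSeq, quasiGreedy, Nat.even_add, this]
      have h3 := seqVal_succ h0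
      rw [h.seqVal_quasiGreedy] at h3
      have h4 : (1 : ℝ) ≤ quasiGreedy r (-1) 0 := by
        exact_mod_cast h.quasiGreedy_zero_pos
      have h5 : ((quasiGreedy r (-1) 0 : ℕ) : ℝ) = r := by
        have : ((r.toNat : ℤ) : ℝ) = ((r : ℤ) : ℝ) := by
          rw [Int.toNat_of_nonneg (by omega)]
        push_cast at this
        simpa [quasiGreedy] using this
      rw [h2]
      have h6 := h.conj_eq
      push_cast at h6
      have h7 := h.mul_inv
      have h8 := h.inv_lt_one
      have h9 : seqVal lam⁻¹ (dropSeq 1 (quasiGreedy r (-1))) = lam - r := by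
        rw [h5] at h3
        have : lam * 1 = lam * (lam⁻¹ * (r + seqVal lam⁻¹ (dropSeq 1 (quasiGreedy r (-1))))) := by
          rw [← h3]
        rw [← mul_assoc, h7] at this
        linarith
      rw [h9]
      linarith

lemma seqVal_le_one {a : ℕ → ℕ} (ha : LexAdm (quasiGreedy r σ) a) : seqVal lam⁻¹ a ≤ 1 :=
  ha.seqVal_le_one h.inv_pos h.inv_lt_one h.summable_quasiGreedy h.seqVal_quasiGreedy

lemma seqVal_lt_one {a : ℕ → ℕ} (ha : LexAdm (quasiGreedy r σ) a) {n : ℕ}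
    (hn : ∀ m, n ≤ m → a m = 0) : seqVal lam⁻¹ a < 1 :=
  ha.seqVal_lt_one h.inv_pos h.inv_lt_one h.summable_quasiGreedy h.seqVal_quasiGreedy
    h.quasiGreedy_infinite hn

lemma lexAdm_of_seqVal_lt_one {a : ℕ → ℕ} (has : SeqSummable lam⁻¹ a)
    (ha : ∀ k, seqVal lam⁻¹ (dropSeq k a) < 1) : LexAdm (quasiGreedy r σ) a :=
  ArithmeticCoding.lexAdm_of_seqVal_lt_one h.inv_pos h.summable_quasiGreedy h.seqVal_quasiGreedy
    h.seqVal_drop_quasiGreedy has ha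

omit h in
/-- The digits of the greedy expansion of `t` in base `lam`. -/
noncomputable def greedyDigit (lam t : ℝ) (n : ℕ) : ℕ := ⌊lam * (fun x => Int.fract (lam * x))^[n] t⌋₊

/-- Every number in `[0, 1)` has an admissible expansion. -/
lemma exists_expansion {t : ℝ} (ht : t ∈ Set.Ico (0 : ℝ) 1) :
    ∃ a, LexAdm (quasiGreedy r σ) a ∧ seqVal lam⁻¹ a = t := by
  set T : ℕ → ℝ := fun n => (fun x => Int.fract (lam * x))^[n] t with hT
  have hTs : ∀ n, T (n + 1) = Int.fract (lam * T n) := fun n => by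
    simp only [hT, Function.iterate_succ_apply']
  have hTmem : ∀ n, T n ∈ Set.Ico (0 : ℝ) 1 := fun n => by
    cases n with
    | zero => simpa [hT] using ht
    | succ n => rw [hTs]; exact ⟨Int.fract_nonneg _, Int.fract_lt_one _⟩
  set g := greedyDigit lam t with hg
  have hgT : ∀ n, (g n : ℝ) = lam * T n - T (n + 1) := fun n => by
    have h1 : 0 ≤ lam * T n := mul_nonneg h.pos.le (hTmem n).1
    rw [hTs, Int.self_sub_fract, hg, greedyDigit]
    change ((⌊lam * T n⌋₊ : ℕ) : ℝ) = _
    exact_mod_cast Int.natCast_floor_eq_floor h1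
  have hgle : ∀ n, g n ≤ ⌊lam⌋₊ := fun n => by
    refine Nat.floor_le_floor ?_
    exact mul_le_of_le_one_right h.pos.le (hTmem n).2.le
  have hgs := h.summable_of_le hgle
  -- The remainders of the greedy algorithm are the values of the tails. They are all below one,
  -- which is what makes the expansion admissible.
  have hval : ∀ k, seqVal lam⁻¹ (dropSeq k g) = T k := by
    intro k
    have hpart : ∀ n, ∑ j ∈ Finset.range n, (dropSeq k g j : ℝ) * lam⁻¹ ^ (j + 1) =
        T k - lam⁻¹ ^ n * T (k + n) := by
      intro n
      induction n with
      | zero => simp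
      | succ n ih =>
        rw [Finset.sum_range_succ, ih, dropSeq, hgT, pow_succ, ← add_assoc]
        have := h.mul_inv
        linear_combination (T (k + n) * lam⁻¹ ^ n) * this
    have h2 := (hgs.drop h.inv_pos k).hasSum.tendsto_sum_nat
    refine tendsto_nhds_unique h2 ?_
    simp_rw [hpart]
    have h3 : Tendsto (fun n => lam⁻¹ ^ n * T (k + n)) atTop (𝓝 0) := by
      refine squeeze_zero (fun n => mul_nonneg (pow_nonneg h.inv_pos.le n) (hTmem _).1)
        (fun n => ?_) (tendsto_pow_atTop_nhds_zero_of_lt_one h.inv_pos.le h.inv_lt_one)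
      exact mul_le_of_le_one_right (pow_nonneg h.inv_pos.le n) (hTmem _).2.le
    simpa using h3.const_sub (T k)
  refine ⟨g, h.lexAdm_of_seqVal_lt_one hgs fun k => ?_, ?_⟩
  · rw [hval]; exact (hTmem k).2
  · simpa [hT] using hval 0

end IsQuadUnit

/-! ### The coding attached to the companion matrix -/

/-- The one-sided sequence `e_N, e_{N+1}, …`. -/
def fwdSeq (e : ℤ → ℕ) (N : ℤ) : ℕ → ℕ := fun j => e (N + j)

/-- The one-sided sequence `e_N, e_{N-1}, …`. -/
def bwdSeq (e : ℤ → ℕ) (N : ℤ) : ℕ → ℕ := fun j => e (N - j)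

/-- The coordinate `∑_{n > N} e_n λ^{N-n}`. -/
noncomputable def fwdCoord (lam : ℝ) (e : ℤ → ℕ) (N : ℤ) : ℝ := seqVal lam⁻¹ (fwdSeq e (N + 1))

/-- The coordinate `∑_{n ≤ N} e_n λ'^{N-n}`, where `λ' = σ / λ`. -/
noncomputable def bwdCoord (lam : ℝ) (σ : ℤ) (e : ℤ → ℕ) (N : ℤ) : ℝ :=
  ∑' j, (bwdSeq e N j : ℝ) * (σ * lam⁻¹) ^ j

/-- The point `(p, q)` with `p + q λ = fwdCoord` and `p + q λ' = -bwdCoord`. -/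
noncomputable def coordVec (lam : ℝ) (σ : ℤ) (e : ℤ → ℕ) (N : ℤ) : Fin 2 → ℝ :=
  ![fwdCoord lam e N - (fwdCoord lam e N + bwdCoord lam σ e N) / (lam - σ * lam⁻¹) * lam,
    (fwdCoord lam e N + bwdCoord lam σ e N) / (lam - σ * lam⁻¹)]

/-- The companion matrix of `x² - r x + σ`. -/
def companion (r σ : ℤ) : Matrix (Fin 2) (Fin 2) ℤ := !![0, -σ; 1, r]

/-- The set of sequences without a tail greater than the quasi-greedy expansion of `1`. -/
def betaSet (r σ : ℤ) (lam : ℝ) : Set (PrimarySpace lam) :=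
  {ε | ∀ N, ¬ LexLess (quasiGreedy r σ) (ε.tail N)}

lemma fwdSeq_digit {lam : ℝ} (ε : PrimarySpace lam) (N : ℤ) : fwdSeq ε.digit N = ε.tail N := rfl

lemma dropSeq_fwdSeq (e : ℤ → ℕ) (N : ℤ) (k : ℕ) : dropSeq k (fwdSeq e N) = fwdSeq e (N + k) := by
  funext j
  simp only [dropSeq, fwdSeq]
  congr 1; push_cast; ring

lemma det_companion (r σ : ℤ) : (companion r σ).det = σ := by
  simp [companion, Matrix.det_fin_two]

namespace IsQuadUnit

variable {r σ : ℤ} {lam : ℝ} (h : IsQuadUnit r σ lam)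
include h

omit h in
lemma coordVec_fwd (e : ℤ → ℕ) (N : ℤ) :
    coordVec lam σ e N 0 + coordVec lam σ e N 1 * lam = fwdCoord lam e N := by
  simp [coordVec]

lemma coordVec_bwd (e : ℤ → ℕ) (N : ℤ) :
    coordVec lam σ e N 0 + coordVec lam σ e N 1 * (σ * lam⁻¹) = -bwdCoord lam σ e N := by
  have h1 := h.lam_sub_conj_pos.ne'
  simp only [coordVec, Matrix.cons_val_zero, Matrix.cons_val_one]
  generalize (σ : ℝ) * lam⁻¹ = c at h1 ⊢
  field_simp
  ring

omit h in
lemma seqSummable_bwdSeq_zero (ε : PrimarySpace lam) : SeqSummable lam⁻¹ (bwdSeq ε.digit 0) := by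
  refine ((Subtype.property ε).2.mul_right lam⁻¹).congr fun n => ?_
  simp only [bwdSeq, PrimarySpace.digit, zero_sub, pow_succ]
  ring

lemma summable_bwd {e : ℤ → ℕ} {N : ℤ} (he : SeqSummable lam⁻¹ (bwdSeq e N)) :
    Summable fun j => (bwdSeq e N j : ℝ) * (σ * lam⁻¹) ^ j := by
  refine Summable.of_norm ((he.mul_right lam).congr fun j => ?_)
  rw [norm_mul, norm_pow, norm_mul, Real.norm_eq_abs, Real.norm_eq_abs, Real.norm_eq_abs,
    h.abs_sign, one_mul, abs_of_pos h.inv_pos, abs_of_nonneg (by positivity), pow_succ]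
  have := h.mul_inv
  linear_combination (bwdSeq e N j : ℝ) * lam⁻¹ ^ j * this

lemma lam_mul_fwdCoord {e : ℤ → ℕ} {N : ℤ} (he : SeqSummable lam⁻¹ (fwdSeq e (N + 1))) :
    lam * fwdCoord lam e N = e (N + 1) + fwdCoord lam e (N + 1) := by
  unfold fwdCoord
  rw [seqVal_succ he, dropSeq_fwdSeq, ← mul_assoc, h.mul_inv]
  simp [fwdSeq]

lemma bwdCoord_succ {e : ℤ → ℕ} {N : ℤ}
    (he' : SeqSummable lam⁻¹ (bwdSeq e (N + 1))) :
    bwdCoord lam σ e (N + 1) = e (N + 1) + σ * lam⁻¹ * bwdCoord lam σ e N := by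
  unfold bwdCoord
  rw [(h.summable_bwd he').tsum_eq_zero_add, ← tsum_mul_left]
  simp only [bwdSeq, Nat.cast_zero, sub_zero, pow_zero, mul_one]
  congr 2
  funext j
  rw [show N + 1 - ((j + 1 : ℕ) : ℤ) = N - j by push_cast; ring]
  ring

/-- `p + q λ` and `p + q λ'` are left eigenfunctionals of the companion matrix. Moving `N` by one
carries the digit `e (N + 1)` from the future to the past, and this changes both functionals by the
same integer, hence the point by an integer vector. -/
lemma coordVec_succ {e : ℤ → ℕ} {N : ℤ} (hf : SeqSummable lam⁻¹ (fwdSeq e (N + 1)))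
    (he' : SeqSummable lam⁻¹ (bwdSeq e (N + 1))) :
    (realMat (companion r σ)).mulVec (coordVec lam σ e N) =
      coordVec lam σ e (N + 1) + intVec ![(e (N + 1) : ℤ), 0] := by
  have h1 := h.lam_mul_fwdCoord hf
  have h2 := h.bwdCoord_succ he'
  have h3 := h.lam_sub_conj_pos.ne'
  have h4 := h.conj_eq
  have h5 := h.eqn
  have hx : fwdCoord lam e (N + 1) = lam * fwdCoord lam e N - e (N + 1) := by linarith
  rw [h4] at h2 h3
  funext i
  fin_cases i
  · simp only [realMat, companion, coordVec, Matrix.mulVec, dotProduct, Fin.sum_univ_two, h2,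
      hx, h4]
    simp [intVec]
    field_simp
    generalize fwdCoord lam e N = x
    generalize bwdCoord lam σ e N = y
    linear_combination (-(x + y)) * h5
  · simp only [realMat, companion, coordVec, Matrix.mulVec, dotProduct, Fin.sum_univ_two, h2,
      hx, h4]
    simp [intVec]
    field_simp
    ring

lemma torusProj_coordVec_succ {e : ℤ → ℕ} {N : ℤ} (hf : SeqSummable lam⁻¹ (fwdSeq e (N + 1)))
    (he' : SeqSummable lam⁻¹ (bwdSeq e (N + 1))) :
    torusProj (coordVec lam σ e (N + 1)) =
      intMap (companion r σ) (torusProj (coordVec lam σ e N)) := by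
  rw [intMap_torusProj, h.coordVec_succ hf he', torusProj_add, torusProj_intVec, add_zero]

omit h in
lemma coordVec_shift (ε : PrimarySpace lam) (N : ℤ) :
    coordVec lam σ ε.shift.digit N = coordVec lam σ ε.digit (N + 1) := by
  have h1 : fwdCoord lam ε.shift.digit N = fwdCoord lam ε.digit (N + 1) := by
    unfold fwdCoord
    rw [fwdSeq_digit, fwdSeq_digit, PrimarySpace.tail_shift]
  have h2 : bwdCoord lam σ ε.shift.digit N = bwdCoord lam σ ε.digit (N + 1) := by
    unfold bwdCoord
    have : bwdSeq ε.shift.digit N = bwdSeq ε.digit (N + 1) := by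
      funext j
      simp only [bwdSeq, PrimarySpace.digit_shift]
      congr 1; ring
    rw [this]
  unfold coordVec
  rw [h1, h2]

lemma isUnit_det_companion : IsUnit (companion r σ).det := by
  rw [det_companion]; exact h.isUnit_sign

/-- The coding of the companion matrix. -/
noncomputable def coding : PrimarySpace lam →+ UnitAddTorus (Fin 2) where
  toFun ε := torusProj (coordVec lam σ ε.digit 0)
  map_zero' := by
    have h1 : fwdCoord lam (0 : PrimarySpace lam).digit 0 = 0 := by
      simp [fwdCoord, fwdSeq, seqVal]
    have h2 : bwdCoord lam σ (0 : PrimarySpace lam).digit 0 = 0 := by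
      simp [bwdCoord, bwdSeq]
    rw [← torusProj_zero]
    congr 1
    funext i
    fin_cases i <;> simp [coordVec, h1, h2]
  map_add' a b := by
    have h1 : fwdCoord lam (a + b).digit 0 = fwdCoord lam a.digit 0 + fwdCoord lam b.digit 0 := by
      unfold fwdCoord seqVal
      refine Eq.trans (tsum_congr fun j => ?_)
        ((a.seqSummable_tail h.one_lt (0 + 1)).tsum_add (b.seqSummable_tail h.one_lt (0 + 1)))
      simp [fwdSeq, PrimarySpace.tail_apply, add_mul]
    have h2 : bwdCoord lam σ (a + b).digit 0 =
        bwdCoord lam σ a.digit 0 + bwdCoord lam σ b.digit 0 := by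
      unfold bwdCoord
      rw [← (h.summable_bwd (seqSummable_bwdSeq_zero a)).tsum_add
        (h.summable_bwd (seqSummable_bwdSeq_zero b))]
      refine tsum_congr fun j => ?_
      simp [bwdSeq, add_mul]
    rw [← torusProj_add]
    congr 1
    funext i
    fin_cases i <;> simp [coordVec, h1, h2] <;> ring

lemma coding_apply (ε : PrimarySpace lam) :
    h.coding ε = torusProj (coordVec lam σ ε.digit 0) := rfl

lemma continuous_coding : Continuous h.coding := by
  have h1 : Continuous fun ε : PrimarySpace lam => fwdCoord lam ε.digit 0 := by
    have h2 := PrimarySpace.continuous_tsum_toL1 (lam := lam) (g := fun j : ℕ => 0 + 1 + (j : ℤ))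
      (c := fun _ => 1) (fun a b hab => by simpa using hab) (fun _ => by simp)
    refine h2.congr fun ε => ?_
    unfold fwdCoord seqVal
    refine tsum_congr fun j => ?_
    rw [PrimarySpace.toL1_apply, one_mul]
    simp only [fwdSeq]
    congr 2
    omega
  have h2 : Continuous fun ε : PrimarySpace lam => bwdCoord lam σ ε.digit 0 := by
    have h2 := PrimarySpace.continuous_tsum_toL1 (lam := lam) (g := fun j : ℕ => 0 - (j : ℤ))
      (c := fun j => (σ : ℝ) ^ j) (fun a b hab => by simpa using hab)
      (fun j => by rw [abs_pow, h.abs_sign, one_pow])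
    refine h2.congr fun ε => ?_
    unfold bwdCoord
    refine tsum_congr fun j => ?_
    rw [PrimarySpace.toL1_apply, mul_pow, show ((0 : ℤ) - j).natAbs = j by omega]
    simp only [bwdSeq]
    ring
  refine continuous_torusProj.comp (continuous_pi fun i => ?_)
  fin_cases i
  · exact h1.sub (((h1.add h2).div_const _).mul_const _)
  · exact (h1.add h2).div_const _

lemma coding_shift (ε : PrimarySpace lam) :
    h.coding ε.shift = intMap (companion r σ) (h.coding ε) := by
  rw [coding_apply, coding_apply, coordVec_shift]
  refine h.torusProj_coordVec_succ (N := 0) (ε.seqSummable_tail h.one_lt _)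
    ?_
  have := seqSummable_bwdSeq_zero ε.shift
  have h2 : bwdSeq ε.shift.digit 0 = bwdSeq ε.digit (0 + 1) := by
    funext j
    simp only [bwdSeq, PrimarySpace.digit_shift]
    congr 1; ring
  rwa [h2] at this

end IsQuadUnit

/-! ### The homoclinic point of the companion matrix -/

/-- The representative of the homoclinic point of the companion matrix on the unstable line. -/
noncomputable def unstableVec (lam : ℝ) (σ : ℤ) : Fin 2 → ℝ :=
  ![-(σ * lam⁻¹) / (lam - σ * lam⁻¹), 1 / (lam - σ * lam⁻¹)]

namespace IsQuadUnit

variable {r σ : ℤ} {lam : ℝ} (h : IsQuadUnit r σ lam)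
include h

lemma coordVec_of_bwd_eq_zero {e : ℤ → ℕ} {N : ℤ} (he : ∀ n ≤ N, e n = 0) :
    coordVec lam σ e N = fwdCoord lam e N • unstableVec lam σ := by
  have h1 : bwdCoord lam σ e N = 0 := by
    unfold bwdCoord
    have : ∀ j, bwdSeq e N j = 0 := fun j => he _ (by omega)
    simp [this]
  have h2 := h.lam_sub_conj_pos.ne'
  funext i
  fin_cases i
  · simp only [coordVec, unstableVec, h1]
    generalize (σ : ℝ) * lam⁻¹ = c at h2 ⊢
    simp
    field_simp
    ring
  · simp [coordVec, unstableVec, h1]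
    ring

lemma mulVec_unstableVec :
    (realMat (companion r σ)).mulVec (unstableVec lam σ) = lam • unstableVec lam σ := by
  have h2 := h.lam_sub_conj_pos.ne'
  have h3 := h.mul_inv
  have h4 := h.conj_eq
  funext i
  fin_cases i
  · simp only [realMat, companion, unstableVec, Matrix.mulVec, dotProduct, Fin.sum_univ_two]
    simp
    linear_combination ((σ : ℝ) * (lam - σ * lam⁻¹)⁻¹) * h3
  · simp only [realMat, companion, unstableVec, Matrix.mulVec, dotProduct, Fin.sum_univ_two, h4]
    simp
    rw [h4] at h2
    field_simp
    ring

lemma coding_single_zero :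
    h.coding (PrimarySpace.single lam 0) = torusProj (unstableVec lam σ) := by
  rw [coding_apply, torusProj_eq_iff]
  -- The digit at place `0` belongs to the past, so here `coordVec` lies on the stable line, with
  -- functionals `0` and `-1`; on `unstableVec` they are `1` and `0`.
  refine ⟨![-1, 0], ?_⟩
  have h1 : fwdCoord lam (PrimarySpace.single lam 0).digit 0 = 0 := by
    unfold fwdCoord seqVal
    have : ∀ j, fwdSeq (PrimarySpace.single lam 0).digit (0 + 1) j = 0 := fun j => by
      simp only [fwdSeq, PrimarySpace.digit_single]
      rw [if_neg (by omega)]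
    simp only [this, Nat.cast_zero, zero_mul, tsum_zero]
  have h2 : bwdCoord lam σ (PrimarySpace.single lam 0).digit 0 = 1 := by
    unfold bwdCoord
    rw [tsum_eq_single 0]
    · simp [bwdSeq]
    · intro j hj
      simp only [bwdSeq, PrimarySpace.digit_single]
      rw [if_neg (by omega)]
      simp
  have h3 := h.lam_sub_conj_pos.ne'
  funext i
  fin_cases i
  · simp only [coordVec, unstableVec, h1, h2]
    generalize (σ : ℝ) * lam⁻¹ = c at h3 ⊢
    simp [intVec]
    field_simp
    ring
  · simp [coordVec, unstableVec, intVec, h1, h2]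

lemma coding_single (n : ℤ) :
    h.coding (PrimarySpace.single lam n) = torusProj (lam ^ (-n) • unstableVec lam σ) := by
  have hstep : ∀ n : ℤ, intMap (companion r σ) (h.coding (PrimarySpace.single lam n)) =
      h.coding (PrimarySpace.single lam (n - 1)) := fun n => by
    rw [← coding_shift, PrimarySpace.shift_single]
  have hstep' : ∀ n : ℤ, intMap (companion r σ) (torusProj (lam ^ (-n) • unstableVec lam σ)) =
      torusProj (lam ^ (-(n - 1)) • unstableVec lam σ) := fun n => by
    rw [intMap_torusProj, Matrix.mulVec_smul, h.mulVec_unstableVec, smul_smul]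
    congr 2
    rw [show -(n - 1) = -n + 1 by ring, zpow_add_one₀ h.pos.ne']
  induction n using Int.induction_on with
  | zero => simp [h.coding_single_zero]
  | succ n ih =>
    apply intMap_injective h.isUnit_det_companion
    rw [hstep, hstep']
    simpa using ih
  | pred n ih =>
    rw [← hstep, ih, hstep']

/-- Symmetric partial sums of the coding. -/
lemma coding_trunc (ε : PrimarySpace lam) (N : ℕ) :
    h.coding (PrimarySpace.trunc N ε) = torusProj
      ((∑ n ∈ Finset.Icc (-(N : ℤ)) N, (ε.digit n : ℝ) * lam ^ (-n)) • unstableVec lam σ) := by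
  rw [PrimarySpace.trunc, map_sum, Finset.sum_smul, ← torusProjHom_apply, map_sum]
  refine Finset.sum_congr rfl fun n _ => ?_
  rw [map_nsmul, coding_single, torusProjHom_apply, mul_smul, torusProj_nsmul]

end IsQuadUnit

/-! ### Surjectivity on the compactum of admissible sequences -/

namespace IsQuadUnit

variable {r σ : ℤ} {lam : ℝ} (h : IsQuadUnit r σ lam)
include h

lemma mem_primarySet_of_le {e : ℤ → ℕ} {B : ℕ} (he : ∀ n, e n ≤ B) : e ∈ primarySet lam := by
  have key : ∀ f : ℕ → ℕ, (∀ n, f n ≤ B) → Summable fun n => (f n : ℝ) * lam⁻¹ ^ n := by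
    intro f hf
    refine ((h.summable_of_le hf).mul_right lam).congr fun n => ?_
    rw [pow_succ]
    linear_combination ((f n : ℝ) * lam⁻¹ ^ n) * h.mul_inv
  exact ⟨key _ fun n => he _, key _ fun n => he _⟩

omit h in
lemma le_of_fwd_adm {e : ℤ → ℕ} {d : ℕ → ℕ} (he : ∀ N, ¬ LexLess d (fwdSeq e N)) (n : ℤ) :
    e n ≤ d 0 := by
  by_contra! hn
  exact he n (lexLess_of_head (by simpa [fwdSeq] using hn))

omit h in
lemma isCompact_admissible (d : ℕ → ℕ) :
    IsCompact {e : ℤ → ℕ | ∀ N, ¬ LexLess d (fwdSeq e N)} := by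
  have h1 : IsCompact (Set.univ.pi fun _ : ℤ => Set.Iic (d 0)) :=
    isCompact_univ_pi fun _ => (Set.finite_Iic _).isCompact
  refine h1.of_isClosed_subset ?_ fun e he n _ => le_of_fwd_adm he n
  rw [Set.ofPred_forall]
  refine isClosed_iInter fun N => ?_
  have h2 : Continuous fun e : ℤ → ℕ => fwdSeq e N := continuous_pi fun j => continuous_apply _
  exact ((isOpen_lexLess d).preimage h2).isClosed_compl

lemma continuousOn_fwdCoord (B : ℕ) :
    ContinuousOn (fun e : ℤ → ℕ => fwdCoord lam e 0) {e | ∀ n, e n ≤ B} := by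
  refine continuousOn_tsum (u := fun j => (B : ℝ) * lam⁻¹ ^ (j + 1)) (fun j => ?_)
    (h.summable_of_le (a := fun _ => B) fun _ => le_rfl) ?_
  · have : Continuous fun e : ℤ → ℕ => ((e (0 + 1 + j) : ℕ) : ℝ) :=
      continuous_of_discreteTopology.comp (continuous_apply _)
    exact (this.mul_const _).continuousOn
  · intro j e he
    have h1 := h.inv_pos
    rw [Real.norm_of_nonneg (by positivity)]
    have : (fwdSeq e (0 + 1) j : ℝ) ≤ B := by exact_mod_cast he _
    gcongr

lemma continuousOn_bwdCoord (B : ℕ) :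
    ContinuousOn (fun e : ℤ → ℕ => bwdCoord lam σ e 0) {e | ∀ n, e n ≤ B} := by
  have hs : Summable fun j => (B : ℝ) * lam⁻¹ ^ j :=
    (summable_geometric_of_lt_one h.inv_pos.le h.inv_lt_one).mul_left _
  refine continuousOn_tsum (u := fun j => (B : ℝ) * lam⁻¹ ^ j) (fun j => ?_) hs ?_
  · have : Continuous fun e : ℤ → ℕ => ((e (0 - j) : ℕ) : ℝ) :=
      continuous_of_discreteTopology.comp (continuous_apply _)
    exact (this.mul_const _).continuousOn
  · intro j e he
    have h1 := h.inv_pos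
    rw [norm_mul, norm_pow, norm_mul, Real.norm_eq_abs (σ : ℝ), h.abs_sign, one_mul,
      Real.norm_of_nonneg h1.le, Real.norm_of_nonneg (by positivity)]
    have : (bwdSeq e 0 j : ℝ) ≤ B := by exact_mod_cast he _
    gcongr

lemma image_betaSet :
    h.coding '' betaSet r σ lam = (fun e => torusProj (coordVec lam σ e 0)) ''
      {e : ℤ → ℕ | ∀ N, ¬ LexLess (quasiGreedy r σ) (fwdSeq e N)} := by
  ext x
  constructor
  · rintro ⟨ε, hε, rfl⟩
    exact ⟨ε.digit, hε, rfl⟩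
  · rintro ⟨e, he, rfl⟩
    exact ⟨PrimarySpace.mk e (h.mem_primarySet_of_le (le_of_fwd_adm he)), he, rfl⟩

/-- The admissible sequences are compact for coordinatewise convergence, and with bounded digits
both coordinate series converge uniformly, so the image is compact. -/
lemma isClosed_image_betaSet : IsClosed (h.coding '' betaSet r σ lam) := by
  rw [h.image_betaSet]
  refine ((isCompact_admissible _).image_of_continuousOn ?_).isClosed
  have h1 := (h.continuousOn_fwdCoord (quasiGreedy r σ 0)).mono
    (t := {e : ℤ → ℕ | ∀ N, ¬ LexLess (quasiGreedy r σ) (fwdSeq e N)})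
    fun e he n => le_of_fwd_adm he n
  have h2 := (h.continuousOn_bwdCoord (quasiGreedy r σ 0)).mono
    (t := {e : ℤ → ℕ | ∀ N, ¬ LexLess (quasiGreedy r σ) (fwdSeq e N)})
    fun e he n => le_of_fwd_adm he n
  refine continuous_torusProj.comp_continuousOn (continuousOn_pi.2 fun i => ?_)
  fin_cases i
  · exact h1.sub (((h1.add h2).div_const _).mul_const _)
  · exact (h1.add h2).div_const _

lemma smul_unstableVec_mem_image {t : ℝ} (ht : t ∈ Set.Ico (0 : ℝ) 1) :
    torusProj (t • unstableVec lam σ) ∈ h.coding '' betaSet r σ lam := by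
  obtain ⟨a, ha, hat⟩ := h.exists_expansion ht
  rw [h.image_betaSet]
  set e : ℤ → ℕ := fun n => if 1 ≤ n then a (n - 1).toNat else 0 with he
  have he1 : fwdSeq e 1 = a := by
    funext j
    simp only [fwdSeq, he]
    rw [if_pos (by omega)]
    congr 1
    omega
  refine ⟨e, fun N => ?_, ?_⟩
  · rcases le_or_gt 1 N with hN | hN
    · obtain ⟨k, rfl⟩ : ∃ k : ℕ, N = 1 + k := ⟨(N - 1).toNat, by omega⟩
      rw [← dropSeq_fwdSeq, he1]
      exact ha k
    · have h0 : fwdSeq e N 0 = 0 := by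
        simp only [fwdSeq, he]
        rw [if_neg (by push_cast; omega)]
      -- A tail starting with `0` cannot exceed the quasi-greedy expansion, whose first digit is
      -- positive.
      have hd := h.quasiGreedy_zero_pos
      rintro ⟨n, hn, hn'⟩
      rcases Nat.eq_zero_or_pos n with rfl | hpos
      · omega
      · have := hn 0 hpos
        omega
  · have h1 : ∀ n ≤ (0 : ℤ), e n = 0 := fun n hn => if_neg (by omega)
    simp only
    rw [h.coordVec_of_bwd_eq_zero h1, fwdCoord, zero_add, he1, hat]

omit h in
lemma shift_mem_betaSet {ε : PrimarySpace lam} :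
    ε.shift ∈ betaSet r σ lam ↔ ε ∈ betaSet r σ lam := by
  constructor
  · intro hε N
    have := hε (N - 1)
    rwa [PrimarySpace.tail_shift, sub_add_cancel] at this
  · intro hε N
    rw [PrimarySpace.tail_shift]
    exact hε _

/-- The shift preserves admissibility and multiplies the parameter on the unstable line by `λ`, so
the segment `[0, 1)` spreads over the half-line. -/
lemma halfLine_mem_image {t : ℝ} (ht : 0 ≤ t) :
    torusProj (t • unstableVec lam σ) ∈ h.coding '' betaSet r σ lam := by
  have key : ∀ k : ℕ, ∀ s ∈ Set.Ico (0 : ℝ) 1,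
      torusProj ((lam ^ k * s) • unstableVec lam σ) ∈ h.coding '' betaSet r σ lam := by
    intro k
    induction k with
    | zero => intro s hs; simpa using h.smul_unstableVec_mem_image hs
    | succ k ih =>
      intro s hs
      obtain ⟨ε, hε, hεs⟩ := ih s hs
      refine ⟨ε.shift, shift_mem_betaSet.2 hε, ?_⟩
      rw [h.coding_shift, hεs, intMap_torusProj, Matrix.mulVec_smul, h.mulVec_unstableVec, smul_smul,
        pow_succ]
      congr 2
      ring
  obtain ⟨k, hk⟩ := pow_unbounded_of_one_lt t h.one_lt
  have hp : 0 < lam ^ k := pow_pos h.pos k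
  have := key k (t / lam ^ k) ⟨by positivity, by rwa [div_lt_one hp]⟩
  rwa [mul_div_cancel₀ _ hp.ne'] at this

/-- The unstable half-line crosses a fixed horizontal circle in the forward orbit of a rotation by
`-λ'`, which is irrational. The orbit is dense and the image is closed, so the image contains every
horizontal circle. -/
lemma coding_surjOn : Set.SurjOn h.coding (betaSet r σ lam) Set.univ := by
  intro x _
  have hp := h.lam_sub_conj_pos
  have hirr : Irrational (-((σ : ℝ) * lam⁻¹)) := h.irrational_conj.neg
  have hdense : DenseRange fun j : ℕ => j • ((-((σ : ℝ) * lam⁻¹) : ℝ) : UnitAddCircle) := by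
    rw [← denseRange_zsmul_iff_nsmul, AddCircle.denseRange_zsmul_coe_iff]
    simpa using hirr
  set z := torusLift x with hz
  have hz1 : 0 ≤ z 1 := (torusLift_mem x 1 trivial).1.le
  let F : UnitAddCircle → UnitAddTorus (Fin 2) := fun c =>
    ![c + ((-((σ : ℝ) * lam⁻¹) * z 1 : ℝ) : UnitAddCircle), ((z 1 : ℝ) : UnitAddCircle)]
  have hF : Continuous F := by
    refine continuous_pi fun i => ?_
    fin_cases i
    · exact continuous_id.add continuous_const
    · exact continuous_const
  have hmem : ∀ c, F c ∈ h.coding '' betaSet r σ lam := by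
    intro c
    refine hdense.induction_on (p := fun c => F c ∈ h.coding '' betaSet r σ lam) c
      (h.isClosed_image_betaSet.preimage hF) fun j => ?_
    -- At this parameter the second coordinate is `z 1 + j`, congruent to `z 1`, and the first is
    -- `-λ' (z 1 + j)`. The parameter is nonnegative because the lift has coordinates in `(0, 1]`.
    have h1 := h.halfLine_mem_image (t := (z 1 + j) * (lam - σ * lam⁻¹)) (by positivity)
    convert h1 using 1
    funext i
    fin_cases i
    · simp only [F, torusProj, unstableVec]
      simp only [Fin.zero_eta, Matrix.cons_val_zero, Pi.smul_apply, smul_eq_mul]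
      rw [← AddCircle.coe_nsmul, ← AddCircle.coe_add, nsmul_eq_mul]
      congr 1
      generalize (σ : ℝ) * lam⁻¹ = c at hp ⊢
      field_simp
      ring
    · simp only [F, torusProj, unstableVec]
      simp only [Fin.mk_one, Matrix.cons_val_one, Matrix.cons_val_zero, Pi.smul_apply, smul_eq_mul]
      rw [mul_assoc, mul_one_div_cancel hp.ne', mul_one, AddCircle.coe_add]
      have : ((j : ℝ) : UnitAddCircle) = 0 :=
        (AddCircle.coe_eq_zero_iff (1 : ℝ)).2 ⟨j, by simp⟩
      simp [this]
  have hx : F (((z 0 + (σ : ℝ) * lam⁻¹ * z 1 : ℝ)) : UnitAddCircle) = x := by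
    rw [← torusProj_torusLift x]
    funext i
    fin_cases i
    · simp only [F, torusProj, ← AddCircle.coe_add]
      simp only [Fin.zero_eta, Matrix.cons_val_zero]
      congr 1
      rw [← hz]
      ring
    · rfl
  rw [← hx]
  exact hmem _

end IsQuadUnit

/-! ### Almost everywhere uniqueness -/

namespace IsQuadUnit

variable {r σ : ℤ} {lam : ℝ} (h : IsQuadUnit r σ lam)
include h

section
variable {e : ℤ → ℕ} (he : ∀ N, ¬ LexLess (quasiGreedy r σ) (fwdSeq e N))
include he

omit h in
lemma lexAdm_fwdSeq (N : ℤ) : LexAdm (quasiGreedy r σ) (fwdSeq e N) := fun k => by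
  rw [dropSeq_fwdSeq]; exact he _

lemma fwdCoord_mem (N : ℤ) : 0 ≤ fwdCoord lam e N ∧ fwdCoord lam e N ≤ 1 :=
  ⟨seqVal_nonneg h.inv_pos _, h.seqVal_le_one (lexAdm_fwdSeq he _)⟩

lemma lam_mul_fwdCoord_of_adm (N : ℤ) :
    lam * fwdCoord lam e N = e (N + 1) + fwdCoord lam e (N + 1) :=
  h.lam_mul_fwdCoord (h.summable_of_le fun _ => le_of_fwd_adm he _)

lemma bwdCoord_succ_of_adm (N : ℤ) :
    bwdCoord lam σ e (N + 1) = e (N + 1) + σ * lam⁻¹ * bwdCoord lam σ e N :=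
  h.bwdCoord_succ (h.summable_of_le fun _ => le_of_fwd_adm he _)

lemma torusProj_coordVec_succ_of_adm (N : ℤ) : torusProj (coordVec lam σ e (N + 1)) =
    intMap (companion r σ) (torusProj (coordVec lam σ e N)) :=
  h.torusProj_coordVec_succ (h.summable_of_le fun _ => le_of_fwd_adm he _)
    (h.summable_of_le fun _ => le_of_fwd_adm he _)

lemma exists_abs_bwdCoord_le : ∃ C, 0 ≤ C ∧ ∀ N, |bwdCoord lam σ e N| ≤ C := by
  have hs : Summable fun j => (quasiGreedy r σ 0 : ℝ) * lam⁻¹ ^ j :=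
    (summable_geometric_of_lt_one h.inv_pos.le h.inv_lt_one).mul_left _
  refine ⟨∑' j, (quasiGreedy r σ 0 : ℝ) * lam⁻¹ ^ j, tsum_nonneg fun j => ?_, fun N => ?_⟩
  · have := h.inv_pos
    positivity
  · rw [← Real.norm_eq_abs]
    refine tsum_of_norm_bounded hs.hasSum fun j => ?_
    have h1 := h.inv_pos
    rw [norm_mul, norm_pow, norm_mul, Real.norm_eq_abs (σ : ℝ), h.abs_sign, one_mul,
      Real.norm_of_nonneg h1.le, Real.norm_of_nonneg (by positivity)]
    have : (bwdSeq e N j : ℝ) ≤ quasiGreedy r σ 0 := by exact_mod_cast le_of_fwd_adm he _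
    gcongr

end

-- The two bounds on the past coordinate must be proved together. A last digit large enough to
-- endanger either of them forces the preceding future coordinate above `1 - 1/λ`, where the sharper
-- bound on the preceding past coordinate applies. Each step back shrinks the excess by the factor
-- `1/λ`.
omit h in
lemma bwdCoord_bounds_pos (h : IsQuadUnit r 1 lam) {e : ℤ → ℕ}
    (he : ∀ N, ¬ LexLess (quasiGreedy r 1) (fwdSeq e N)) (N : ℤ) :
    (1 - lam⁻¹ < fwdCoord lam e N → bwdCoord lam 1 e N ≤ lam - 1) ∧ bwdCoord lam 1 e N ≤ lam := by
  obtain ⟨C, hC0, hC⟩ := h.exists_abs_bwdCoord_le he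
  have h1 := h.one_lt
  have h2 := h.inv_pos
  have h3 := h.inv_lt_one
  have h4 := h.mul_inv
  have h5 := h.conj_eq
  push_cast at h5
  -- The Boolean selects the bound: `true` for `λ - 1`, claimed only under the condition on the
  -- future coordinate, `false` for `λ`.
  have key := le_of_contracting h2 h3 (ι := ℤ × Bool)
    (f := fun i => bwdCoord lam 1 e i.1 - bif i.2 then lam - 1 else lam)
    (P := fun i => i.2 = true → 1 - lam⁻¹ < fwdCoord lam e i.1) (b := 0) hC0
    (fun i _ => by
      have h6 := (abs_le.1 (hC i.1)).2
      rcases i with ⟨n, _ | _⟩ <;> simp only [cond_true, cond_false] <;> linarith) ?_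
  · refine ⟨fun hx => ?_, ?_⟩
    · simpa using key (N, true) fun _ => hx
    · simpa using key (N, false) (by simp)
  · intro t ht hall
    have hfree : ∀ n, bwdCoord lam 1 e n ≤ lam + t := fun n => by
      have := hall (n, false) (by simp)
      simp only [cond_false] at this
      linarith
    have hres : ∀ n, 1 - lam⁻¹ < fwdCoord lam e n → bwdCoord lam 1 e n ≤ lam - 1 + t :=
      fun n hn => by
        have := hall (n, true) fun _ => hn
        simp only [cond_true] at this
        linarith
    rintro ⟨n, s⟩ hs
    obtain ⟨m, rfl⟩ : ∃ m, n = m + 1 := ⟨n - 1, by ring⟩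
    have hx := h.lam_mul_fwdCoord_of_adm he m
    have hy := h.bwdCoord_succ_of_adm he m
    have hxm := h.fwdCoord_mem he m
    have hxn := h.fwdCoord_mem he (m + 1)
    simp only at hs ⊢
    generalize e (m + 1) = a at hx hy
    have hfm := hfree m
    have hrm := hres m
    generalize fwdCoord lam e m = x at hx hxm hrm
    generalize fwdCoord lam e (m + 1) = x' at hx hxn hs
    generalize bwdCoord lam 1 e m = y at hy hfm hrm
    generalize bwdCoord lam 1 e (m + 1) = y' at hy ⊢
    push_cast at hy
    rw [one_mul] at hy h5
    have hx2 : x = lam⁻¹ * (a + x') := by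
      rw [← hx, ← mul_assoc, mul_comm lam⁻¹, h4, one_mul]
    have hmf : lam⁻¹ * y ≤ 1 + lam⁻¹ * t := by
      calc lam⁻¹ * y ≤ lam⁻¹ * (lam + t) := by gcongr
        _ = _ := by rw [mul_add, mul_comm lam⁻¹ lam, h4]
    have hmr : 1 - lam⁻¹ < x → lam⁻¹ * y ≤ 1 - lam⁻¹ + lam⁻¹ * t := fun hxx => by
      calc lam⁻¹ * y ≤ lam⁻¹ * (lam - 1 + t) := by gcongr; exact hrm hxx
        _ = _ := by rw [mul_add, mul_sub, mul_comm lam⁻¹ lam, h4, mul_one]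
    have hlx : lam * x ≤ lam := mul_le_of_le_one_right (by linarith) hxm.2
    cases s
    · simp only [cond_false]
      have ha : (a : ℤ) < r := by
        have : (a : ℝ) < r := by linarith
        exact_mod_cast this
      rcases (show (a : ℤ) ≤ r - 2 ∨ (a : ℤ) = r - 1 by omega) with ha | ha
      · have ha' : (a : ℝ) ≤ r - 2 := by exact_mod_cast ha
        linarith
      · have ha' : (a : ℝ) = r - 1 := by exact_mod_cast ha
        have : 1 - lam⁻¹ < x := by
          rw [hx2, ha']
          nlinarith
        have := hmr this
        linarith
    · simp only [cond_true]
      have hs' := hs rfl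
      -- Here `a = λ x - x'` with `x ≤ 1` and `x' > 1 - 1/λ`, so `a < λ - 1 + 1/λ = r - 1`.
      have ha : (a : ℤ) < r - 1 := by
        have : (a : ℝ) < r - 1 := by linarith
        exact_mod_cast this
      rcases (show (a : ℤ) ≤ r - 3 ∨ (a : ℤ) = r - 2 by omega) with ha | ha
      · have ha' : (a : ℝ) ≤ r - 3 := by exact_mod_cast ha
        linarith
      · have ha' : (a : ℝ) = r - 2 := by exact_mod_cast ha
        have : 1 - lam⁻¹ < x := by
          rw [hx2, ha']
          nlinarith
        have := hmr this
        linarith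

-- With `λ' = -1/λ` the upper and lower bounds feed each other: `y' = a - y/λ` with `0 ≤ a ≤ r`
-- sends `[-1, λ]` into itself. Values above `λ - 1` need the last digit `r`, which leaves a future
-- coordinate of at most `λ - r = 1/λ`.
omit h in
lemma bwdCoord_bounds_neg (h : IsQuadUnit r (-1) lam) {e : ℤ → ℕ}
    (he : ∀ N, ¬ LexLess (quasiGreedy r (-1)) (fwdSeq e N)) (N : ℤ) :
    -1 ≤ bwdCoord lam (-1) e N ∧ (bwdCoord lam (-1) e N ≤ lam - 1 ∨
      fwdCoord lam e N ≤ lam⁻¹ ∧ lam - 1 ≤ bwdCoord lam (-1) e N ∧ bwdCoord lam (-1) e N ≤ lam) := by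
  obtain ⟨C, hC0, hC⟩ := h.exists_abs_bwdCoord_le he
  have h1 := h.one_lt
  have h2 := h.inv_pos
  have h3 := h.inv_lt_one
  have h4 := h.mul_inv
  have h5 := h.conj_eq
  push_cast at h5
  have hr : 1 ≤ r := by rcases h.sign with h6 | h6 <;> omega
  have hq0 : quasiGreedy r (-1) 0 = r.toNat := by simp [quasiGreedy]
  have hle : ∀ n, (e n : ℤ) ≤ r := fun n => by
    have := le_of_fwd_adm he n
    omega
  have hy := h.bwdCoord_succ_of_adm he
  push_cast at hy
  have key := le_of_contracting h2 h3 (ι := ℤ × Bool)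
    (f := fun i => bif i.2 then bwdCoord lam (-1) e i.1 - lam else -1 - bwdCoord lam (-1) e i.1)
    (P := fun i => True) (b := 0) hC0
    (fun i _ => by
      have h6 := abs_le.1 (hC i.1)
      rcases i with ⟨n, _ | _⟩ <;> simp only [cond_true, cond_false] <;> linarith [h6.1, h6.2]) ?_
  · have hlow : ∀ n, -1 ≤ bwdCoord lam (-1) e n := fun n => by
      have := key (n, false) trivial
      simp only [cond_false] at this
      linarith
    have hup : ∀ n, bwdCoord lam (-1) e n ≤ lam := fun n => by
      have := key (n, true) trivial
      simp only [cond_true] at this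
      linarith
    have hup' : ∀ n, (e n : ℤ) ≤ r - 1 → bwdCoord lam (-1) e n ≤ lam - 1 := fun n hn => by
      have hn' : (e n : ℝ) ≤ r - 1 := by exact_mod_cast hn
      have h6 := hy (n - 1)
      rw [sub_add_cancel] at h6
      have h7 : lam⁻¹ * (-1) ≤ lam⁻¹ * bwdCoord lam (-1) e (n - 1) := by
        gcongr; exact hlow _
      linarith
    refine ⟨hlow N, ?_⟩
    by_cases hN : (e N : ℤ) ≤ r - 1
    · exact Or.inl (hup' N hN)
    · right
      have hNr : (e N : ℤ) = r := le_antisymm (hle N) (by omega)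
      have hNr' : (e N : ℝ) = r := by exact_mod_cast hNr
      obtain ⟨M, rfl⟩ : ∃ M, N = M + 1 := ⟨N - 1, by ring⟩
      -- Two consecutive digits `r` would exceed the expansion `r 0 r 0 …`.
      have hM : (e M : ℤ) ≤ r - 1 := by
        by_contra hM
        refine he M ⟨1, fun m hm => ?_, ?_⟩
        · have : m = 0 := by omega
          subst this
          have := hle M
          rw [hq0]
          simp only [fwdSeq, Nat.cast_zero, add_zero]
          omega
        · simp only [fwdSeq, Nat.cast_one, quasiGreedy]
          simp
          omega
      refine ⟨?_, ?_, hup _⟩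
      · have h6 := h.lam_mul_fwdCoord_of_adm he M
        have h7 : lam * fwdCoord lam e M ≤ lam :=
          mul_le_of_le_one_right (by linarith) (h.fwdCoord_mem he M).2
        linarith
      · have h6 := hy M
        have h7 : lam⁻¹ * bwdCoord lam (-1) e M ≤ lam⁻¹ * (lam - 1) := by
          gcongr; exact hup' M hM
        rw [mul_sub, mul_comm lam⁻¹ lam, h4, mul_one] at h7
        linarith
  · intro t ht hall
    have hlow : ∀ n, -1 - t ≤ bwdCoord lam (-1) e n := fun n => by
      have := hall (n, false) trivial
      simp only [cond_false] at this
      linarith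
    have hup : ∀ n, bwdCoord lam (-1) e n ≤ lam + t := fun n => by
      have := hall (n, true) trivial
      simp only [cond_true] at this
      linarith
    rintro ⟨n, s⟩ -
    obtain ⟨m, rfl⟩ : ∃ m, n = m + 1 := ⟨n - 1, by ring⟩
    have h6 := hy m
    cases s
    · simp only [cond_false]
      have h7 : lam⁻¹ * bwdCoord lam (-1) e m ≤ lam⁻¹ * (lam + t) := by
        gcongr; exact hup _
      rw [mul_add, mul_comm lam⁻¹ lam, h4] at h7
      have : (0 : ℝ) ≤ e (m + 1) := by positivity
      linarith
    · simp only [cond_true]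
      have h7 : lam⁻¹ * (-1 - t) ≤ lam⁻¹ * bwdCoord lam (-1) e m := by
        gcongr; exact hlow _
      have h8 : (e (m + 1) : ℝ) ≤ r := by exact_mod_cast hle _
      linarith

/-- The pairs of coordinates of admissible sequences lie in a union of two rectangles of total area
`λ - λ'`. -/
lemma exists_region : ∃ b c : ℝ, b ≤ lam - 1 ∧ 0 ≤ c ∧ lam - 1 - b + c = lam - σ * lam⁻¹ ∧
    ∀ e : ℤ → ℕ, (∀ N, ¬ LexLess (quasiGreedy r σ) (fwdSeq e N)) → ∀ N,
      ![fwdCoord lam e N, bwdCoord lam σ e N] ∈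
        Set.Icc ![0, b] ![1, lam - 1] ∪ Set.Icc ![0, lam - 1] ![c, lam] := by
  have h1 := h.one_lt
  have h2 := h.inv_pos
  have h3 := h.inv_lt_one
  have hmem : ∀ x y x₁ y₁ x₂ y₂ : ℝ, ![x, y] ∈ Set.Icc ![x₁, y₁] ![x₂, y₂] ↔
      (x₁ ≤ x ∧ y₁ ≤ y) ∧ x ≤ x₂ ∧ y ≤ y₂ := fun x y x₁ y₁ x₂ y₂ => by
    simp [Set.mem_Icc, Pi.le_def, Fin.forall_fin_two]
  rcases h.sign with ⟨rfl, -⟩ | ⟨rfl, -⟩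
  -- `b` is the floor of the wide rectangle and `c` the width of the one on top of it, which has
  -- height one. For `σ = 1` the areas are `λ - 1` and `1 - 1/λ`; for `σ = -1` they are `λ` and
  -- `1/λ`.
  · refine ⟨0, 1 - lam⁻¹, by linarith, by linarith, by push_cast; ring, fun e he N => ?_⟩
    obtain ⟨hx0, hx1⟩ := h.fwdCoord_mem he N
    obtain ⟨hy1, hy2⟩ := h.bwdCoord_bounds_pos he N
    have hy0 : 0 ≤ bwdCoord lam 1 e N := tsum_nonneg fun j => by push_cast; positivity
    rw [Set.mem_union, hmem, hmem]
    by_cases hx : 1 - lam⁻¹ < fwdCoord lam e N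
    · exact Or.inl ⟨⟨hx0, hy0⟩, hx1, hy1 hx⟩
    · rcases le_total (bwdCoord lam 1 e N) (lam - 1) with hy | hy
      · exact Or.inl ⟨⟨hx0, hy0⟩, hx1, hy⟩
      · exact Or.inr ⟨⟨hx0, hy⟩, not_lt.1 hx, hy2⟩
  · refine ⟨-1, lam⁻¹, by linarith, by linarith, by push_cast; ring, fun e he N => ?_⟩
    obtain ⟨hx0, hx1⟩ := h.fwdCoord_mem he N
    obtain ⟨hy0, hy | ⟨hx2, hy1, hy2⟩⟩ := h.bwdCoord_bounds_neg he N
    · exact Or.inl ((hmem _ _ _ _ _ _).2 ⟨⟨hx0, hy0⟩, hx1, hy⟩)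
    · exact Or.inr ((hmem _ _ _ _ _ _).2 ⟨⟨hx0, hy1⟩, hx2, hy2⟩)

/-- The coordinate vectors of admissible sequences lie in a set of measure one. -/
lemma exists_measurable_coordVec_mem : ∃ B : Set (Fin 2 → ℝ), MeasurableSet B ∧ volume B ≤ 1 ∧
    ∀ e : ℤ → ℕ, (∀ N, ¬ LexLess (quasiGreedy r σ) (fwdSeq e N)) → ∀ N,
      coordVec lam σ e N ∈ B := by
  obtain ⟨b, c, hb, hc, hbc, hmem⟩ := h.exists_region
  set R : Set (Fin 2 → ℝ) := Set.Icc ![0, b] ![1, lam - 1] ∪ Set.Icc ![0, lam - 1] ![c, lam]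
  -- `L` sends `coordVec` to the pair of future and past coordinates. Its determinant `λ - λ'` is
  -- the area of the region, so the preimage has area at most one.
  set L := Matrix.toLin' !![1, lam; -1, -(σ * lam⁻¹)] with hL
  have hpos := h.lam_sub_conj_pos
  have hdet : LinearMap.det L = lam - σ * lam⁻¹ := by
    rw [hL, LinearMap.det_toLin', Matrix.det_fin_two]
    simp
    ring
  have hR : volume R ≤ ENNReal.ofReal (lam - σ * lam⁻¹) := by
    refine (measure_union_le _ _).trans ?_
    rw [Real.volume_Icc_pi, Real.volume_Icc_pi, ← hbc, Fin.prod_univ_two, Fin.prod_univ_two,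
      ENNReal.ofReal_add (by linarith) hc]
    simp
  refine ⟨L ⁻¹' R, ?_, ?_, fun e he N => ?_⟩
  · exact (measurableSet_Icc.union measurableSet_Icc).preimage
      L.continuous_of_finiteDimensional.measurable
  · rw [Measure.addHaar_preimage_linearMap _ (by rw [hdet]; exact hpos.ne'), hdet]
    calc _ ≤ ENNReal.ofReal |(lam - σ * lam⁻¹)⁻¹| * ENNReal.ofReal (lam - σ * lam⁻¹) := by gcongr
      _ = 1 := by
        rw [← ENNReal.ofReal_mul (abs_nonneg _), abs_of_pos (by positivity),
          inv_mul_cancel₀ hpos.ne', ENNReal.ofReal_one]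
  · have h2 : L (coordVec lam σ e N) = ![fwdCoord lam e N, bwdCoord lam σ e N] := by
      have h3 := coordVec_fwd (lam := lam) (σ := σ) e N
      have h4 := h.coordVec_bwd e N
      funext i
      fin_cases i
      · simp only [hL, Matrix.toLin'_apply, Matrix.mulVec, dotProduct, Fin.sum_univ_two]
        simp
        linarith
      · simp only [hL, Matrix.toLin'_apply, Matrix.mulVec, dotProduct, Fin.sum_univ_two]
        simp
        linarith
    rw [Set.mem_preimage, h2]
    exact hmem e he N

/-- The orbit of the coordinates of an admissible sequence. -/
lemma torusProj_coordVec_natCast {e : ℤ → ℕ}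
    (he : ∀ N, ¬ LexLess (quasiGreedy r σ) (fwdSeq e N)) (n : ℕ) :
    torusProj (coordVec lam σ e n) = intMap (companion r σ ^ n) (torusProj (coordVec lam σ e 0)) ∧
    torusProj (coordVec lam σ e (-n)) =
      intMap ((companion r σ)⁻¹ ^ n) (torusProj (coordVec lam σ e 0)) := by
  induction n with
  | zero => simp [intMap_one]
  | succ n ih =>
    constructor
    · rw [pow_succ', intMap_mul, ← ih.1, ← h.torusProj_coordVec_succ_of_adm he]
      push_cast; rfl
    · rw [pow_succ', intMap_mul, ← ih.2]
      have := h.torusProj_coordVec_succ_of_adm he (-((n + 1 : ℕ) : ℤ))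
      rw [show -((n + 1 : ℕ) : ℤ) + 1 = -(n : ℤ) by push_cast; ring] at this
      rw [this, intMap_inv_intMap h.isUnit_det_companion]

lemma torusProj_coordVec_congr {e e' : ℤ → ℕ}
    (he : ∀ N, ¬ LexLess (quasiGreedy r σ) (fwdSeq e N))
    (he' : ∀ N, ¬ LexLess (quasiGreedy r σ) (fwdSeq e' N))
    (hee : torusProj (coordVec lam σ e 0) = torusProj (coordVec lam σ e' 0)) (N : ℤ) :
    torusProj (coordVec lam σ e N) = torusProj (coordVec lam σ e' N) := by
  obtain ⟨n, rfl | rfl⟩ := N.eq_nat_or_neg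
  · rw [(h.torusProj_coordVec_natCast he n).1, (h.torusProj_coordVec_natCast he' n).1, hee]
  · rw [(h.torusProj_coordVec_natCast he n).2, (h.torusProj_coordVec_natCast he' n).2, hee]

/-- Almost every point has at most one admissible preimage. -/
lemma ae_coding_injOn : ∀ᵐ x, ∀ ε ∈ betaSet r σ lam, ∀ ε' ∈ betaSet r σ lam,
    h.coding ε = x → h.coding ε' = x → ε = ε' := by
  obtain ⟨B, hBm, hB1, hB⟩ := h.exists_measurable_coordVec_mem
  have hcov : ∀ x, ∃ p ∈ B, torusProj p = x := fun x => by
    obtain ⟨ε, hε, hx⟩ := h.coding_surjOn (Set.mem_univ x)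
    exact ⟨_, hB ε.digit hε 0, hx⟩
  have hae := ae_unique_of_cover hBm hB1 hcov
  have hu := h.isUnit_det_companion
  -- Uniqueness is imposed along the whole orbit, in both directions of time. Two codes of `x` then
  -- share their coordinates at every `N`, and the digits are read off from `λ x_N = e_{N+1} +
  -- x_{N+1}`.
  have hae1 : ∀ᵐ x, ∀ n : ℕ, ∀ p ∈ B, ∀ q ∈ B, torusProj p = intMap (companion r σ ^ n) x →
      torusProj q = intMap (companion r σ ^ n) x → p = q :=
    ae_all_iff.2 fun n => (measurePreserving_intMap
      (by rw [Matrix.det_pow]; exact hu.pow n)).quasiMeasurePreserving.ae hae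
  have hae2 : ∀ᵐ x, ∀ n : ℕ, ∀ p ∈ B, ∀ q ∈ B, torusProj p = intMap ((companion r σ)⁻¹ ^ n) x →
      torusProj q = intMap ((companion r σ)⁻¹ ^ n) x → p = q :=
    ae_all_iff.2 fun n => (measurePreserving_intMap (by
      rw [Matrix.det_pow]
      exact (Matrix.isUnit_nonsing_inv_det _ hu).pow n)).quasiMeasurePreserving.ae hae
  filter_upwards [hae1, hae2] with x hx1 hx2 ε hε ε' hε' hεx hεx'
  have hcoord : ∀ N, coordVec lam σ ε.digit N = coordVec lam σ ε'.digit N := by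
    rw [coding_apply] at hεx hεx'
    intro N
    obtain ⟨n, rfl | rfl⟩ := N.eq_nat_or_neg
    · refine hx1 n _ (hB _ hε _) _ (hB _ hε' _) ?_ ?_
      · rw [(h.torusProj_coordVec_natCast hε n).1, hεx]
      · rw [(h.torusProj_coordVec_natCast hε' n).1, hεx']
    · refine hx2 n _ (hB _ hε _) _ (hB _ hε' _) ?_ ?_
      · rw [(h.torusProj_coordVec_natCast hε n).2, hεx]
      · rw [(h.torusProj_coordVec_natCast hε' n).2, hεx']
  have hfwd : ∀ N, fwdCoord lam ε.digit N = fwdCoord lam ε'.digit N := fun N => by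
    rw [← coordVec_fwd (σ := σ), ← coordVec_fwd (σ := σ), hcoord]
  ext n
  have h1 := h.lam_mul_fwdCoord_of_adm hε (n - 1)
  have h2 := h.lam_mul_fwdCoord_of_adm hε' (n - 1)
  rw [sub_add_cancel] at h1 h2
  rw [hfwd, hfwd n, h2] at h1
  exact_mod_cast (add_right_cancel h1).symm

/-- The unstable line has irrational slope, so it meets the lattice only at the origin. -/
lemma smul_unstableVec_eq_intVec {s : ℝ} {k : Fin 2 → ℤ} (hs : s • unstableVec lam σ = intVec k) :
    s = 0 := by
  have hp := h.lam_sub_conj_pos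
  have h0 := congrFun hs 0
  have h1 := congrFun hs 1
  simp only [unstableVec, intVec, Pi.smul_apply, smul_eq_mul, Matrix.cons_val_zero,
    Matrix.cons_val_one] at h0 h1
  have h2 : (k 0 : ℝ) = -(σ * lam⁻¹) * k 1 := by
    rw [← h0, ← h1]; ring
  have hk : k 1 = 0 := by
    by_contra hk
    refine h.irrational_conj ⟨-(k 0 : ℚ) / k 1, ?_⟩
    have : (k 1 : ℝ) ≠ 0 := by exact_mod_cast hk
    push_cast
    rw [h2]
    field_simp
  rw [hk, Int.cast_zero] at h1
  rcases mul_eq_zero.1 h1 with h3 | h3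
  · exact h3
  · exact absurd h3 (by positivity)

/-- The coding is injective on finite admissible sequences. -/
lemma coding_injOn_finite : Set.InjOn h.coding {ε | ε ∈ betaSet r σ lam ∧ ε.IsFiniteSeq} := by
  rintro ε ⟨hε, hfin⟩ ε' ⟨hε', hfin'⟩ heq
  obtain ⟨K, hK⟩ := hfin.bddBelow
  obtain ⟨K', hK'⟩ := hfin'.bddBelow
  obtain ⟨U, hU⟩ := hfin.bddAbove
  obtain ⟨U', hU'⟩ := hfin'.bddAbove
  -- Before either sequence starts, both points lie on the unstable line, where equality modulo `ℤ²`
  -- is equality. The tails have value less than one because they are finite, so the common value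
  -- determines the digits.
  set N := min K K' - 1 with hN
  have hz : ∀ n ≤ N, ε.digit n = 0 := fun n hn => by
    by_contra hne
    have := hK hne
    omega
  have hz' : ∀ n ≤ N, ε'.digit n = 0 := fun n hn => by
    by_contra hne
    have := hK' hne
    omega
  have h1 := h.torusProj_coordVec_congr hε hε' heq N
  rw [h.coordVec_of_bwd_eq_zero hz, h.coordVec_of_bwd_eq_zero hz', torusProj_eq_iff] at h1
  obtain ⟨k, hk⟩ := h1
  have h2 := h.smul_unstableVec_eq_intVec (s := fwdCoord lam ε.digit N - fwdCoord lam ε'.digit N)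
    (k := k) (by rw [sub_smul, hk, add_sub_cancel_left])
  have h3 := eq_of_seqVal_eq h.inv_pos (ε.seqSummable_tail h.one_lt (N + 1))
    (ε'.seqSummable_tail h.one_lt (N + 1)) (fun k => ?_) (fun k => ?_) (sub_eq_zero.1 h2)
  · ext n
    rcases le_or_gt n N with hn | hn
    · rw [hz n hn, hz' n hn]
    · have := congrFun h3 (n - (N + 1)).toNat
      simp only [PrimarySpace.tail_apply] at this
      rwa [show N + 1 + ((n - (N + 1)).toNat : ℤ) = n by omega] at this
  · rw [PrimarySpace.dropSeq_tail]
    refine h.seqVal_lt_one (PrimarySpace.lexAdm_tail hε _) (n := (U - N).toNat) fun m hm => ?_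
    by_contra hne
    have := hU hne
    omega
  · rw [PrimarySpace.dropSeq_tail]
    refine h.seqVal_lt_one (PrimarySpace.lexAdm_tail hε' _) (n := (U' - N).toNat) fun m hm => ?_
    by_contra hne
    have := hU' hne
    omega

end IsQuadUnit

/-! ### Arithmetic codings contain all admissible sequences -/

lemma toLex_cons_zero_le {a b : ℕ → ℕ} (h0 : b 0 = 0) (hs : ∀ j, b (j + 1) = a j) :
    toLex b ≤ toLex a := by
  rw [← not_lexLess_iff]
  rintro ⟨n, hn, hn'⟩
  have hz : ∀ m < n, a m = 0 := by
    intro m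
    induction m with
    | zero => intro hm; rw [hn 0 hm, h0]
    | succ m ih => intro hm; rw [hn _ hm, hs, ih (by omega)]
  cases n with
  | zero => omega
  | succ n => rw [hs, hz n (by omega)] at hn'; omega

/-- Only starts in `[-n, n+1]` matter: earlier tails are zero-prefixed copies of the one at `-n`,
hence no larger by `toLex_cons_zero_le`, and later ones vanish like the one at `n + 1`. -/
lemma PrimarySpace.exists_max_tail {lam : ℝ} (n : ℕ) (ε : PrimarySpace lam) :
    ∃ K₀, ∀ K, toLex ((trunc n ε).tail K) ≤ toLex ((trunc n ε).tail K₀) := by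
  set f := trunc n ε with hf
  have hz : ∀ k, k < -(n : ℤ) ∨ (n : ℤ) < k → f.digit k = 0 := fun k hk => by
    rw [hf, digit_trunc, if_neg]
    rw [Finset.mem_Icc]
    omega
  obtain ⟨K₀, -, hK₀⟩ := Finset.exists_max_image (Finset.Icc (-(n : ℤ)) (n + 1))
    (fun K => toLex (f.tail K)) ⟨0, by rw [Finset.mem_Icc]; omega⟩
  refine ⟨K₀, fun K => ?_⟩
  by_cases h1 : K ∈ Finset.Icc (-(n : ℤ)) (n + 1)
  · exact hK₀ K h1
  · rw [Finset.mem_Icc] at h1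
    rcases lt_or_ge K (-(n : ℤ)) with h2 | h2
    · have key : ∀ j : ℕ, toLex (f.tail (-(n : ℤ) - j)) ≤ toLex (f.tail (-(n : ℤ))) := by
        intro j
        induction j with
        | zero => simp
        | succ j ih =>
          refine le_trans (toLex_cons_zero_le ?_ fun i => ?_) ih
          · exact hz _ (Or.inl (by push_cast; omega))
          · simp only [tail_apply]
            congr 1; push_cast; ring
      have h3 := key (-(n : ℤ) - K).toNat
      rw [show -(n : ℤ) - ((-(n : ℤ) - K).toNat : ℤ) = K by omega] at h3
      exact h3.trans (hK₀ _ (by rw [Finset.mem_Icc]; omega))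
    · have h3 : f.tail K = f.tail (n + 1) := by
        funext j
        rw [tail_apply, tail_apply, hz _ (Or.inr (by omega)), hz _ (Or.inr (by omega))]
      rw [h3]
      exact hK₀ _ (by rw [Finset.mem_Icc]; omega)

namespace IsQuadUnit

variable {r σ : ℤ} {lam : ℝ} (h : IsQuadUnit r σ lam)
include h

omit h in
lemma trunc_mem_betaSet {ε : PrimarySpace lam} (hε : ε ∈ betaSet r σ lam) (n : ℕ) :
    PrimarySpace.trunc n ε ∈ betaSet r σ lam := by
  intro N
  rw [not_lexLess_iff]
  refine le_trans (Pi.toLex_monotone fun j => ?_) ((not_lexLess_iff _ _).1 (hε N))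
  exact PrimarySpace.digit_trunc_le n ε _

/-- If all tails of the members of a family are at most `w` and the value of `w` is less than one,
then the family codes a null set. -/
lemma volume_image_eq_zero {X : Set (PrimarySpace lam)} {w : ℕ → ℕ} (hw : SeqSummable lam⁻¹ w)
    (hw1 : seqVal lam⁻¹ w < 1) (hX : ∀ ε ∈ X, ∀ N, ¬ LexLess w (ε.tail N))
    (C : Matrix (Fin 2) (Fin 2) ℤ) : volume ((fun ε => intMap C (h.coding ε)) '' X) = 0 := by
  set E := {x : ℝ | ∃ a, LexAdm w a ∧ seqVal lam⁻¹ a = x} with hE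
  have hE0 : volume E = 0 := volume_seqVal_eq_zero h.inv_pos h.inv_lt_one hw hw1
  -- The first coordinate of `L` is `p + q λ`, the future coordinate, which is confined to the null
  -- set `E`. The second row only makes `L` invertible.
  set L := Matrix.toLin' !![1, lam; 0, 1] with hL
  have hdet : LinearMap.det L = 1 := by
    rw [hL, LinearMap.det_toLin', Matrix.det_fin_two]
    simp
  have h1 : volume (L ⁻¹' ((fun v : Fin 2 → ℝ => v 0) ⁻¹' E)) = 0 := by
    rw [Measure.addHaar_preimage_linearMap _ (by rw [hdet]; exact one_ne_zero)]
    have : volume ((fun v : Fin 2 → ℝ => v 0) ⁻¹' E) = 0 := Measure.pi_eval_preimage_null _ hE0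
    rw [this, mul_zero]
  have h2 : volume ((Matrix.toLin' (realMat C)) '' (L ⁻¹' ((fun v : Fin 2 → ℝ => v 0) ⁻¹' E))) = 0 := by
    rw [Measure.addHaar_image_linearMap, h1, mul_zero]
  refine measure_mono_null ?_ (volume_image_torusProj_eq_zero h2)
  rintro _ ⟨ε, hε, rfl⟩
  refine ⟨_, ⟨coordVec lam σ ε.digit 0, ?_, rfl⟩, ?_⟩
  · have h3 := coordVec_fwd (lam := lam) (σ := σ) ε.digit 0
    refine ⟨ε.tail (0 + 1), PrimarySpace.lexAdm_tail (hX ε hε) _, ?_⟩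
    change fwdCoord lam ε.digit 0 = _
    rw [← h3, hL]
    simp only [Matrix.toLin'_apply, Matrix.mulVec, dotProduct, Fin.sum_univ_two]
    simp
    ring
  · rw [Matrix.toLin'_apply, ← intMap_torusProj]
    rfl

/-- A closed total set that codes the torus contains all admissible sequences. -/
lemma betaSet_subset {X : Set (PrimarySpace lam)} (hcl : IsClosed X) (htot : IsTotal X)
    {C : Matrix (Fin 2) (Fin 2) ℤ}
    (hsurj : Set.SurjOn (fun ε => intMap C (h.coding ε)) X Set.univ) : betaSet r σ lam ⊆ X := by
  intro ε hε
  refine hcl.mem_of_tendsto ε.tendsto_trunc (Eventually.of_forall fun n => ?_)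
  -- By totality no tail in `X` exceeds all tails of the missing truncation, so every tail in `X` is
  -- at most the greatest of these. That tail is finite and admissible, hence of value less than
  -- one, and `X` would code only a null set.
  by_contra hn
  obtain ⟨K, hK⟩ := PrimarySpace.exists_max_tail n ε
  have hadm := PrimarySpace.lexAdm_tail (trunc_mem_betaSet hε n) K
  have hlt : seqVal lam⁻¹ ((PrimarySpace.trunc n ε).tail K) < 1 := by
    refine h.seqVal_lt_one hadm (n := (n + 1 - K).toNat) fun m hm => ?_
    rw [PrimarySpace.tail_apply, PrimarySpace.digit_trunc, if_neg]
    rw [Finset.mem_Icc]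
    omega
  have h0 := h.volume_image_eq_zero (PrimarySpace.seqSummable_tail h.one_lt _ K) hlt
    (X := X) (fun ε' hε' N => ?_) C
  · rw [Set.univ_subset_iff.1 hsurj] at h0
    have h1 : volume (Set.univ : Set (UnitAddTorus (Fin 2))) = 1 := by
      rw [volume_pi, Measure.pi_univ]
      simp
    rw [h0] at h1
    exact zero_ne_one h1
  · have h1 : ¬ ∀ k : ℤ, LexLess ((PrimarySpace.trunc n ε).tail (N + k)) (ε'.tail N) := fun h2 =>
      hn (htot ε' hε' _ ⟨N, h2⟩)
    push Not at h1
    obtain ⟨k, hk⟩ := h1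
    rw [not_lexLess_iff] at hk ⊢
    exact hk.trans (hK _)

end IsQuadUnit

/-! ### Homoclinic points -/

lemma UnitAddCircle.exists_lift (x : UnitAddCircle) : ∃ y : ℝ, (y : UnitAddCircle) = x ∧ |y| = ‖x‖ := by
  induction x using QuotientAddGroup.induction_on with
  | H y =>
    refine ⟨y - round y, ?_, (UnitAddCircle.norm_eq).symm⟩
    rw [AddCircle.coe_sub, sub_eq_self]
    exact (AddCircle.coe_eq_zero_iff (1 : ℝ)).2 ⟨round y, by simp⟩

/-- An orbit on the torus tending to zero eventually lifts to a bounded orbit in the plane. -/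
lemma exists_bounded_orbit (A : Matrix (Fin 2) (Fin 2) ℤ) {t : ℕ → UnitAddTorus (Fin 2)}
    (hA : ∀ n, t (n + 1) = intMap A (t n)) (ht : Tendsto t atTop (𝓝 0)) :
    ∃ (N : ℕ) (w : ℕ → Fin 2 → ℝ), torusProj (w 0) = t N ∧
      (∀ n, w (n + 1) = (realMat A).mulVec (w n)) ∧ ∀ n i, |w n i| ≤ 1 := by
  have hl : ∀ n, ∃ w : Fin 2 → ℝ, torusProj w = t n ∧ ∀ i, |w i| = ‖t n i‖ := fun n => by
    choose w hw hw' using fun i => UnitAddCircle.exists_lift (t n i)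
    exact ⟨w, funext hw, hw'⟩
  choose w hw hw' using hl
  set S : ℝ := ∑ i, ∑ j, |(A i j : ℝ)| with hS
  have hS0 : 0 ≤ S := Finset.sum_nonneg fun i _ => Finset.sum_nonneg fun j _ => abs_nonneg _
  -- With lifts of size below `1/(S+2)`, the integer error between `A w_n` and `w_{n+1}` is at most
  -- `(S+1)/(S+2) < 1`, so it vanishes.
  have hδ : 0 < 1 / (S + 2) := by positivity
  have hsmall : ∀ᶠ n in atTop, ∀ i, ‖t n i‖ < 1 / (S + 2) := by
    rw [eventually_all]
    intro i
    have h1 : Tendsto (fun n => t n i) atTop (𝓝 0) := (tendsto_pi_nhds.1 ht) i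
    exact (tendsto_zero_iff_norm_tendsto_zero.1 h1).eventually_lt_const hδ
  obtain ⟨N, hN⟩ := eventually_atTop.1 hsmall
  have hb : ∀ n i, |w (N + n) i| < 1 / (S + 2) := fun n i => by
    rw [hw']; exact hN _ (by omega) i
  refine ⟨N, fun n => w (N + n), by simp [hw], fun n => ?_, fun n i => ?_⟩
  · have h1 : torusProj ((realMat A).mulVec (w (N + n))) = torusProj (w (N + (n + 1))) := by
      rw [← intMap_torusProj, hw, hw, ← hA, add_assoc]
    obtain ⟨k, hk⟩ := (torusProj_eq_iff _ _).1 h1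
    suffices k = 0 by
      rw [hk, this]
      funext i; simp [intVec]
    funext i
    have h2 := congrFun hk i
    simp only [Pi.add_apply, intVec] at h2
    have h3 : |(realMat A).mulVec (w (N + n)) i| ≤ S * (1 / (S + 2)) := by
      simp only [Matrix.mulVec, dotProduct, realMat, Matrix.map_apply]
      refine (Finset.abs_sum_le_sum_abs _ _).trans ?_
      calc ∑ j, |(A i j : ℝ) * w (N + n) j| ≤ ∑ j, |(A i j : ℝ)| * (1 / (S + 2)) := by
            refine Finset.sum_le_sum fun j _ => ?_
            rw [abs_mul]
            gcongr
            exact (hb n j).le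
        _ = (∑ j, |(A i j : ℝ)|) * (1 / (S + 2)) := by rw [Finset.sum_mul]
        _ ≤ S * (1 / (S + 2)) := by
            gcongr
            exact Finset.single_le_sum (f := fun i => ∑ j, |(A i j : ℝ)|)
              (fun i _ => Finset.sum_nonneg fun j _ => abs_nonneg _) (Finset.mem_univ i)
    have h4 := hb (n + 1) i
    have h5 : |(k i : ℝ)| < 1 := by
      have : (k i : ℝ) = (realMat A).mulVec (w (N + n)) i - w (N + (n + 1)) i := by
        rw [h2]; ring
      rw [this]
      refine (abs_sub _ _).trans_lt ?_
      have h6 : S * (1 / (S + 2)) + 1 / (S + 2) < 1 := by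
        have : S * (1 / (S + 2)) + 1 / (S + 2) = (S + 1) / (S + 2) := by ring
        rw [this, div_lt_one (by positivity)]
        linarith
      linarith
    have h6 : |k i| < 1 := by exact_mod_cast h5
    simpa using Int.abs_lt_one_iff.1 h6
  · refine (hb n i).le.trans ?_
    rw [div_le_one (by positivity)]
    linarith

/-- A point whose forward orbit tends to zero has a representative on the contracted line. -/
lemma exists_eigenvector_of_tendsto {A : Matrix (Fin 2) (Fin 2) ℤ} (hA : IsUnit A.det) {α β : ℝ}
    (hα : 1 < |α|) (hβ : β ≠ 0)
    (hαβ : ∀ w, (realMat A).mulVec ((realMat A).mulVec w - β • w) =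
      α • ((realMat A).mulVec w - β • w)) {t : ℕ → UnitAddTorus (Fin 2)}
    (ht' : ∀ n, t (n + 1) = intMap A (t n)) (ht : Tendsto t atTop (𝓝 0)) :
    ∃ w, (realMat A).mulVec w = β • w ∧ torusProj w = t 0 := by
  obtain ⟨N, w, hw0, hw, hwb⟩ := exists_bounded_orbit A ht' ht
  -- Applying `A - β` leaves only the expanding component, which grows like `α^n`. The orbit is
  -- bounded, so that component is zero and `w 0` is an eigenvector for `β`.
  set u : ℕ → Fin 2 → ℝ := fun n => (realMat A).mulVec (w n) - β • w n with hu
  have hun : ∀ n, u n = α ^ n • u 0 := fun n => by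
    induction n with
    | zero => simp
    | succ n ih =>
      rw [pow_succ', mul_smul, ← ih]
      simp only [hu]
      rw [hw n, ← hαβ, Matrix.mulVec_sub, Matrix.mulVec_smul]
  have hu0 : u 0 = 0 := by
    funext i
    by_contra hne
    have hb : ∀ n, |α| ^ n * |u 0 i| ≤ 1 + |β| := fun n => by
      have h1 := congrFun (hun n) i
      rw [Pi.smul_apply, smul_eq_mul] at h1
      rw [← abs_pow, ← abs_mul, ← h1]
      simp only [hu, Pi.sub_apply, Pi.smul_apply, smul_eq_mul, ← hw n]
      refine (abs_sub _ _).trans ?_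
      rw [abs_mul]
      have h2 := hwb n i
      have h3 := hwb (n + 1) i
      have h4 : |β| * |w n i| ≤ |β| * 1 := by gcongr
      linarith
    have hpos : 0 < |u 0 i| := abs_pos.2 hne
    obtain ⟨n, hn⟩ := pow_unbounded_of_one_lt ((1 + |β|) / |u 0 i|) hα
    rw [div_lt_iff₀ hpos] at hn
    exact absurd (hb n) (not_le.2 hn)
  have heig : (realMat A).mulVec (w 0) = β • w 0 := sub_eq_zero.1 hu0
  have hpow : ∀ k : ℕ, ∀ c : ℝ, (realMat (A ^ k)).mulVec (c • w 0) = (c * β ^ k) • w 0 := by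
    intro k
    induction k with
    | zero => intro c; simp [realMat_one]
    | succ k ih =>
      intro c
      rw [pow_succ', realMat_mul, ← Matrix.mulVec_mulVec, ih, Matrix.mulVec_smul, heig, smul_smul]
      congr 1; ring
  have htk : ∀ k, t k = intMap (A ^ k) (t 0) := fun k => by
    induction k with
    | zero => simp [intMap_one]
    | succ k ih => rw [ht', ih, ← intMap_mul, pow_succ']
  -- `w 0` represents the point at time `N`; dividing by `β^N` returns along the eigenline to time
  -- `0`.
  refine ⟨(β ^ N)⁻¹ • w 0, ?_, ?_⟩
  · rw [Matrix.mulVec_smul, heig, smul_comm]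
  · apply intMap_injective (C := A ^ N) (by rw [Matrix.det_pow]; exact hA.pow N)
    rw [← htk, intMap_torusProj, hpow, inv_mul_cancel₀ (pow_ne_zero _ hβ), one_smul, hw0]

/-! ### The codings of a toral automorphism -/

/-- The matrix with columns `m` and `M m`. -/
def cyclicMat (M : GL (Fin 2) ℤ) (m : Fin 2 → ℤ) : Matrix (Fin 2) (Fin 2) ℤ :=
  !![m 0, M.1.mulVec m 0; m 1, M.1.mulVec m 1]

/-- By Cayley–Hamilton `M` acts on the pair `m`, `M m` as the companion matrix. This carries the
companion coding over to `M`. -/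
lemma mul_cyclicMat (M : GL (Fin 2) ℤ) (m : Fin 2 → ℤ) :
    M.1 * cyclicMat M m = cyclicMat M m * companion M.1.trace M.1.det := by
  ext i j
  fin_cases i <;> fin_cases j <;>
    simp [cyclicMat, companion, Matrix.mul_apply, Fin.sum_univ_two, Matrix.mulVec, dotProduct,
      Matrix.trace_fin_two, Matrix.det_fin_two] <;> ring

/-- The representative on the unstable line of the homoclinic point attached to `m`. -/
noncomputable def homVec (M : GL (Fin 2) ℤ) (m : Fin 2 → ℤ) : Fin 2 → ℝ :=
  (realMat (cyclicMat M m)).mulVec (unstableVec (eigen M) M.1.det)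

lemma isUnit_det_coe (M : GL (Fin 2) ℤ) : IsUnit M.1.det := Matrix.isUnits_det_units M

lemma toralMap_mul (A M : GL (Fin 2) ℤ) (x : UnitAddTorus (Fin 2)) :
    toralMap (A * M) x = toralMap A (toralMap M x) := by
  simp only [toralMap_eq, Units.val_mul, intMap_mul]

lemma toralMap_injective (M : GL (Fin 2) ℤ) : Function.Injective (toralMap M) :=
  intMap_injective (isUnit_det_coe M)

/-- Two continuous homomorphisms agreeing on the sequences with a single nonzero digit are equal. -/
lemma PrimarySpace.hom_ext {lam : ℝ} {φ ψ : PrimarySpace lam →+ UnitAddTorus (Fin 2)}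
    (hφ : Continuous φ) (hψ : Continuous ψ) (h : ∀ n, φ (single lam n) = ψ (single lam n)) :
    φ = ψ := by
  ext1 ε
  have h1 : ∀ N, φ (trunc N ε) = ψ (trunc N ε) := fun N => by
    simp only [trunc, map_sum, map_nsmul, h]
  have h2 : Tendsto (fun N => φ (trunc N ε)) atTop (𝓝 (φ ε)) :=
    (hφ.tendsto ε).comp ε.tendsto_trunc
  have h3 : Tendsto (fun N => ψ (trunc N ε)) atTop (𝓝 (ψ ε)) :=
    (hψ.tendsto ε).comp ε.tendsto_trunc
  simp_rw [h1] at h2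
  exact tendsto_nhds_unique h2 h3

lemma isGivenBy_unique {M : GL (Fin 2) ℤ} {φ ψ : PrimarySpace (eigen M) →+ UnitAddTorus (Fin 2)}
    {v : Fin 2 → ℝ} (hφ : IsGivenBy M φ v) (hψ : IsGivenBy M ψ v) : φ = ψ := by
  ext1 ε
  exact tendsto_nhds_unique (hφ ε) (hψ ε)

lemma IsGivenBy.single_zero {M : GL (Fin 2) ℤ} {φ : PrimarySpace (eigen M) →+ UnitAddTorus (Fin 2)}
    {v : Fin 2 → ℝ} (hφ : IsGivenBy M φ v) :
    φ (PrimarySpace.single (eigen M) 0) = torusProj v := by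
  refine tendsto_nhds_unique (hφ _) (tendsto_const_nhds.congr fun N => ?_)
  rw [Finset.sum_eq_single 0]
  · simp
  · intro n _ hn
    simp [hn]
  · intro h0
    rw [Finset.mem_Icc] at h0
    omega

section
variable {M : GL (Fin 2) ℤ} (hq : IsQuadUnit M.1.trace M.1.det (eigen M))
include hq

/-- The coding attached to the integer vector `m`. -/
noncomputable def matrixCoding (m : Fin 2 → ℤ) :
    PrimarySpace (eigen M) →+ UnitAddTorus (Fin 2) :=
  (intMap (cyclicMat M m)).comp hq.coding

lemma matrixCoding_apply (m : Fin 2 → ℤ) (ε : PrimarySpace (eigen M)) :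
    matrixCoding hq m ε = intMap (cyclicMat M m) (hq.coding ε) := rfl

lemma continuous_matrixCoding (m : Fin 2 → ℤ) : Continuous (matrixCoding hq m) :=
  (continuous_intMap _).comp hq.continuous_coding

lemma matrixCoding_shift (m : Fin 2 → ℤ) (ε : PrimarySpace (eigen M)) :
    matrixCoding hq m ε.shift = toralMap M (matrixCoding hq m ε) := by
  rw [matrixCoding_apply, matrixCoding_apply, hq.coding_shift, ← intMap_mul, ← mul_cyclicMat,
    intMap_mul, toralMap_eq]

lemma isGivenBy_matrixCoding (m : Fin 2 → ℤ) : IsGivenBy M (matrixCoding hq m) (homVec M m) := by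
  intro ε
  have h1 := ((continuous_matrixCoding hq m).tendsto ε).comp ε.tendsto_trunc
  refine h1.congr fun N => ?_
  rw [Function.comp, matrixCoding_apply, hq.coding_trunc, intMap_torusProj, Matrix.mulVec_smul]
  rfl

lemma mulVec_homVec (m : Fin 2 → ℤ) :
    (realMat M.1).mulVec (homVec M m) = eigen M • homVec M m := by
  unfold homVec
  rw [Matrix.mulVec_mulVec, ← realMat_mul, mul_cyclicMat, realMat_mul, ← Matrix.mulVec_mulVec,
    hq.mulVec_unstableVec, Matrix.mulVec_smul]

omit hq in
lemma toralMap_zpow_single {φ : PrimarySpace (eigen M) →+ UnitAddTorus (Fin 2)}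
    (hφ : ∀ ε, φ ε.shift = toralMap M (φ ε)) (n : ℤ) :
    toralMap (M ^ n) (φ (PrimarySpace.single _ 0)) = φ (PrimarySpace.single _ (-n)) := by
  have hstep : ∀ k, φ (PrimarySpace.single _ (k - 1)) = toralMap M (φ (PrimarySpace.single _ k)) :=
    fun k => by rw [← PrimarySpace.shift_single, hφ]
  induction n using Int.induction_on with
  | zero => simp [toralMap_eq, intMap_one]
  | succ n ih =>
    rw [add_comm, zpow_add, zpow_one, toralMap_mul, ih, ← hstep]
    congr 2; ring
  | pred n ih =>
    apply toralMap_injective M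
    rw [← toralMap_mul, ← zpow_one_add, ← hstep]
    rw [show (1 : ℤ) + (-(n : ℤ) - 1) = -n by ring, ih]
    congr 2; ring

/-- The orbit of this point is the sequence of codes of `single (-n)`, and these sequences tend to
zero in both directions. -/
lemma isHomoclinicCoord_homVec (m : Fin 2 → ℤ) : IsHomoclinicCoord M (homVec M m) := by
  refine ⟨mulVec_homVec hq m, ?_⟩
  have h1 := (isGivenBy_matrixCoding hq m).single_zero
  have h2 : ∀ l : Filter ℤ, Tendsto Int.natAbs l atTop →
      Tendsto (fun n : ℤ => toralMap (M ^ n) (torusProj (homVec M m))) l (𝓝 0) := by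
    intro l hl
    have h3 : Tendsto (fun n : ℤ => PrimarySpace.single (eigen M) (-n)) l (𝓝 0) :=
      (PrimarySpace.tendsto_single hq.one_lt (l := l.map Neg.neg)
        (by rw [tendsto_map'_iff]; simpa [Function.comp_def] using hl)).comp tendsto_map
    have h4 := ((continuous_matrixCoding hq m).tendsto 0).comp h3
    rw [map_zero] at h4
    refine h4.congr fun n => ?_
    rw [← h1, toralMap_zpow_single (matrixCoding_shift hq m)]
    rfl
  exact ⟨h2 _ (tendsto_atTop.2 fun b => (eventually_ge_atTop (b : ℤ)).mono fun n hn => by omega),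
    h2 _ (tendsto_atTop.2 fun b => (eventually_le_atBot (-(b : ℤ))).mono fun n hn => by omega)⟩

/-- Every continuous equivariant homomorphism is the coding of an integer vector. -/
lemma exists_eq_matrixCoding {φ : PrimarySpace (eigen M) →+ UnitAddTorus (Fin 2)}
    (hc : Continuous φ) (hφ : ∀ ε, φ ε.shift = toralMap M (φ ε)) :
    ∃ m, φ = matrixCoding hq m := by
  have hstep : ∀ k, φ (PrimarySpace.single _ (k - 1)) = intMap M.1 (φ (PrimarySpace.single _ k)) :=
    fun k => by rw [← PrimarySpace.shift_single, hφ, toralMap_eq]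
  have hlim : ∀ l : Filter ℤ, Tendsto Int.natAbs l atTop →
      Tendsto (fun n => φ (PrimarySpace.single _ n)) l (𝓝 0) := fun l hl => by
    have := (hc.tendsto 0).comp (PrimarySpace.tendsto_single hq.one_lt hl)
    rwa [map_zero] at this
  have hu := isUnit_det_coe M
  have hl := hq.pos
  have hl1 := hq.one_lt
  have hmi := hq.mul_inv
  have hσ2 : ((M.1.det : ℤ) : ℝ) * M.1.det = 1 := by
    have := hq.abs_sign
    rw [← abs_mul_abs_self, this, one_mul]
  have hσ0 : ((M.1.det : ℤ) : ℝ) ≠ 0 := left_ne_zero_of_mul_eq_one hσ2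
  have hconj := hq.conj_eq
  have hCH : ∀ w, (realMat M.1).mulVec ((realMat M.1).mulVec w) =
      (M.1.trace : ℝ) • (realMat M.1).mulVec w - (M.1.det : ℝ) • w := fun w => by
    funext i
    fin_cases i <;>
      simp [realMat, Matrix.mulVec, dotProduct, Fin.sum_univ_two, Matrix.trace_fin_two,
        Matrix.det_fin_two] <;> ring
  have htr : (M.1.trace : ℝ) = eigen M + M.1.det * (eigen M)⁻¹ := by linarith
  have hdet : ((M.1.det : ℤ) : ℝ) = eigen M * (M.1.det * (eigen M)⁻¹) := by
    rw [mul_left_comm, hmi, mul_one]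
  set c : ℝ := M.1.det * (eigen M)⁻¹ with hc'
  have hc0 : c ≠ 0 := mul_ne_zero hσ0 (inv_ne_zero hl.ne')
  -- the representative on the stable line
  obtain ⟨s, hs, hst⟩ := exists_eigenvector_of_tendsto hu (α := eigen M) (β := c)
    (by rwa [abs_of_pos hl]) hc0 (fun w => by
      rw [Matrix.mulVec_sub, Matrix.mulVec_smul, hCH, htr, hdet]
      module)
    (t := fun n : ℕ => φ (PrimarySpace.single _ (-(n : ℤ))))
    (fun n => by rw [← hstep]; congr 2; push_cast; ring)
    (hlim (map (fun n : ℕ => -(n : ℤ)) atTop) (by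
      rw [tendsto_map'_iff]
      simp only [Function.comp_def, Int.natAbs_neg, Int.natAbs_natCast]
      exact tendsto_id) |>.comp tendsto_map)
  -- the representative on the unstable line
  have hMM : realMat M.1 * realMat (M.1)⁻¹ = 1 := by
    rw [← realMat_mul, Matrix.mul_nonsing_inv _ hu, realMat_one]
  have hMM' : realMat (M.1)⁻¹ * realMat M.1 = 1 := by
    rw [← realMat_mul, Matrix.nonsing_inv_mul _ hu, realMat_one]
  have hMv : ∀ y, (realMat M.1).mulVec ((realMat (M.1)⁻¹).mulVec y) = y := fun y => by
    rw [Matrix.mulVec_mulVec, hMM, Matrix.one_mulVec]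
  obtain ⟨v, hv, hvt⟩ := exists_eigenvector_of_tendsto (A := (M.1)⁻¹)
    (Matrix.isUnit_nonsing_inv_det _ hu) (α := c⁻¹) (β := (eigen M)⁻¹)
    (by
      rw [abs_inv, hc', abs_mul, hq.abs_sign, one_mul, abs_inv, inv_inv, abs_of_pos hl]
      exact hl1) (inv_ne_zero hl.ne') (fun w => by
      obtain ⟨x, rfl⟩ : ∃ x, w = (realMat M.1).mulVec ((realMat M.1).mulVec x) :=
        ⟨(realMat (M.1)⁻¹).mulVec ((realMat (M.1)⁻¹).mulVec w), by rw [hMv, hMv]⟩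
      have h1 : ∀ y, (realMat (M.1)⁻¹).mulVec ((realMat M.1).mulVec y) = y := fun y => by
        rw [Matrix.mulVec_mulVec, hMM', Matrix.one_mulVec]
      rw [Matrix.mulVec_sub, Matrix.mulVec_smul, h1, h1, hCH, htr, hdet]
      match_scalars <;> field_simp <;> ring)
    (t := fun n : ℕ => φ (PrimarySpace.single _ (n : ℤ)))
    (fun n => by
      have := hstep ((n + 1 : ℕ) : ℤ)
      push_cast at this ⊢
      rw [add_sub_cancel_right] at this
      rw [this, intMap_inv_intMap hu])
    (hlim (map (fun n : ℕ => (n : ℤ)) atTop) (by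
      rw [tendsto_map'_iff]
      simp only [Function.comp_def, Int.natAbs_natCast]
      exact tendsto_id) |>.comp tendsto_map)
  have hv' : (realMat M.1).mulVec v = eigen M • v := by
    have h1 := hMv v
    rw [hv, Matrix.mulVec_smul] at h1
    rw [← h1, smul_smul, h1, hmi, one_smul]
  -- Both vectors represent the same torus point, so `v - s` is an integer vector `m`. Applying `M`
  -- separates its two components: `v = (M m - λ' m) / (λ - λ')`.
  obtain ⟨m, hm⟩ := (torusProj_eq_iff v s).1 (by rw [hvt, hst]; simp)
  have hvm : homVec M m = v := by
    have h1 : ∀ i, v i = s i + m i := fun i => congrFun hm i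
    have h2 : ∀ i, (realMat M.1).mulVec v i = eigen M * v i := fun i => congrFun hv' i
    have h3 : ∀ i, (realMat M.1).mulVec s i = c * s i := fun i => congrFun hs i
    have h4 : ∀ i, ((M.1.mulVec m i : ℤ) : ℝ) = eigen M * v i - c * s i := fun i => by
      have : ((M.1.mulVec m i : ℤ) : ℝ) = (realMat M.1).mulVec (intVec m) i := by
        rw [realMat_mulVec_intVec]; rfl
      rw [this, ← h2, ← h3, hm, Matrix.mulVec_add]
      simp
    have h5 : eigen M - c ≠ 0 := hq.lam_sub_conj_pos.ne'
    have h6 : ∀ i, homVec M m i = (-c * m i + M.1.mulVec m i) / (eigen M - c) := fun i => by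
      fin_cases i <;>
      · simp only [homVec, cyclicMat, unstableVec, realMat, Matrix.mulVec, dotProduct,
          Fin.sum_univ_two, Matrix.map_apply]
        simp [← hc']
        ring
    funext i
    rw [h6, h4, h1, div_eq_iff h5]
    ring
  refine ⟨m, PrimarySpace.hom_ext hc (continuous_matrixCoding hq m) fun n => ?_⟩
  have h7 := toralMap_zpow_single hφ (-n)
  have h8 := toralMap_zpow_single (matrixCoding_shift hq m) (-n)
  rw [neg_neg] at h7 h8
  rw [← h7, ← h8, (isGivenBy_matrixCoding hq m).single_zero, hvm, hvt]
  rfl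

/-- The integer matrix is then an automorphism of the torus, so surjectivity and injectivity pass
over from the companion coding. -/
lemma isArithmeticCoding_matrixCoding {m : Fin 2 → ℤ} (hm : IsUnit (cyclicMat M m).det) :
    IsArithmeticCoding M (matrixCoding hq m) (betaSet M.1.trace M.1.det (eigen M)) where
  continuous := continuous_matrixCoding hq m
  equivariant := matrixCoding_shift hq m
  closed := PrimarySpace.isClosed_lex hq.pos.ne' _
  shift_invariant _ := IsQuadUnit.shift_mem_betaSet
  total := by
    rintro ε hε ε' ⟨N, hN⟩ K hK
    have h1 := hN (K - N)
    rw [add_sub_cancel] at h1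
    exact hε N (lexLess_trans hK h1)
  surjOn := by
    intro x _
    obtain ⟨ε, hε, hx⟩ := hq.coding_surjOn (Set.mem_univ (intMap (cyclicMat M m)⁻¹ x))
    refine ⟨ε, hε, ?_⟩
    rw [matrixCoding_apply, hx, intMap_intMap_inv hm]
  injOn_finite := fun _ hε _ hε' h =>
    hq.coding_injOn_finite hε hε' (intMap_injective hm h)

lemma isBAC_matrixCoding {m : Fin 2 → ℤ} (hm : IsUnit (cyclicMat M m).det) :
    IsBAC M (matrixCoding hq m) := by
  refine ⟨_, isArithmeticCoding_matrixCoding hq hm, ?_⟩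
  have hm' := Matrix.isUnit_nonsing_inv_det _ hm
  filter_upwards [(measurePreserving_intMap hm').quasiMeasurePreserving.ae hq.ae_coding_injOn]
    with x hx
  obtain ⟨ε, hε, hεx⟩ := hq.coding_surjOn (Set.mem_univ (intMap (cyclicMat M m)⁻¹ x))
  refine ⟨ε, ⟨hε, ?_⟩, ?_⟩
  · rw [matrixCoding_apply, hεx, intMap_intMap_inv hm]
  · rintro ε' ⟨hε', hεx'⟩
    refine hx ε' hε' ε hε ?_ hεx
    rw [← hεx', matrixCoding_apply, intMap_inv_intMap hm]

/-- Every bijective arithmetic coding is the coding of a cyclic vector. -/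
lemma IsBAC.exists_eq_matrixCoding {φ : PrimarySpace (eigen M) →+ UnitAddTorus (Fin 2)}
    (hφ : IsBAC M φ) : ∃ m, IsUnit (cyclicMat M m).det ∧ φ = matrixCoding hq m := by
  obtain ⟨X, hX, hae⟩ := hφ
  obtain ⟨m, rfl⟩ := ArithmeticCoding.exists_eq_matrixCoding hq hX.continuous hX.equivariant
  refine ⟨m, isUnit_det_of_injective fun a b hab => ?_, rfl⟩
  have hsub := hq.betaSet_subset hX.closed hX.total (C := cyclicMat M m) hX.surjOn
  have : (ae (volume : Measure (UnitAddTorus (Fin 2)))).NeBot := by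
    rw [ae_neBot]
    intro h0
    have h1 : volume (Set.univ : Set (UnitAddTorus (Fin 2))) = 1 := by
      rw [volume_pi, Measure.pi_univ]
      simp
    rw [h0] at h1
    exact zero_ne_one h1
  obtain ⟨x, ε, ⟨-, hεx⟩, huniq⟩ := hae.exists
  -- Every point over `x` has a code in `betaSet ⊆ X`, and uniqueness over `x` makes all these codes
  -- equal to `ε`. So `x` has a single preimage under the matrix, and adding `a - b` to it changes
  -- nothing.
  have key : ∀ c, intMap (cyclicMat M m) c = x → hq.coding ε = c := fun c hc => by
    obtain ⟨ε', hε', hc'⟩ := hq.coding_surjOn (Set.mem_univ c)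
    rw [← huniq ε' ⟨hsub hε', by rw [matrixCoding_apply, hc', hc]⟩, hc']
  have h1 := key (hq.coding ε + (a - b)) (by
    rw [map_add, map_sub, hab, sub_self, add_zero]; exact hεx)
  exact (sub_eq_zero.1 (left_eq_add.1 h1))

end

/-! ### The Dirichlet group -/

lemma neg_mem_signedPowers {μ u : ℝ} (hu : -u ∈ signedPowers μ) : u ∈ signedPowers μ := by
  obtain ⟨k, hk | hk⟩ := hu
  · exact ⟨k, Or.inr (by rw [← hk, neg_neg])⟩
  · exact ⟨k, Or.inl (neg_injective hk)⟩

/-- The norm of `a + b λ`. -/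
def quadNorm (r σ a b : ℤ) : ℤ := a ^ 2 + a * b * r + b ^ 2 * σ

namespace IsQuadUnit

variable {r σ : ℤ} {lam : ℝ} (h : IsQuadUnit r σ lam)
include h

/-- The Dirichlet group is the unit group of `ℤ[λ]`. The norm equation forces `x ≡ r y` modulo `2`,
so `x = 2a + r y` has an integer solution. -/
lemma mem_dirichletGroup_iff (u : ℝ) : u ∈ dirichletGroup (r ^ 2 - 4 * σ) ↔
    ∃ a b : ℤ, (quadNorm r σ a b = 1 ∨ quadNorm r σ a b = -1) ∧ u = a + b * lam := by
  have hs := h.sqrt_discrim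
  rw [h.conj_eq] at hs
  constructor
  · rintro ⟨x, y, hxy, rfl⟩
    have hev : Even (x - r * y) := by
      have h1 : Even ((x - r * y) ^ 2) := by
        rcases hxy with h2 | h2
        · exact ⟨r ^ 2 * y ^ 2 - 2 * σ * y ^ 2 + 2 - r * x * y, by linear_combination h2⟩
        · exact ⟨r ^ 2 * y ^ 2 - 2 * σ * y ^ 2 - 2 - r * x * y, by linear_combination h2⟩
      exact (Int.even_pow.1 h1).1
    obtain ⟨a, ha⟩ := hev
    obtain rfl : x = 2 * a + r * y := by linarith
    refine ⟨a, y, ?_, ?_⟩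
    · unfold quadNorm
      rcases hxy with h2 | h2
      · left; linarith
      · right; linarith
    · rw [← hs]
      push_cast
      ring
  · rintro ⟨a, b, hab, rfl⟩
    refine ⟨2 * a + r * b, b, ?_, ?_⟩
    · unfold quadNorm at hab
      rcases hab with h2 | h2
      · left; linarith
      · right; linarith
    · rw [← hs]
      push_cast
      ring

lemma lam_mul_mem_dirichletGroup {u : ℝ} (hu : u ∈ dirichletGroup (r ^ 2 - 4 * σ)) :
    lam * u ∈ dirichletGroup (r ^ 2 - 4 * σ) := by
  rw [h.mem_dirichletGroup_iff] at hu ⊢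
  obtain ⟨a, b, hab, rfl⟩ := hu
  refine ⟨-b * σ, a + b * r, ?_, ?_⟩
  · have h1 : quadNorm r σ (-b * σ) (a + b * r) = σ * quadNorm r σ a b := by
      unfold quadNorm; ring
    rw [h1]
    rcases h.sign with ⟨rfl, -⟩ | ⟨rfl, -⟩
    · rw [one_mul]; exact hab
    · rcases hab with h2 | h2 <;> simp [h2]
  · have := h.eqn
    push_cast
    linear_combination (b : ℝ) * this

lemma inv_mul_mem_dirichletGroup {u : ℝ} (hu : u ∈ dirichletGroup (r ^ 2 - 4 * σ)) :
    lam⁻¹ * u ∈ dirichletGroup (r ^ 2 - 4 * σ) := by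
  rw [h.mem_dirichletGroup_iff] at hu ⊢
  obtain ⟨a, b, hab, rfl⟩ := hu
  have hσ : σ * σ = 1 := by
    rcases h.sign with ⟨rfl, -⟩ | ⟨rfl, -⟩ <;> norm_num
  -- Obtained by expanding `σ (r - λ) (a + b λ)`, where `σ (r - λ)` is the inverse of `λ`.
  refine ⟨σ * (r * a + b * σ), -σ * a, ?_, ?_⟩
  · have h1 : quadNorm r σ (σ * (r * a + b * σ)) (-σ * a) = (σ * σ) * σ * quadNorm r σ a b := by
      unfold quadNorm; ring
    rw [h1, hσ, one_mul]
    rcases h.sign with ⟨rfl, -⟩ | ⟨rfl, -⟩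
    · rw [one_mul]; exact hab
    · rcases hab with h2 | h2 <;> simp [h2]
  · have h2 := h.eqn
    have h3 := h.mul_inv
    have h4 : lam⁻¹ = σ * (r - lam) := by
      have h5 := h.conj_eq
      have h6 : (σ : ℝ) * σ = 1 := by exact_mod_cast hσ
      linear_combination (σ : ℝ) * h5 - lam⁻¹ * h6
    rw [h4]
    push_cast
    linear_combination (-(σ : ℝ) * b) * h2

lemma zpow_mul_mem_dirichletGroup {u : ℝ} (hu : u ∈ dirichletGroup (r ^ 2 - 4 * σ)) (k : ℤ) :
    lam ^ k * u ∈ dirichletGroup (r ^ 2 - 4 * σ) := by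
  induction k using Int.induction_on with
  | zero => simpa using hu
  | succ k ih =>
    rw [zpow_add_one₀ h.pos.ne', mul_comm (lam ^ (k : ℤ)), mul_assoc]
    exact h.lam_mul_mem_dirichletGroup ih
  | pred k ih =>
    rw [zpow_sub_one₀ h.pos.ne', mul_comm (lam ^ (-(k : ℤ))), mul_assoc]
    exact h.inv_mul_mem_dirichletGroup ih

omit h in
lemma neg_mem_dirichletGroup {D : ℤ} {u : ℝ} (hu : u ∈ dirichletGroup D) :
    -u ∈ dirichletGroup D := by
  obtain ⟨x, y, hxy, rfl⟩ := hu
  exact ⟨-x, -y, by simpa using hxy, by push_cast; ring⟩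

omit h in
lemma one_mem_dirichletGroup : (1 : ℝ) ∈ dirichletGroup (r ^ 2 - 4 * σ) :=
  ⟨2, 0, Or.inl (by norm_num), by simp⟩

/-- There is no unit strictly between `1` and `λ`. -/
lemma eq_one_of_mem_dirichletGroup (hne : ¬ (r = 3 ∧ σ = 1)) {w : ℝ}
    (hw : w ∈ dirichletGroup (r ^ 2 - 4 * σ)) (h1 : 1 ≤ w) (h2 : w < lam) : w = 1 := by
  by_contra hw1
  have hgt : 1 < w := lt_of_le_of_ne h1 (Ne.symm hw1)
  obtain ⟨x, y, hxy, rfl⟩ := hw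
  have hs := h.sqrt_discrim
  rw [h.conj_eq] at hs
  have hpos : 0 < √((r ^ 2 - 4 * σ : ℤ) : ℝ) := by
    rw [← h.sqrt_discrim]; exact h.lam_sub_conj_pos
  have hsq : √((r ^ 2 - 4 * σ : ℤ) : ℝ) ^ 2 = r ^ 2 - 4 * σ := by
    rw [Real.sq_sqrt (Real.sqrt_pos.1 hpos).le]
    push_cast; ring
  have hlam : lam = (r + √((r ^ 2 - 4 * σ : ℤ) : ℝ)) / 2 := by linarith
  rw [hlam] at h2
  generalize √((r ^ 2 - 4 * σ : ℤ) : ℝ) = s at *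
  -- the conjugate has modulus less than one
  have hconj : |(x - y * s) / 2| < 1 := by
    have h3 : |(x + y * s) / 2| * |(x - y * s) / 2| = 1 := by
      rw [← abs_mul]
      have h4 : ((x : ℝ) + y * s) / 2 * ((x - y * s) / 2) =
          ((x ^ 2 - (r ^ 2 - 4 * σ) * y ^ 2 : ℤ) : ℝ) / 4 := by
        push_cast
        linear_combination (-(y : ℝ) ^ 2 / 4) * hsq
      rw [h4]
      rcases hxy with h5 | h5 <;> rw [h5] <;> norm_num
    rw [abs_of_pos (by linarith : (0 : ℝ) < (x + y * s) / 2)] at h3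
    by_contra! h4
    nlinarith
  rw [abs_lt] at hconj
  have hx : 0 < x := by
    have : (0 : ℝ) < x := by linarith
    exact_mod_cast this
  have hy : 0 < y := by
    have : (0 : ℝ) < y * s := by linarith
    have : (0 : ℝ) < y := (pos_iff_pos_of_mul_pos this).2 hpos
    exact_mod_cast this
  have hxR : (1 : ℝ) ≤ x := by exact_mod_cast hx
  have hyR : (1 : ℝ) ≤ y := by exact_mod_cast hy
  have hxr : x + y * s < r + s := by linarith
  have hxltr : x < r := by
    have : (x : ℝ) < r := by nlinarith
    exact_mod_cast this
  -- For `y = 1` and `σ = -1`, `x²` is `r²` or `r² + 8`, against `x < r`. For `σ = 1` it is `r²` or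
  -- `r² - 8`; the latter forces `r ≤ 4`, where `r = 4` fails and `r = 3` is the excluded case. For
  -- `y ≥ 2` one gets `1 + s < r`, incompatible with `s² = r² - 4σ`.
  rcases (show y = 1 ∨ 2 ≤ y by omega) with rfl | hy2
  · rcases h.sign with ⟨rfl, hr⟩ | ⟨rfl, hr⟩
    · rcases hxy with h5 | h5
      · nlinarith
      · have h6 : r ≤ 4 := by nlinarith
        interval_cases r
        · have : x < 2 := by nlinarith
          exact hne ⟨rfl, rfl⟩
        · have : x < 3 := by nlinarith
          interval_cases x <;> omega
    · rcases hxy with h5 | h5 <;> nlinarith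
  · have hy2R : (2 : ℝ) ≤ y := by exact_mod_cast hy2
    have h6 : 1 + s < r := by nlinarith
    rcases h.sign with ⟨rfl, hr⟩ | ⟨rfl, hr⟩
    · have hrR : (3 : ℝ) ≤ r := by exact_mod_cast hr
      push_cast at hsq
      have h7 : 2 < s := by
        by_contra! h7
        nlinarith
      nlinarith
    · push_cast at hsq
      nlinarith

/-- The Dirichlet group is generated by `-1` and `λ`, but for the square of the golden mean. -/
lemma dirichletGroup_eq (hne : ¬ (r = 3 ∧ σ = 1)) :
    dirichletGroup (r ^ 2 - 4 * σ) = signedPowers lam := by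
  have hpos : ∀ u ∈ dirichletGroup (r ^ 2 - 4 * σ), 0 < u → u ∈ signedPowers lam := by
    intro u hu hu0
    -- A power of `λ` moves the unit into `[1, λ)`, which contains no unit but `1`.
    obtain ⟨k, hk1, hk2⟩ := exists_mem_Ico_zpow hu0 h.one_lt
    have hp : 0 < lam ^ k := zpow_pos h.pos k
    have h1 := h.eq_one_of_mem_dirichletGroup hne (h.zpow_mul_mem_dirichletGroup hu (-k))
      (by rw [zpow_neg, ← div_eq_inv_mul, le_div_iff₀ hp, one_mul]; exact hk1)
      (by rw [zpow_neg, ← div_eq_inv_mul, div_lt_iff₀ hp, ← zpow_one_add₀ h.pos.ne', add_comm]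
          exact hk2)
    refine ⟨k, Or.inl ?_⟩
    rw [zpow_neg, inv_mul_eq_one₀ hp.ne'] at h1
    exact h1.symm
  refine Set.Subset.antisymm (fun u hu => ?_) ?_
  · rcases lt_trichotomy u 0 with h0 | rfl | h0
    · exact neg_mem_signedPowers (hpos _ (neg_mem_dirichletGroup hu) (by linarith))
    · exfalso
      obtain ⟨a, b, hab, h1⟩ := (h.mem_dirichletGroup_iff 0).1 hu
      have hb : b = 0 := by
        by_contra hb
        refine h.irrational ⟨-(a : ℚ) / b, ?_⟩
        have : (b : ℝ) ≠ 0 := by exact_mod_cast hb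
        push_cast
        rw [div_eq_iff this]
        linarith
      subst hb
      have ha : a = 0 := by
        have : (a : ℝ) = 0 := by simpa using h1.symm
        exact_mod_cast this
      subst ha
      simp [quadNorm] at hab
    · exact hpos u hu h0
  · rintro u ⟨k, rfl | rfl⟩
    · simpa using h.zpow_mul_mem_dirichletGroup one_mem_dirichletGroup k
    · exact neg_mem_dirichletGroup
        (by simpa using h.zpow_mul_mem_dirichletGroup one_mem_dirichletGroup k)

end IsQuadUnit

/-- The excluded pair `r = 3`, `σ = 1` has the same discriminant `5` as `r = 1`, `σ = -1`, to which
`dirichletGroup_eq` applies. -/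
lemma isQuadUnit_goldenRatio : IsQuadUnit 1 (-1) ((1 + √5) / 2) := by
  have h5 : √5 ^ 2 = (5 : ℝ) := Real.sq_sqrt (by norm_num)
  have h1 : 1 < √5 := by
    rw [Real.lt_sqrt] <;> norm_num
  refine ⟨by linarith, ?_, Or.inr ⟨rfl, le_rfl⟩⟩
  push_cast
  linear_combination h5 / 4

/-! ### Hyperbolic matrices -/

lemma isQuadUnit_of_hyperbolic {M : GL (Fin 2) ℤ} (hM : IsHyperbolicMatrix M)
    (htr : 0 < M.1.trace) : IsQuadUnit M.1.trace M.1.det (eigen M) := by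
  have hroot : ∀ μ : ℂ, μ ^ 2 - M.1.trace * μ + M.1.det = 0 → ‖μ‖ ≠ 1 := by
    intro μ hμ
    refine hM μ ?_
    rw [spectrum.mem_iff, Matrix.isUnit_iff_isUnit_det, isUnit_iff_ne_zero, not_not,
      Matrix.det_fin_two, ← hμ, Matrix.trace_fin_two, Matrix.det_fin_two]
    simp [Matrix.algebraMap_matrix_apply]
    ring
  have hsign : (M.1.det = 1 ∧ 3 ≤ M.1.trace) ∨ (M.1.det = -1 ∧ 1 ≤ M.1.trace) := by
    rcases Int.isUnit_iff.1 (isUnit_det_coe M) with hd | hd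
    · left
      refine ⟨hd, ?_⟩
      by_contra! hlt
      -- Determinant one with trace `1` or `2` gives a sixth root of unity or `1` as an eigenvalue.
      rcases (show M.1.trace = 1 ∨ M.1.trace = 2 by omega) with ht | ht
      · have h3 : √3 ^ 2 = (3 : ℝ) := Real.sq_sqrt (by norm_num)
        refine hroot ⟨1 / 2, √3 / 2⟩ ?_ ?_
        · rw [hd, ht]
          apply Complex.ext
          · simp [pow_two]
            linear_combination -h3 / 4
          · simp [pow_two]
            ring
        · rw [Complex.norm_def, Complex.normSq_mk, Real.sqrt_eq_one]
          linear_combination h3 / 4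
      · refine hroot 1 ?_ (by simp)
        rw [hd, ht]
        norm_num
    · exact Or.inr ⟨hd, htr⟩
  have hD : (5 : ℤ) ≤ discrim M := by
    unfold discrim
    rcases hsign with ⟨h1, h2⟩ | ⟨h1, h2⟩ <;> rw [h1] <;> nlinarith
  have hDR : (5 : ℝ) ≤ (discrim M : ℝ) := by exact_mod_cast hD
  have hsq : √(discrim M : ℝ) ^ 2 = M.1.trace ^ 2 - 4 * M.1.det := by
    rw [Real.sq_sqrt (by linarith)]
    unfold discrim
    push_cast; ring
  have hgt : 1 < √(discrim M : ℝ) := by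
    rw [Real.lt_sqrt (by norm_num)]
    linarith
  have htR : (1 : ℝ) ≤ M.1.trace := by exact_mod_cast htr
  refine ⟨?_, ?_, hsign⟩
  · unfold eigen; linarith
  · unfold eigen
    linear_combination hsq / 4

/-- Up to sign and the substitution `m = (-y, x)`, the form `f_T` is the determinant of the pair
`m`, `M m`. -/
lemma representsUnit_iff (M : GL (Fin 2) ℤ) :
    RepresentsUnit M ↔ ∃ m, IsUnit (cyclicMat M m).det := by
  have key : ∀ x y : ℤ, (cyclicMat M ![-y, x]).det = -assocForm M x y := fun x y => by
    simp [cyclicMat, assocForm, Matrix.det_fin_two, Matrix.mulVec, dotProduct, Fin.sum_univ_two]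
    ring
  simp only [Int.isUnit_iff]
  constructor
  · rintro ⟨x, y, hxy⟩
    refine ⟨![-y, x], ?_⟩
    rw [key]
    omega
  · rintro ⟨m, hm⟩
    refine ⟨m 1, -m 0, ?_⟩
    have h1 := key (m 1) (-m 0)
    have h2 : ![- -m 0, m 1] = m := by
      funext i; fin_cases i <;> simp
    rw [h2] at h1
    omega

/-! ### Units acting on the codings, and primitivity -/

section
variable {M : GL (Fin 2) ℤ} (hq : IsQuadUnit M.1.trace M.1.det (eigen M))
include hq

lemma admitsBAC_iff : AdmitsBAC M ↔ RepresentsUnit M := by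
  rw [representsUnit_iff]
  constructor
  · rintro ⟨φ, hφ⟩
    obtain ⟨m, hm, -⟩ := hφ.exists_eq_matrixCoding hq
    exact ⟨m, hm⟩
  · rintro ⟨m, hm⟩
    exact ⟨_, isBAC_matrixCoding hq hm⟩

omit hq in
/-- Coordinates with respect to `m` and `M m`. -/
lemma exists_coords {m : Fin 2 → ℤ} (hm : IsUnit (cyclicMat M m).det) (k : Fin 2 → ℤ) :
    ∃ a b : ℤ, k = a • m + b • M.1.mulVec m := by
  set c := (cyclicMat M m)⁻¹.mulVec k with hc
  refine ⟨c 0, c 1, ?_⟩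
  have h1 : (cyclicMat M m).mulVec c = k := by
    rw [hc, Matrix.mulVec_mulVec, Matrix.mul_nonsing_inv _ hm, Matrix.one_mulVec]
  rw [← h1]
  funext i
  fin_cases i <;> simp [cyclicMat, Matrix.mulVec, dotProduct, Fin.sum_univ_two] <;> ring

-- `a + b M` commutes with `M` and has determinant `quadNorm`.
omit hq in
lemma det_cyclicMat_comb (m : Fin 2 → ℤ) (a b : ℤ) :
    (cyclicMat M (a • m + b • M.1.mulVec m)).det =
      quadNorm M.1.trace M.1.det a b * (cyclicMat M m).det := by
  simp [cyclicMat, Matrix.det_fin_two, Matrix.mulVec, dotProduct, Fin.sum_univ_two, quadNorm,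
    Matrix.trace_fin_two]
  ring

lemma homVec_comb (m : Fin 2 → ℤ) (a b : ℤ) :
    homVec M (a • m + b • M.1.mulVec m) = ((a : ℝ) + b * eigen M) • homVec M m := by
  have h2 : realMat (cyclicMat M (a • m + b • M.1.mulVec m)) =
      (a : ℝ) • realMat (cyclicMat M m) + (b : ℝ) • (realMat M.1 * realMat (cyclicMat M m)) := by
    ext i j
    fin_cases i <;> fin_cases j <;>
      simp [realMat, cyclicMat, Matrix.mulVec, dotProduct, Fin.sum_univ_two, Matrix.mul_apply] <;>
      ring
  have h3 := mulVec_homVec hq m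
  unfold homVec at h3 ⊢
  rw [h2, Matrix.add_mulVec, Matrix.smul_mulVec, Matrix.smul_mulVec, ← Matrix.mulVec_mulVec, h3,
    smul_smul, add_smul]

lemma smul_homVec_eq_intVec {m : Fin 2 → ℤ} (hm : IsUnit (cyclicMat M m).det) {s : ℝ}
    {k : Fin 2 → ℤ} (hs : s • homVec M m = intVec k) : s = 0 := by
  refine hq.smul_unstableVec_eq_intVec (k := (cyclicMat M m)⁻¹.mulVec k) ?_
  rw [← realMat_mulVec_intVec, ← hs, Matrix.mulVec_smul, homVec, Matrix.mulVec_mulVec, ← realMat_mul,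
    Matrix.nonsing_inv_mul _ hm, realMat_one, Matrix.one_mulVec]

/-- Every integer vector is `(a + b M) m`. Its matrix has unit determinant exactly when `a + b λ` is
a unit, and its homoclinic vector is then `(a + b λ) v`. Different units give different maps because
the unstable line contains no nonzero integer vector. -/
lemma parametrizesBACs {m : Fin 2 → ℤ} (hm : IsUnit (cyclicMat M m).det) :
    ParametrizesBACs M (dirichletGroup (discrim M)) (homVec M m) := by
  constructor
  · intro u hu
    obtain ⟨a, b, hab, rfl⟩ := (hq.mem_dirichletGroup_iff u).1 hu
    refine ⟨matrixCoding hq (a • m + b • M.1.mulVec m), ⟨isBAC_matrixCoding hq ?_, ?_⟩, ?_⟩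
    · rw [det_cyclicMat_comb]
      exact (Int.isUnit_iff.2 hab).mul hm
    · rw [← homVec_comb hq]
      exact isGivenBy_matrixCoding hq _
    · rintro ψ ⟨-, hψ⟩
      rw [← homVec_comb hq] at hψ
      exact isGivenBy_unique hψ (isGivenBy_matrixCoding hq _)
  · intro φ hφ
    obtain ⟨m', hm', rfl⟩ := hφ.exists_eq_matrixCoding hq
    obtain ⟨a, b, rfl⟩ := exists_coords hm m'
    have hgiv := isGivenBy_matrixCoding hq (a • m + b • M.1.mulVec m)
    rw [homVec_comb hq] at hgiv
    refine ⟨(a : ℝ) + b * eigen M, ⟨(hq.mem_dirichletGroup_iff _).2 ⟨a, b, ?_, rfl⟩, hgiv⟩, ?_⟩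
    · rw [det_cyclicMat_comb] at hm'
      exact Int.isUnit_iff.1 (isUnit_of_mul_isUnit_left hm')
    · rintro u ⟨-, hu⟩
      have h1 := hu.single_zero
      rw [hgiv.single_zero] at h1
      obtain ⟨k, hk⟩ := (torusProj_eq_iff _ _).1 h1.symm
      have h2 := smul_homVec_eq_intVec hq hm
        (s := u - ((a : ℝ) + b * eigen M)) (k := k) (by
          rw [sub_smul, hk, add_sub_cancel_left])
      exact sub_eq_zero.1 h2

/-- A matrix with a cyclic vector is primitive unless its eigenvalue is the square of the golden
mean. -/
lemma isPrimitiveMatrix_of_ne (hr : RepresentsUnit M) (hne : ¬ (M.1.trace = 3 ∧ M.1.det = 1)) :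
    IsPrimitiveMatrix M := by
  rintro ⟨K, n, hn, hK⟩
  obtain ⟨m, hm⟩ := (representsUnit_iff M).1 hr
  -- `K` commutes with `M`, so it acts on the unstable line as the number `a + b λ`. Its norm is the
  -- determinant of `K`, so this number is a unit, and its `n`-th power is `λ`.
  obtain ⟨a, b, hab⟩ := exists_coords hm (K.1.mulVec m)
  have hcomm : K.1 * M.1 = M.1 * K.1 := by
    have : K * M = M * K := by rw [hK, ← pow_succ, ← pow_succ']
    rw [← Units.val_mul, this, Units.val_mul]
  have hmulK : cyclicMat M (K.1.mulVec m) = K.1 * cyclicMat M m := by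
    have h1 : M.1.mulVec (K.1.mulVec m) = K.1.mulVec (M.1.mulVec m) := by
      rw [Matrix.mulVec_mulVec, Matrix.mulVec_mulVec, hcomm]
    unfold cyclicMat
    rw [h1]
    ext i j
    fin_cases i <;> fin_cases j <;>
      simp [Matrix.mul_apply, Matrix.mulVec, dotProduct, Fin.sum_univ_two]
  have hnorm : quadNorm M.1.trace M.1.det a b = K.1.det := by
    have h1 := det_cyclicMat_comb (M := M) m a b
    rw [← hab, hmulK, Matrix.det_mul] at h1
    exact (mul_right_cancel₀ hm.ne_zero h1).symm
  set κ : ℝ := a + b * eigen M with hκ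
  have hKv : (realMat K.1).mulVec (homVec M m) = κ • homVec M m := by
    rw [hκ, ← homVec_comb hq, ← hab]
    unfold homVec
    rw [Matrix.mulVec_mulVec, ← realMat_mul, hmulK]
  have hKn : ∀ j : ℕ, (realMat (K ^ j).1).mulVec (homVec M m) = κ ^ j • homVec M m := by
    intro j
    induction j with
    | zero => simp [realMat_one]
    | succ j ih =>
      rw [pow_succ', Units.val_mul, realMat_mul, ← Matrix.mulVec_mulVec, ih, Matrix.mulVec_smul, hKv,
        smul_smul, pow_succ]
  have h2 := hKn n
  rw [← hK, mulVec_homVec hq] at h2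
  have h3 : eigen M = κ ^ n := by
    rw [← sub_eq_zero]
    refine smul_homVec_eq_intVec hq hm (k := 0) ?_
    rw [sub_smul, h2, sub_self]
    funext i; simp [intVec]
  have h4 : κ ∈ signedPowers (eigen M) := by
    rw [← hq.dirichletGroup_eq hne, hq.mem_dirichletGroup_iff]
    exact ⟨a, b, by rw [hnorm]; exact Int.isUnit_iff.1 (isUnit_det_coe K), hκ⟩
  obtain ⟨k, hk⟩ := h4
  have h5 : |κ| = eigen M ^ k := by
    have := zpow_pos hq.pos k
    rcases hk with hk | hk <;> rw [hk]
    · exact abs_of_pos this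
    · rw [abs_neg, abs_of_pos this]
  have h6 : eigen M ^ (1 : ℤ) = eigen M ^ (k * n) := by
    rw [zpow_one, zpow_mul, ← h5, zpow_natCast, ← abs_pow, ← h3, abs_of_pos hq.pos]
  -- The unit is `±λ^k`, so comparing exponents in absolute value gives `k n = 1`, impossible for `n
  -- ≥ 2`.
  have h7 : (1 : ℤ) = k * n := zpow_right_injective₀ hq.pos hq.one_lt.ne' h6
  have h8 : (n : ℤ) ∣ 1 := ⟨k, by rw [h7]; ring⟩
  have := Int.le_of_dvd one_pos h8
  omega

end

/-! ### The exceptional case: trace three and determinant one -/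

lemma coe_fibMatrix : (fibMatrix).1 = !![1, 1; 1, 0] := rfl

lemma det_sub_one {M : GL (Fin 2) ℤ} (ht : M.1.trace = 3) (hd : M.1.det = 1) :
    (M.1 - 1).det = -1 := by
  rw [Matrix.trace_fin_two] at ht
  rw [Matrix.det_fin_two] at hd ⊢
  simp
  linear_combination hd - ht

/-- Cayley–Hamilton: `M² - 2 M + 1 = M` when `M² - 3 M + 1 = 0`. -/
lemma sub_one_mul_self {M : GL (Fin 2) ℤ} (ht : M.1.trace = 3) (hd : M.1.det = 1) :
    (M.1 - 1) * (M.1 - 1) = M.1 := by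
  rw [Matrix.trace_fin_two] at ht
  rw [Matrix.det_fin_two] at hd
  ext i j
  fin_cases i <;> fin_cases j <;> simp [Matrix.mul_apply, Fin.sum_univ_two]
  · linear_combination M.1 0 0 * ht - hd
  · linear_combination M.1 0 1 * ht
  · linear_combination M.1 1 0 * ht
  · linear_combination M.1 1 1 * ht - hd

/-- The square root `M - 1` of a matrix with trace `3` and determinant `1`. -/
noncomputable def sqrtMatrix {M : GL (Fin 2) ℤ} (ht : M.1.trace = 3) (hd : M.1.det = 1) :
    GL (Fin 2) ℤ :=
  Matrix.GeneralLinearGroup.mk'' (M.1 - 1) (by rw [det_sub_one ht hd]; simp)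

lemma eq_sqrtMatrix_sq {M : GL (Fin 2) ℤ} (ht : M.1.trace = 3) (hd : M.1.det = 1) :
    M = sqrtMatrix ht hd ^ 2 := by
  apply Units.ext
  rw [pow_two, Units.val_mul]
  exact (sub_one_mul_self ht hd).symm

lemma isFibSquare_of_trace_det {M : GL (Fin 2) ℤ} (hr : RepresentsUnit M) (ht : M.1.trace = 3)
    (hd : M.1.det = 1) : IsFibSquare M := by
  refine ⟨sqrtMatrix ht hd, ?_, eq_sqrtMatrix_sq ht hd⟩
  obtain ⟨m, hm⟩ := (representsUnit_iff M).1 hr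
  -- The columns are `(M - 1) m` and `m`. Since `(M - 1)² m = M m = (M - 1) m + m`, in this basis `M
  -- - 1` is the Fibonacci matrix.
  set P : Matrix (Fin 2) (Fin 2) ℤ :=
    !![M.1.mulVec m 0 - m 0, m 0; M.1.mulVec m 1 - m 1, m 1] with hP
  have hPdet : IsUnit P.det := by
    have : P.det = -(cyclicMat M m).det := by
      simp [hP, cyclicMat, Matrix.det_fin_two]
      ring
    rw [this]
    exact hm.neg
  refine IsConj.symm ⟨toUnits (Matrix.GeneralLinearGroup.mk'' P hPdet), ?_⟩
  apply Units.ext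
  rw [Units.val_mul, Units.val_mul]
  change P * !![1, 1; 1, 0] = (M.1 - 1) * P
  rw [Matrix.trace_fin_two] at ht
  rw [Matrix.det_fin_two] at hd
  ext i j
  fin_cases i <;> fin_cases j <;>
    simp [hP, Matrix.mul_apply, Fin.sum_univ_two, Matrix.mulVec, dotProduct]
  · linear_combination (-(M.1 0 0) * m 0 - M.1 0 1 * m 1) * ht + m 0 * hd
  · ring
  · linear_combination (-(M.1 1 0) * m 0 - M.1 1 1 * m 1) * ht + m 1 * hd
  · ring

lemma IsFibSquare.trace_det {M : GL (Fin 2) ℤ} (hM : IsFibSquare M) :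
    M.1.trace = 3 ∧ M.1.det = 1 ∧ RepresentsUnit M := by
  obtain ⟨K, hK, rfl⟩ := hM
  obtain ⟨c, hc⟩ := hK.symm
  have hF : fibMatrix.1 ^ 2 = !![2, 1; 1, 1] := by
    rw [coe_fibMatrix, pow_two]
    simp
  have h1 : (K ^ 2) = (c : GL (Fin 2) ℤ) * fibMatrix ^ 2 * (c : GL (Fin 2) ℤ)⁻¹ := by
    rw [eq_mul_inv_iff_mul_eq]
    exact ((hc.pow_right 2).eq).symm
  have h2 : (K ^ 2).1 = c.1.1 * !![2, 1; 1, 1] * (c.1.1)⁻¹ := by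
    rw [h1, Units.val_mul, Units.val_mul, Units.val_pow_eq_pow_val, hF, Matrix.coe_units_inv]
  have hcu : IsUnit c.1.1.det := isUnit_det_coe c.1
  have h3 : (K ^ 2).1 * c.1.1 = c.1.1 * !![2, 1; 1, 1] := by
    rw [h2, mul_assoc, Matrix.nonsing_inv_mul _ hcu, mul_one]
  refine ⟨?_, ?_, ?_⟩
  · rw [h2, Matrix.trace_mul_comm, ← mul_assoc, Matrix.nonsing_inv_mul _ hcu, one_mul]
    simp [Matrix.trace_fin_two]
  · have h4 := congrArg Matrix.det h3
    rw [Matrix.det_mul, Matrix.det_mul, mul_comm] at h4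
    have h5 := mul_left_cancel₀ hcu.ne_zero h4
    rw [h5]
    simp [Matrix.det_fin_two]
  · rw [representsUnit_iff]
    -- The first basis vector is cyclic for the squared Fibonacci matrix, whose first column is `(2,
    -- 1)`; the conjugating matrix carries it to its own first column.
    refine ⟨fun i => c.1.1 i 0, ?_⟩
    have h5 : cyclicMat (K ^ 2) (fun i => c.1.1 i 0) = c.1.1 * !![1, 2; 0, 1] := by
      have h6 : ∀ i, (K ^ 2).1.mulVec (fun i => c.1.1 i 0) i = c.1.1 i 0 * 2 + c.1.1 i 1 := by
        intro i
        have := congrFun (congrFun h3 i) 0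
        simpa [Matrix.mul_apply, Fin.sum_univ_two, Matrix.mulVec, dotProduct] using this
      unfold cyclicMat
      rw [h6, h6]
      ext i j
      fin_cases i <;> fin_cases j <;> simp [Matrix.mul_apply, Fin.sum_univ_two]
    rw [h5, Matrix.det_mul]
    refine hcu.mul ?_
    simp [Matrix.det_fin_two]

lemma eigen_of_trace_det {M : GL (Fin 2) ℤ} (ht : M.1.trace = 3) (hd : M.1.det = 1) :
    eigen M = (3 + √5) / 2 := by
  unfold eigen discrim
  rw [ht, hd]
  norm_num

lemma sqrt_eigen_of_trace_det {M : GL (Fin 2) ℤ} (ht : M.1.trace = 3) (hd : M.1.det = 1) :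
    √(eigen M) = (1 + √5) / 2 := by
  rw [eigen_of_trace_det ht hd, Real.sqrt_eq_iff_mul_self_eq_of_pos (by positivity)]
  have h5 : √5 ^ 2 = (5 : ℝ) := Real.sq_sqrt (by norm_num)
  linear_combination h5 / 4

lemma dirichletGroup_of_trace_det {M : GL (Fin 2) ℤ} (ht : M.1.trace = 3) (hd : M.1.det = 1) :
    dirichletGroup (discrim M) = signedPowers ((1 + √5) / 2) := by
  rw [← isQuadUnit_goldenRatio.dirichletGroup_eq (by norm_num), discrim, ht, hd]
  norm_num

end ArithmeticCoding

open ArithmeticCoding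
theorem theorem2p6 (M : GL (Fin 2) ℤ) (hM : IsHyperbolicMatrix M) (htr : 0 < M.1.trace) :
    (AdmitsBAC M ↔ RepresentsUnit M) ∧
    (AdmitsBAC M → IsPrimitiveMatrix M ∨ IsFibSquare M) ∧
    (IsFibSquare M → ¬ IsPrimitiveMatrix M ∧ AdmitsBAC M) ∧
    (RepresentsUnit M → IsPrimitiveMatrix M →
      dirichletGroup (discrim M) = signedPowers (eigen M) ∧
      ∃ v : Fin 2 → ℝ, IsHomoclinicCoord M v ∧
        ParametrizesBACs M (signedPowers (eigen M)) v) ∧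
    (RepresentsUnit M → ¬ IsPrimitiveMatrix M →
      eigen M = (3 + √5) / 2 ∧ √(eigen M) = (1 + √5) / 2 ∧
      dirichletGroup (discrim M) = signedPowers ((1 + √5) / 2) ∧
      ∃ v : Fin 2 → ℝ, IsHomoclinicCoord M v ∧
        ParametrizesBACs M (signedPowers ((1 + √5) / 2)) v) := by
  have hq := isQuadUnit_of_hyperbolic hM htr
  have hadm := admitsBAC_iff hq
  have hnot : M.1.trace = 3 ∧ M.1.det = 1 → ¬ IsPrimitiveMatrix M := fun h hp =>
    hp ⟨_, 2, le_rfl, eq_sqrtMatrix_sq h.1 h.2⟩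
  refine ⟨hadm, fun h => ?_, fun h => ?_, fun hr hp => ?_, fun hr hp => ?_⟩
  · by_cases h3 : M.1.trace = 3 ∧ M.1.det = 1
    · exact Or.inr (isFibSquare_of_trace_det (hadm.1 h) h3.1 h3.2)
    · exact Or.inl (isPrimitiveMatrix_of_ne hq (hadm.1 h) h3)
  · obtain ⟨ht, hd, hr⟩ := h.trace_det
    exact ⟨hnot ⟨ht, hd⟩, hadm.2 hr⟩
  · obtain ⟨m, hm⟩ := (representsUnit_iff M).1 hr
    have hD : dirichletGroup (discrim M) = signedPowers (eigen M) :=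
      hq.dirichletGroup_eq fun h => hnot h hp
    exact ⟨hD, homVec M m, isHomoclinicCoord_homVec hq m, hD ▸ parametrizesBACs hq hm⟩
  · obtain ⟨m, hm⟩ := (representsUnit_iff M).1 hr
    obtain ⟨ht, hd⟩ : M.1.trace = 3 ∧ M.1.det = 1 := by
      by_contra h3
      exact hp (isPrimitiveMatrix_of_ne hq hr h3)
    have hD := dirichletGroup_of_trace_det ht hd
    exact ⟨eigen_of_trace_det ht hd, sqrt_eigen_of_trace_det ht hd, hD, homVec M m,
      isHomoclinicCoord_homVec hq m, hD ▸ parametrizesBACs hq hm⟩
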